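/- Let $\alpha\in\mathbb R$, $\beta<0$, $V(q)=\frac12q^2+\frac{\alpha}{3}q^3+\frac{\beta}{4}q^4$, $H_0(p,q)=\frac{p^2}{2}+V(q)$, and let $E_{\max}$ be the smaller of the two values of $V$ at $\frac{-\alpha\pm\sqrt{\alpha^2-4\beta}}{2\beta}$ (its two maxima). Then $$E_{\max}=\begin{cases}\dfrac{(\alpha-\sqrt{\alpha^2-4\beta})^2\,\bigl(\alpha(\sqrt{\alpha^2-4\beta}-\alpha)+6\beta\bigr)}{96\beta^3},&\alpha\ge0,\\[2mm] -\dfrac{(\sqrt{\alpha^2-4\beta}+\alpha)^2\,\bigl(\alpha(\sqrt{\alpha^2-4\beta}+\alpha)-6\beta\bigr)}{96\beta^3},&\alpha\le0.\end{cases}$$ For $0<\xi<E_{\max}$ the polynomial $\xi-V(q)$ has exactly four distinct real roots $a>b>c>d$ (functions of $\xi$), and the oscillation of energy $\xi$ around $q=0$ has turning points $c$ and $b$. Let $I(\xi)=\frac1{2\pi}\oint p\,dq$ be its action and $\theta=\frac{\partial}{\partial I}\int p\,dx$ the conjugate angle, where the integral runs along the phase curve from the left turning point $c$, first along $p\ge0$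 and then along $p\le0$. The function $I$ is strictly increasing and has a differentiable inverse $H_0(I)$ on $I\bigl((0,E_{\max})\bigr)$. The angle is well defined, and it is a bijection of the open upper branch onto $(0,\pi)$ and of the open lower branch onto $(\pi,2\pi)$. The displacement $q(\theta,\xi)$ is continuous and $2\pi$-periodic in $\theta$. Let $q_1(\xi)=\frac1{2\pi}\int_0^{2\pi}q(\theta,\xi)e^{-i\theta}\,d\theta$; it is a differentiable function of the action. Let $\mathbf K(k)$, $\mathbf E(k)$, $\mathbf\Pi(n,k)=\int_0^{\pi/2}\frac{dt}{(1-n\sin^2t)\sqrt{1-k^2\sin^2t}}$ be the complete elliptic integrals with modulus $k$, and put $$k=\sqrt{\frac{(b-c)(a-d)}{(a-c)(b-d)}}\in(0,1),\qquad k'=\sqrt{1-k^2},\qquad \gamma^2=\frac{b-c}{b-d}.$$ **(i)** The action $J(\xi)=I(\xi)$ is $$\begin{aligned}J=\frac{\sqrt{2|\beta|}}{48\pi\sqrt{(a-c)(b-d)}}\Bigl(&\mathbf E(k)(a-c)(b-d)\bigl(3a^2-2a(b+c+d)+3b^2-2b(c+d)+3c^2-2cd+3d^2\bigr)\\&-(c-d)\bigl(\mathbf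 K(k)(d-b)(a^2+a(-4b-4c+6d)+3b^2-2bc+3c^2-3d^2)\\&\quad+3\mathbf\Pi(\gamma^2,k)\bigl(a^3-a^2(b+c+d)-a(b^2-2b(c+d)+(c-d)^2)\\&\quad\quad+b^3-b^2(c+d)-b(c-d)^2+(c-d)^2(c+d)\bigr)\bigr)\Bigr).\end{aligned}$$ **(ii)** There is exactly one $\nu\in\mathbb C$ with $\operatorname{Re}\nu=\mathbf K(k')$, $0<\operatorname{Im}\nu<\mathbf K(k)$ and $\operatorname{cn}(\nu,k')=-i\sqrt{\frac{b-c}{c-d}}$. With $\omega=\frac{\pi(\mathbf K(k')-\nu)}{2\mathbf K(k)}$, $\omega_0=\frac{\pi\mathbf K(k')}{2\mathbf K(k)}$ and $\sqrt{(b-d)(c-a)}=i\sqrt{(b-d)(a-c)}$, $$q_1=-G,\qquad G=\frac{\pi\sqrt{(b-d)(c-a)}\,\sinh(2\omega)}{2\mathbf K(k)\sinh(2\omega_0)} .$$ $G$ is real: $G=\frac{\pi\sqrt{(b-d)(a-c)}\,\sin(\pi\tau/\mathbf K(k))}{2\mathbf K(k)\sinh(2\omega_0)}$ for some $\tau$ with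 $0<\tau<\mathbf K(k)$ and $\operatorname{cn}(\tau,k)=\sqrt{\frac{c-d}{a-d}}$. **(iii)** For all real $F,\Omega,\vartheta$ and all $\xi\in(0,E_{\max})$, $$C(\vartheta,\xi):=\xi-\frac{iF}{2}\bigl(q_1(\xi)e^{i\vartheta}-\bar q_1(\xi)e^{-i\vartheta}\bigr)-\Omega J(\xi)=\xi-F\,G(\xi)\sin\vartheta-\Omega J(\xi),$$ with the closed forms of $G$ and $J$ above, and this is a first integral of the averaged slow flow $$\dot J=-\frac F2\bigl(q_1e^{i\vartheta}+\bar q_1e^{-i\vartheta}\bigr),\qquad \dot\vartheta=\frac{dH_0}{dJ}-\frac{iF}2\Bigl(\frac{dq_1}{dJ}e^{i\vartheta}-\frac{d\bar q_1}{dJ}e^{-i\vartheta}\Bigr)-\Omega:$$ along every solution $(J(t),\vartheta(t))$ on a time interval with $J(t)\in I\bigl((0,E_{\max})\bigr)$, the quantity $C(\vartheta(t),H_0(J(t)))$ is constant. -/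

import Mathlib

open Set Real

noncomputable section

namespace QuarticEscape

/-! ### Elliptic integrals and Jacobi elliptic functions (modulus convention) -/

/-- Incomplete elliptic integral of the first kind `F(φ, k)`. -/
def ellipticF (k φ : ℝ) : ℝ := ∫ t in (0 : ℝ)..φ, 1 / √(1 - k ^ 2 * sin t ^ 2)

/-- Complete elliptic integral of the first kind `K(k)`. -/
def ellipticK (k : ℝ) : ℝ := ellipticF k (π / 2)

/-- Complete elliptic integral of the second kind `E(k)`. -/
def ellipticE (k : ℝ) : ℝ := ∫ t in (0 : ℝ)..(π / 2), √(1 - k ^ 2 * sin t ^ 2)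

/-- Complete elliptic integral of the third kind `Π(n, k)`. -/
def ellipticPi (n k : ℝ) : ℝ :=
  ∫ t in (0 : ℝ)..(π / 2), 1 / ((1 - n * sin t ^ 2) * √(1 - k ^ 2 * sin t ^ 2))

/-- Jacobi amplitude: the inverse of `φ ↦ F(φ, k)`, a bijection of `ℝ` for `0 ≤ k < 1`. -/
def jacobiAm (u k : ℝ) : ℝ := Function.invFun (ellipticF k) u

def jacobiSn (u k : ℝ) : ℝ := sin (jacobiAm u k)

def jacobiCn (u k : ℝ) : ℝ := cos (jacobiAm u k)

def jacobiDn (u k : ℝ) : ℝ := √(1 - k ^ 2 * jacobiSn u k ^ 2)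

/-- The complementary modulus `k' = √(1 - k²)`. -/
def complModulus (k : ℝ) : ℝ := √(1 - k ^ 2)

/-- The function `cn(z, k)` of a complex argument `z = x + i y`, expressed through the Jacobi
functions of the real arguments `x` (modulus `k`) and `y` (modulus `k'`):
`cn(x + i y, k) = (c c₁ - i s d s₁ d₁) / (c₁² + k² s² s₁²)`. -/
def jacobiCnC (z : ℂ) (k : ℝ) : ℂ :=
  ((jacobiCn z.re k * jacobiCn z.im (complModulus k) : ℝ) -
      Complex.I * (jacobiSn z.re k * jacobiDn z.re k *
        (jacobiSn z.im (complModulus k) * jacobiDn z.im (complModulus k)) : ℝ)) /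
    (jacobiCn z.im (complModulus k) ^ 2 + k ^ 2 * jacobiSn z.re k ^ 2 * jacobiSn z.im (complModulus k) ^ 2 : ℝ)

/-! ### The potential, and action-angle variables in the well around `q = 0` -/

/-- The quartic potential `V`. -/
def potential (α β q : ℝ) : ℝ := q ^ 2 / 2 + α / 3 * q ^ 3 + β / 4 * q ^ 4

/-- The height of the barrier: for `β < 0`, the smaller of the two maxima of the potential. -/
def barrier (α β : ℝ) : ℝ :=
  min (potential α β ((-α + √(α ^ 2 - 4 * β)) / (2 * β)))
    (potential α β ((-α - √(α ^ 2 - 4 * β)) / (2 * β)))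

/-- Left turning point of the oscillation of energy `E` around `0`. -/
def qLeft (α β E : ℝ) : ℝ := sSup {q | q < 0 ∧ potential α β q = E}

/-- Right turning point of the oscillation of energy `E` around `0`. -/
def qRight (α β E : ℝ) : ℝ := sInf {q | 0 < q ∧ potential α β q = E}

/-- The momentum `p(q, E)` on the upper branch of the phase curve; the lower branch is its
negative. -/
def momentum (α β q E : ℝ) : ℝ := √(2 * (E - potential α β q))

/-- `∫ p dx` along the phase curve, from the left turning point to the point of the upper branch
over `q`. -/
def phaseUp (α β q E : ℝ) : ℝ := ∫ x in (qLeft α β E)..q, momentum α β x E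

/-- `∫ p dx` along the phase curve, from the left turning point through the whole upper branch,
and then back along the lower branch to the point over `q`. -/
def phaseDown (α β q E : ℝ) : ℝ :=
  (∫ x in (qLeft α β E)..(qRight α β E), momentum α β x E) +
    ∫ x in (qRight α β E)..q, -momentum α β x E

/-- The action `I(E) = (1 / 2π) ∮ p dq`, over the phase curve of energy `E` around the origin. -/
def actionVar (α β E : ℝ) : ℝ := 1 / (2 * π) * phaseDown α β (qLeft α β E) E

/-- `H₀` as a function of the action: the inverse of `E ↦ I(E)` on `(0, E_max)`. -/
def energyOfAction (α β I : ℝ) : ℝ := Function.invFunOn (actionVar α β) (Ioo 0 (barrier α β)) I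

/-- The angle `θ = ∂/∂I ∫ p(x, I) dx` at the point of the upper branch over `q`. -/
def angleUp (α β E q : ℝ) : ℝ :=
  deriv (fun I => phaseUp α β q (energyOfAction α β I)) (actionVar α β E)

/-- The angle `θ = ∂/∂I ∫ p(x, I) dx` at the point of the lower branch over `q`. -/
def angleDown (α β E q : ℝ) : ℝ :=
  deriv (fun I => phaseDown α β q (energyOfAction α β I)) (actionVar α β E)

open Classical in
/-- The displacement `q(θ, E)`, `2π`-periodic in the angle `θ`: on the upper branch for
`0 < θ < π`, on the lower branch for `π < θ < 2π`, at the turning points for `θ = 0` and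
`θ = π`. -/
def position (α β E θ : ℝ) : ℝ :=
  let φ := toIcoMod Real.two_pi_pos 0 θ
  if φ = 0 then qLeft α β E
  else if φ < π then Function.invFunOn (angleUp α β E) (Ioo (qLeft α β E) (qRight α β E)) φ
  else if φ = π then qRight α β E
  else Function.invFunOn (angleDown α β E) (Ioo (qLeft α β E) (qRight α β E)) φ

/-- The Fourier coefficient `q_m = (1 / 2π) ∫₀^{2π} q(θ, E) e^{-imθ} dθ`. -/
def qHarmonic (α β : ℝ) (m : ℤ) (E : ℝ) : ℂ :=
  fourierCoeffOn Real.two_pi_pos (fun θ => (position α β E θ : ℂ)) m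

/-- The first harmonic as a function of the averaged action. -/
def harmonicOfAction (α β J : ℝ) : ℂ := qHarmonic α β 1 (energyOfAction α β J)

/-! ### The averaged slow flow of the principal resonance, and its first integral -/

open ComplexConjugate in
/-- `(J, ϑ)` solves, on the time interval `s` and inside the well, the averaged system
`J' = -(F/2) (q₁ e^{iϑ} + q̄₁ e^{-iϑ})`,
`ϑ' = dH₀/dJ - (iF/2) (dq₁/dJ e^{iϑ} - dq̄₁/dJ e^{-iϑ}) - Ω`,
which is the Hamiltonian system of `H₀(J) - (iF/2) (q₁ e^{iϑ} - q̄₁ e^{-iϑ}) - Ω J`. -/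
def IsSlowFlow (α β F Ω : ℝ) (s : Set ℝ) (J ϑ : ℝ → ℝ) : Prop :=
  ∀ t ∈ s, J t ∈ actionVar α β '' Ioo 0 (barrier α β) ∧
    HasDerivWithinAt (fun r => (J r : ℂ))
      (-(F / 2 : ℂ) * (harmonicOfAction α β (J t) * Complex.exp (Complex.I * ϑ t) +
        conj (harmonicOfAction α β (J t)) * Complex.exp (-Complex.I * ϑ t))) s t ∧
    HasDerivWithinAt (fun r => (ϑ r : ℂ))
      ((deriv (energyOfAction α β) (J t) : ℝ) -
        Complex.I * F / 2 *
          (deriv (harmonicOfAction α β) (J t) * Complex.exp (Complex.I * ϑ t) -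
            deriv (fun j => conj (harmonicOfAction α β j)) (J t) *
              Complex.exp (-Complex.I * ϑ t)) - Ω) s t

open ComplexConjugate in
/-- `C(ϑ, ξ) = ξ - (iF/2) (q₁(ξ) e^{iϑ} - q̄₁(ξ) e^{-iϑ}) - Ω J(ξ)`. -/
def conservedQuantity (α β F Ω ϑ ξ : ℝ) : ℂ :=
  ξ - Complex.I * F / 2 * (qHarmonic α β 1 ξ * Complex.exp (Complex.I * ϑ) -
    conj (qHarmonic α β 1 ξ) * Complex.exp (-Complex.I * ϑ)) - Ω * actionVar α β ξ

/-! ### The closed forms for the inverted quartic potential -/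

/-- `a > b > c > d` are the roots of `ξ - V(q)`. -/
def IsDescendingRoots (α β ξ a b c d : ℝ) : Prop :=
  b < a ∧ c < b ∧ d < c ∧
    ∀ q, ξ - potential α β q = 0 ↔ q = a ∨ q = b ∨ q = c ∨ q = d

/-- The modulus `k`. -/
def modulus (a b c d : ℝ) : ℝ := √((b - c) * (a - d) / ((a - c) * (b - d)))

/-- The parameter `γ²`. -/
def gammaSq (b c d : ℝ) : ℝ := (b - c) / (b - d)

/-- The closed form of the averaged action `J`. -/
def closedAction (β a b c d : ℝ) : ℝ :=
  √(2 * |β|) / (48 * π * √((a - c) * (b - d))) *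
    (ellipticE (modulus a b c d) * (a - c) * (b - d) *
        (3 * a ^ 2 - 2 * a * (b + c + d) + 3 * b ^ 2 - 2 * b * (c + d) + 3 * c ^ 2
          - 2 * c * d + 3 * d ^ 2) -
      (c - d) *
        (ellipticK (modulus a b c d) * (d - b) *
            (a ^ 2 + a * (-4 * b - 4 * c + 6 * d) + 3 * b ^ 2 - 2 * b * c + 3 * c ^ 2
              - 3 * d ^ 2) +
          3 * ellipticPi (gammaSq b c d) (modulus a b c d) *
            (a ^ 3 - a ^ 2 * (b + c + d) - a * (b ^ 2 - 2 * b * (c + d) + (c - d) ^ 2)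
              + b ^ 3 - b ^ 2 * (c + d) - b * (c - d) ^ 2 + (c - d) ^ 2 * (c + d))))

/-- `ν = cn⁻¹(√((b - c) / (d - c)), k')`, with the negative imaginary square root, on the branch
`Re ν = K(k')`, `0 < Im ν < K(k)`. -/
def IsNu (a b c d : ℝ) (ν : ℂ) : Prop :=
  ν.re = ellipticK (complModulus (modulus a b c d)) ∧
    ν.im ∈ Ioo 0 (ellipticK (modulus a b c d)) ∧
    jacobiCnC ν (complModulus (modulus a b c d)) = -Complex.I * (√((b - c) / (c - d)) : ℝ)

/-- `ω = π (K(k') - ν) / (2 K(k))`. -/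
def omega (a b c d : ℝ) (ν : ℂ) : ℂ :=
  π * (ellipticK (complModulus (modulus a b c d)) - ν) / (2 * ellipticK (modulus a b c d))

/-- `ω₀ = π K(k') / (2 K(k))`. -/
def omegaZero (a b c d : ℝ) : ℝ :=
  π * ellipticK (complModulus (modulus a b c d)) / (2 * ellipticK (modulus a b c d))

/-- `G = π √((b - d)(c - a)) sinh(2ω) / (2 K(k) sinh(2ω₀))`, where `c < a` and the square root is
`i √((b - d)(a - c))`. -/
def closedG (a b c d : ℝ) (ν : ℂ) : ℂ :=
  π * (Complex.I * (√((b - d) * (a - c)) : ℝ)) * Complex.sinh (2 * omega a b c d ν) /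
    (2 * ellipticK (modulus a b c d) * Complex.sinh (2 * omegaZero a b c d))

end QuarticEscape

end

open QuarticEscape

/-! Below the barrier, `ξ - V(q)` equals `-β/4 (a-q)(b-q)(q-c)(q-d)`. The substitution `q = d +
(c-d)/(1 - γ² sin² t)` carries `[0, π/2]` onto `[c, b]` and turns each of the four factors into a
fraction over `1 - γ² sin² t` whose numerator is constant or a constant times `sin²`, `cos²` or `1 -
k² sin²` (`quartic_ampPos`). Hence `dq/p` becomes a constant times `dt/√(1 - k² sin² t)`, and time
along the orbit is an elliptic integral of the first kind.

Action and angle. The energy derivative of `∫ p dq` is `∫ dq/p`. It is obtained in integrated form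
by Fubini (`integral_sqrt_sub_eq_integral`). The moving endpoints do no harm, because the real
square root vanishes outside the well, so that the interval of integration can be frozen. Dividing
by `dI/dE` gives the angle `π F(φ,k)/K(k)` on the upper branch and `2π` minus this on the lower one.
Inverting, the displacement is `d + (c-d)/(1 - γ² sn²(Kθ/π))` for every `θ`
(`RootFamily.position_eq`). In the action itself `p dq` becomes a multiple of `sin² cos² Δ/(1 - γ²
sin²)⁴` with `Δ = √(1 - k² sin²)`, which differs from a combination of the integrands of `E`, `K`,
`Π` by an exact derivative (`hasDerivAt_reduction`, `closedAction_eq_integral`).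

First harmonic. The displacement is even in `θ`, so `q₁` is real and reduces to the integral of
`cos(πu/K)/(1 - γ² sn² u)` over `[0, K]`. Writing `γ² = k² sn² τ`, the function `1/(1 - γ² sn² z)`
has a single pole in the closed rectangle with vertices `0, K, K + iK', iK'`, namely `τ + iK'` on
the top side. An elementary function of `cos(π(z - iK')/K)` with the same pole is subtracted, and
Cauchy's theorem is applied to the remainder times `sin(π(z - iK')/K)`. Reality on the sides leaves
only the bottom one (`integral_cos_div_one_sub_sn_sq`). For this, `sn` of a complex argument is
given by the addition formula and shown holomorphic through the Cauchy–Riemann equations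
(`hasDerivAt_snC`). The auxiliary `ν` is `K' + iτ`, whence the form with `sinh(2ω)`.

First integral. As `q₁ = -G` is real, the slow flow is the Hamiltonian system of `H₀(J) - F G sin ϑ
- Ω J`, which is therefore constant along solutions. Differentiability of `G` in the action comes
from that of the roots in `ξ` and of `F(φ,k)` in both arguments. -/

noncomputable section

namespace QuarticEscape

/-! ### Real elliptic integrals and Jacobi functions -/

section Jacobi

variable {k : ℝ}

lemma one_sub_mul_sin_sq_pos (hk : k ^ 2 < 1) (t : ℝ) : 0 < 1 - k ^ 2 * sin t ^ 2 := by
  nlinarith [sin_sq_le_one t, sq_nonneg k, sq_nonneg (sin t)]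

lemma sqrt_one_sub_mul_sin_sq_pos (hk : k ^ 2 < 1) (t : ℝ) : 0 < √(1 - k ^ 2 * sin t ^ 2) :=
  sqrt_pos.2 (one_sub_mul_sin_sq_pos hk t)

lemma continuous_one_div_sqrt (hk : k ^ 2 < 1) :
    Continuous fun t : ℝ => 1 / √(1 - k ^ 2 * sin t ^ 2) :=
  continuous_const.div (by fun_prop) fun t => (sqrt_one_sub_mul_sin_sq_pos hk t).ne'

lemma hasDerivAt_ellipticF (hk : k ^ 2 < 1) (φ : ℝ) :
    HasDerivAt (ellipticF k) (1 / √(1 - k ^ 2 * sin φ ^ 2)) φ :=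
  (continuous_one_div_sqrt hk).integral_hasStrictDerivAt 0 φ |>.hasDerivAt

lemma ellipticF_zero (k : ℝ) : ellipticF k 0 = 0 := by simp [ellipticF]

lemma continuous_ellipticF (hk : k ^ 2 < 1) : Continuous (ellipticF k) :=
  continuous_iff_continuousAt.2 fun φ => (hasDerivAt_ellipticF hk φ).continuousAt

lemma strictMono_ellipticF (hk : k ^ 2 < 1) : StrictMono (ellipticF k) :=
  strictMono_of_hasDerivAt_pos (hasDerivAt_ellipticF hk)
    fun φ => one_div_pos.2 (sqrt_one_sub_mul_sin_sq_pos hk φ)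

lemma ellipticF_neg (k φ : ℝ) : ellipticF k (-φ) = -ellipticF k φ := by
  have h := intervalIntegral.integral_comp_neg (a := 0) (b := φ)
    (fun t : ℝ => 1 / √(1 - k ^ 2 * sin t ^ 2))
  simp only [sin_neg, neg_sq, neg_zero] at h
  rw [ellipticF, intervalIntegral.integral_symm, ← h, ellipticF]

/-- The integrand is symmetric about `π/2`, so `F(π - x) + F(x)` has zero derivative; its constant
value is read off at `x = π/2`. -/
lemma ellipticF_pi_sub (hk : k ^ 2 < 1) (φ : ℝ) :
    ellipticF k (π - φ) = 2 * ellipticK k - ellipticF k φ := by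
  have key (x : ℝ) : ellipticF k (π - x) + ellipticF k x =
      ellipticF k (π - π / 2) + ellipticF k (π / 2) := by
    have hd (x : ℝ) : HasDerivAt (fun x => ellipticF k (π - x) + ellipticF k x) 0 x := by
      have h1 := (hasDerivAt_ellipticF hk (π - x)).comp x ((hasDerivAt_id x).const_sub π)
      convert! h1.add (hasDerivAt_ellipticF hk x) using 1
      simp
    exact is_const_of_deriv_eq_zero (fun x => (hd x).differentiableAt) (fun x => (hd x).deriv) x
      (π / 2)
  have := key φ
  rw [show π - π / 2 = π / 2 by ring] at this
  rw [ellipticK]; linarith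

lemma ellipticF_add_pi (hk : k ^ 2 < 1) (φ : ℝ) :
    ellipticF k (φ + π) = ellipticF k φ + 2 * ellipticK k := by
  have := ellipticF_pi_sub hk (-φ)
  rw [ellipticF_neg, sub_neg_eq_add, sub_neg_eq_add] at this
  rw [add_comm φ, this]; ring

lemma ellipticK_pos (hk : k ^ 2 < 1) : 0 < ellipticK k := by
  have := strictMono_ellipticF hk (show (0 : ℝ) < π / 2 by positivity)
  rwa [ellipticF_zero] at this

/-- The integrand is at least 1. This linear growth makes `ellipticF k` surjective, so that
`jacobiAm` is a genuine inverse. -/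
lemma le_ellipticF (hk : k ^ 2 < 1) {φ : ℝ} (hφ : 0 ≤ φ) : φ ≤ ellipticF k φ := by
  have h : ∫ _ in (0 : ℝ)..φ, (1 : ℝ) ≤ ellipticF k φ := by
    refine intervalIntegral.integral_mono_on hφ (by simp)
      ((continuous_one_div_sqrt hk).intervalIntegrable _ _) fun t _ => ?_
    rw [le_div_iff₀ (sqrt_one_sub_mul_sin_sq_pos hk t), one_mul, sqrt_le_iff]
    refine ⟨zero_le_one, ?_⟩
    nlinarith [mul_nonneg (sq_nonneg k) (sq_nonneg (sin t))]
  simpa using h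

lemma surjective_ellipticF (hk : k ^ 2 < 1) : Function.Surjective (ellipticF k) := by
  refine (continuous_ellipticF hk).surjective ?_ ?_
  · refine Filter.tendsto_atTop_mono' _ ?_ Filter.tendsto_id
    filter_upwards [Filter.eventually_ge_atTop 0] with x hx using le_ellipticF hk hx
  · refine Filter.tendsto_atBot_mono' _ ?_ Filter.tendsto_id
    filter_upwards [Filter.eventually_le_atBot 0] with x hx
    have := le_ellipticF hk (neg_nonneg.2 hx)
    rw [ellipticF_neg] at this
    simpa using this

lemma ellipticF_jacobiAm (hk : k ^ 2 < 1) (u : ℝ) : ellipticF k (jacobiAm u k) = u :=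
  Function.invFun_eq (surjective_ellipticF hk u)

lemma jacobiAm_ellipticF (hk : k ^ 2 < 1) (φ : ℝ) : jacobiAm (ellipticF k φ) k = φ :=
  (strictMono_ellipticF hk).injective (ellipticF_jacobiAm hk _)

lemma jacobiAm_eq (hk : k ^ 2 < 1) {u φ : ℝ} (h : ellipticF k φ = u) : jacobiAm u k = φ := by
  rw [← h, jacobiAm_ellipticF hk]

lemma strictMono_jacobiAm (hk : k ^ 2 < 1) : StrictMono fun u => jacobiAm u k := fun u v h => by
  rwa [← (strictMono_ellipticF hk).lt_iff_lt, ellipticF_jacobiAm hk, ellipticF_jacobiAm hk]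

lemma surjective_jacobiAm (hk : k ^ 2 < 1) : Function.Surjective fun u => jacobiAm u k :=
  fun φ => ⟨_, jacobiAm_ellipticF hk φ⟩

lemma continuous_jacobiAm (hk : k ^ 2 < 1) : Continuous fun u => jacobiAm u k :=
  (strictMono_jacobiAm hk).monotone.continuous_of_surjective (surjective_jacobiAm hk)

lemma jacobiDn_pos (hk : k ^ 2 < 1) (u : ℝ) : 0 < jacobiDn u k :=
  sqrt_one_sub_mul_sin_sq_pos hk _

lemma hasDerivAt_jacobiAm (hk : k ^ 2 < 1) (u : ℝ) :
    HasDerivAt (fun u => jacobiAm u k) (jacobiDn u k) u := by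
  have h := HasDerivAt.of_local_left_inverse (continuous_jacobiAm hk).continuousAt
    (hasDerivAt_ellipticF hk (jacobiAm u k))
    (one_div_pos.2 (sqrt_one_sub_mul_sin_sq_pos hk _)).ne'
    (Filter.Eventually.of_forall fun v => ellipticF_jacobiAm hk v)
  simpa [jacobiDn, jacobiSn] using h

lemma jacobiAm_zero (hk : k ^ 2 < 1) : jacobiAm 0 k = 0 := jacobiAm_eq hk (ellipticF_zero k)

lemma jacobiAm_ellipticK (hk : k ^ 2 < 1) : jacobiAm (ellipticK k) k = π / 2 := jacobiAm_eq hk rfl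

lemma jacobiAm_two_mul_sub (hk : k ^ 2 < 1) (u : ℝ) :
    jacobiAm (2 * ellipticK k - u) k = π - jacobiAm u k :=
  jacobiAm_eq hk (by rw [ellipticF_pi_sub hk, ellipticF_jacobiAm hk])

lemma jacobiAm_add_two_mul (hk : k ^ 2 < 1) (u : ℝ) :
    jacobiAm (u + 2 * ellipticK k) k = jacobiAm u k + π :=
  jacobiAm_eq hk (by rw [ellipticF_add_pi hk, ellipticF_jacobiAm hk])

lemma jacobiSn_zero (hk : k ^ 2 < 1) : jacobiSn 0 k = 0 := by simp [jacobiSn, jacobiAm_zero hk]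
lemma jacobiCn_zero (hk : k ^ 2 < 1) : jacobiCn 0 k = 1 := by simp [jacobiCn, jacobiAm_zero hk]
lemma jacobiSn_ellipticK (hk : k ^ 2 < 1) : jacobiSn (ellipticK k) k = 1 := by
  simp [jacobiSn, jacobiAm_ellipticK hk]
lemma jacobiCn_ellipticK (hk : k ^ 2 < 1) : jacobiCn (ellipticK k) k = 0 := by
  simp [jacobiCn, jacobiAm_ellipticK hk]

lemma jacobiCn_sq (u k : ℝ) : jacobiCn u k ^ 2 = 1 - jacobiSn u k ^ 2 := by
  rw [jacobiCn, jacobiSn, cos_sq']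

lemma jacobiDn_sq (hk : k ^ 2 < 1) (u : ℝ) : jacobiDn u k ^ 2 = 1 - k ^ 2 * jacobiSn u k ^ 2 :=
  sq_sqrt (one_sub_mul_sin_sq_pos hk _).le

lemma hasDerivAt_jacobiSn (hk : k ^ 2 < 1) (u : ℝ) :
    HasDerivAt (fun u => jacobiSn u k) (jacobiCn u k * jacobiDn u k) u :=
  (hasDerivAt_jacobiAm hk u).sin

lemma hasDerivAt_jacobiCn (hk : k ^ 2 < 1) (u : ℝ) :
    HasDerivAt (fun u => jacobiCn u k) (-(jacobiSn u k * jacobiDn u k)) u := by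
  simpa using! (hasDerivAt_jacobiAm hk u).cos

lemma hasDerivAt_jacobiDn (hk : k ^ 2 < 1) (u : ℝ) :
    HasDerivAt (fun u => jacobiDn u k) (-(k ^ 2 * (jacobiSn u k * jacobiCn u k))) u := by
  have h := ((((hasDerivAt_jacobiSn hk u).pow 2).const_mul (k ^ 2)).const_sub 1).sqrt
    (one_sub_mul_sin_sq_pos hk _).ne'
  convert! h using 1
  have h1 : √(1 - k ^ 2 * jacobiSn u k ^ 2) = jacobiDn u k := rfl
  have := (jacobiDn_pos hk u).ne'
  simp only [Pi.pow_apply, h1]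
  field_simp
  push_cast
  ring

lemma jacobiAm_mem (hk : k ^ 2 < 1) {u : ℝ} (hu : u ∈ Ioo 0 (ellipticK k)) :
    jacobiAm u k ∈ Ioo 0 (π / 2) := by
  have h0 := strictMono_jacobiAm hk hu.1
  have h1 := strictMono_jacobiAm hk hu.2
  simp only [jacobiAm_zero hk, jacobiAm_ellipticK hk] at h0 h1
  exact ⟨h0, h1⟩

lemma jacobiSn_pos (hk : k ^ 2 < 1) {u : ℝ} (h0 : 0 < u) (h1 : u ≤ ellipticK k) :
    0 < jacobiSn u k := by
  rcases h1.lt_or_eq with h | h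
  · have := jacobiAm_mem hk ⟨h0, h⟩
    exact sin_pos_of_pos_of_lt_pi this.1 (by linarith [this.2, pi_pos])
  · rw [h, jacobiSn_ellipticK hk]; exact one_pos

lemma jacobiCn_pos (hk : k ^ 2 < 1) {u : ℝ} (h0 : 0 ≤ u) (h1 : u < ellipticK k) :
    0 < jacobiCn u k := by
  rcases h0.lt_or_eq with h | h
  · have := jacobiAm_mem hk ⟨h, h1⟩
    exact cos_pos_of_mem_Ioo ⟨by linarith [this.1, pi_pos], this.2⟩
  · rw [← h, jacobiCn_zero hk]; exact one_pos

lemma jacobiAm_ellipticF_mem (hk : k ^ 2 < 1) {φ : ℝ} (hφ : φ ∈ Ioo 0 (π / 2)) :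
    ellipticF k φ ∈ Ioo 0 (ellipticK k) :=
  ⟨by simpa [ellipticF_zero] using strictMono_ellipticF hk hφ.1, strictMono_ellipticF hk hφ.2⟩

lemma jacobiSn_injOn (hk : k ^ 2 < 1) : InjOn (fun u => jacobiSn u k) (Icc 0 (ellipticK k)) := by
  intro u hu v hv h
  have hm {w : ℝ} (hw : w ∈ Icc 0 (ellipticK k)) : jacobiAm w k ∈ Icc (-(π / 2)) (π / 2) := by
    have h0 := (strictMono_jacobiAm hk).monotone hw.1
    have h1 := (strictMono_jacobiAm hk).monotone hw.2
    simp only [jacobiAm_zero hk, jacobiAm_ellipticK hk] at h0 h1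
    exact ⟨by linarith [pi_pos], h1⟩
  exact (strictMono_jacobiAm hk).injective (injOn_sin (hm hu) (hm hv) h)

end Jacobi

/-! ### The function `sn` of a complex argument and its holomorphy. -/

lemma complModulus_sq {k : ℝ} (hk : k ^ 2 < 1) : complModulus k ^ 2 = 1 - k ^ 2 :=
  sq_sqrt (by linarith)

lemma complModulus_sq_lt_one {k : ℝ} (hk0 : k ≠ 0) (hk : k ^ 2 < 1) : complModulus k ^ 2 < 1 := by
  rw [complModulus_sq hk]; have := pow_pos (abs_pos.2 hk0) 2; rw [sq_abs] at this; linarith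

lemma complModulus_complModulus {k : ℝ} (hk0 : 0 ≤ k) (hk : k ^ 2 < 1) :
    complModulus (complModulus k) = k := by
  rw [complModulus, complModulus_sq hk, sub_sub_cancel, sqrt_sq hk0]

/-- Cauchy–Riemann: a real differentiable function whose `y`-derivative is `i` times its
`x`-derivative has a complex linear differential. -/
lemma hasDerivAt_of_partials {f : ℂ → ℂ} {z A : ℂ} (hf : DifferentiableAt ℝ f z)
    (h1 : HasDerivAt (fun x : ℝ => f (x + z.im * Complex.I)) A z.re)
    (h2 : HasDerivAt (fun y : ℝ => f (z.re + y * Complex.I)) (Complex.I * A) z.im) :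
    HasDerivAt f A z := by
  have hz : (z.re : ℂ) + z.im * Complex.I = z := Complex.re_add_im z
  have e1 : fderiv ℝ f z 1 = A := by
    have hg : HasDerivAt (fun x : ℝ => (x : ℂ) + z.im * Complex.I) 1 z.re :=
      (Complex.ofRealCLM.hasDerivAt (x := z.re)).add_const _
    have := HasFDerivAt.comp_hasDerivAt z.re (hz.symm ▸ hf.hasFDerivAt) hg
    rw [hz] at this
    exact this.unique h1
  have e2 : fderiv ℝ f z Complex.I = Complex.I * A := by
    have hg : HasDerivAt (fun y : ℝ => (z.re : ℂ) + y * Complex.I) Complex.I z.im := by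
      simpa using! ((Complex.ofRealCLM.hasDerivAt (x := z.im)).mul_const Complex.I).const_add
        (z.re : ℂ)
    have := HasFDerivAt.comp_hasDerivAt z.im (hz.symm ▸ hf.hasFDerivAt) hg
    rw [hz] at this
    exact this.unique h2
  have key : (ContinuousLinearMap.toSpanSingleton ℂ A).restrictScalars ℝ = fderiv ℝ f z := by
    ext v
    have hv : v = v.re • (1 : ℂ) + v.im • Complex.I := by simp [Complex.re_add_im]
    conv_rhs => rw [hv, map_add, map_smul, map_smul, e1, e2]
    simp only [ContinuousLinearMap.coe_restrictScalars', ContinuousLinearMap.toSpanSingleton_apply,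
      smul_eq_mul, Complex.real_smul]
    conv_lhs => rw [← Complex.re_add_im v]
    ring
  exact hasFDerivAt_of_restrictScalars ℝ hf.hasFDerivAt key

/-- `sn (x + i y, k)` for a complex argument, through the Jacobi functions of `x` and `y`. -/
def snC (k : ℝ) (z : ℂ) : ℂ :=
  ((jacobiSn z.re k * jacobiDn z.im (complModulus k) : ℝ) +
    Complex.I * (jacobiCn z.re k * jacobiDn z.re k *
        (jacobiSn z.im (complModulus k) * jacobiCn z.im (complModulus k)) : ℝ)) /
    (jacobiCn z.im (complModulus k) ^ 2 +
      k ^ 2 * jacobiSn z.re k ^ 2 * jacobiSn z.im (complModulus k) ^ 2 : ℝ)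

/-- The derivative of `snC`. -/
def snCDeriv (k : ℝ) (z : ℂ) : ℂ :=
  let s := (jacobiSn z.re k : ℂ)
  let c := (jacobiCn z.re k : ℂ)
  let d := (jacobiDn z.re k : ℂ)
  let s1 := (jacobiSn z.im (complModulus k) : ℂ)
  let c1 := (jacobiCn z.im (complModulus k) : ℂ)
  let d1 := (jacobiDn z.im (complModulus k) : ℂ)
  ((c * d * d1 + Complex.I * ((-(s * d) * d + c * (-(k ^ 2 * (s * c)))) * (s1 * c1))) *
      (c1 ^ 2 + k ^ 2 * s ^ 2 * s1 ^ 2) -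
    (s * d1 + Complex.I * (c * d * (s1 * c1))) * (k ^ 2 * (2 * s * (c * d)) * s1 ^ 2)) /
    (c1 ^ 2 + k ^ 2 * s ^ 2 * s1 ^ 2) ^ 2

/-- The Cauchy–Riemann equation for `snC` with the squared denominator cleared. The left side comes
from the `y`-derivative, the right side is `i` times the `x`-derivative, and the relations among
`sn`, `cn`, `dn` make it purely polynomial. -/
lemma snCDeriv_identity (s c d s1 c1 d1 k i : ℂ) (hc : c ^ 2 = 1 - s ^ 2)
    (hd : d ^ 2 = 1 - k ^ 2 * s ^ 2) (hc1 : c1 ^ 2 = 1 - s1 ^ 2)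
    (hd1 : d1 ^ 2 = 1 - (1 - k ^ 2) * s1 ^ 2) (hi : i ^ 2 = -1) :
    (s * (-((1 - k ^ 2) * (s1 * c1))) + i * (c * d * (c1 * d1 * c1 + s1 * (-(s1 * d1))))) *
        (c1 ^ 2 + k ^ 2 * s ^ 2 * s1 ^ 2) -
      (s * d1 + i * (c * d * (s1 * c1))) *
        (2 * c1 * (-(s1 * d1)) + k ^ 2 * s ^ 2 * (2 * s1 * (c1 * d1))) =
    i * ((c * d * d1 + i * ((-(s * d) * d + c * (-(k ^ 2 * (s * c)))) * (s1 * c1))) *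
        (c1 ^ 2 + k ^ 2 * s ^ 2 * s1 ^ 2) -
      (s * d1 + i * (c * d * (s1 * c1))) * (k ^ 2 * (2 * s * (c * d)) * s1 ^ 2)) := by
  grind

lemma differentiable_jacobi {k : ℝ} (hk : k ^ 2 < 1) :
    Differentiable ℝ (fun u => jacobiSn u k) ∧ Differentiable ℝ (fun u => jacobiCn u k) ∧
      Differentiable ℝ (fun u => jacobiDn u k) :=
  ⟨fun u => (hasDerivAt_jacobiSn hk u).differentiableAt,
    fun u => (hasDerivAt_jacobiCn hk u).differentiableAt,
    fun u => (hasDerivAt_jacobiDn hk u).differentiableAt⟩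

lemma hasDerivAt_snC {k : ℝ} (hk0 : k ≠ 0) (hk : k ^ 2 < 1) {z : ℂ}
    (hz : jacobiCn z.im (complModulus k) ^ 2 +
      k ^ 2 * jacobiSn z.re k ^ 2 * jacobiSn z.im (complModulus k) ^ 2 ≠ 0) :
    HasDerivAt (snC k) (snCDeriv k z) z := by
  have hk' := complModulus_sq_lt_one hk0 hk
  have hzC : (jacobiCn z.im (complModulus k) ^ 2 +
      k ^ 2 * jacobiSn z.re k ^ 2 * jacobiSn z.im (complModulus k) ^ 2 : ℂ) ≠ 0 := by
    exact_mod_cast hz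
  have es := (hasDerivAt_jacobiSn hk z.re).ofReal_comp
  have ec := (hasDerivAt_jacobiCn hk z.re).ofReal_comp
  have ed := (hasDerivAt_jacobiDn hk z.re).ofReal_comp
  have es1 := (hasDerivAt_jacobiSn hk' z.im).ofReal_comp
  have ec1 := (hasDerivAt_jacobiCn hk' z.im).ofReal_comp
  have ed1 := (hasDerivAt_jacobiDn hk' z.im).ofReal_comp
  have rs := jacobiCn_sq z.re k
  have rd := jacobiDn_sq hk z.re
  have rs1 := jacobiCn_sq z.im (complModulus k)
  have rd1 := jacobiDn_sq hk' z.im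
  have rk := complModulus_sq hk
  apply hasDerivAt_of_partials
  · obtain ⟨a1, a2, a3⟩ := differentiable_jacobi hk
    obtain ⟨b1, b2, b3⟩ := differentiable_jacobi hk'
    have hre : Differentiable ℝ Complex.re := Complex.reCLM.differentiable
    have him : Differentiable ℝ Complex.im := Complex.imCLM.differentiable
    have hof : Differentiable ℝ Complex.ofReal := Complex.ofRealCLM.differentiable
    have hs : Differentiable ℝ fun z : ℂ => jacobiSn z.re k := a1.comp hre
    have hc : Differentiable ℝ fun z : ℂ => jacobiCn z.re k := a2.comp hre
    have hd : Differentiable ℝ fun z : ℂ => jacobiDn z.re k := a3.comp hre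
    have hs1 : Differentiable ℝ fun z : ℂ => jacobiSn z.im (complModulus k) := b1.comp him
    have hc1 : Differentiable ℝ fun z : ℂ => jacobiCn z.im (complModulus k) := b2.comp him
    have hd1 : Differentiable ℝ fun z : ℂ => jacobiDn z.im (complModulus k) := b3.comp him
    unfold snC
    simp only [div_eq_mul_inv]
    refine DifferentiableAt.mul ?_ (DifferentiableAt.inv ?_ (by exact_mod_cast hzC))
    · refine ((hof.comp ?_).add ((differentiable_const _).mul (hof.comp ?_))) z <;> fun_prop
    · refine (hof.comp ?_) z; fun_prop
  · unfold snC snCDeriv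
    have num := ((es.mul_const ((jacobiDn z.im (complModulus k) : ℝ) : ℂ))).add
      (((ec.mul ed).mul_const ((jacobiSn z.im (complModulus k) * jacobiCn z.im (complModulus k)
        : ℝ) : ℂ)).const_mul Complex.I)
    have den := ((((es.pow 2).const_mul ((k : ℂ) ^ 2)).mul_const
      ((jacobiSn z.im (complModulus k) : ℂ) ^ 2)).const_add
        ((jacobiCn z.im (complModulus k) : ℂ) ^ 2))
    convert! num.div den ?_ using 1
    · ext x
      simp
    · simp
    · simpa using hzC
  · unfold snC snCDeriv
    have num := ((ed1.const_mul ((jacobiSn z.re k : ℝ) : ℂ))).add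
      ((((es1.mul ec1).const_mul ((jacobiCn z.re k * jacobiDn z.re k : ℝ) : ℂ))).const_mul
        Complex.I)
    have den := (ec1.pow 2).add ((es1.pow 2).const_mul ((k : ℂ) ^ 2 * (jacobiSn z.re k : ℂ) ^ 2))
    convert! num.div den ?_ using 1
    · ext x
      simp
    · have key := snCDeriv_identity (jacobiSn z.re k) (jacobiCn z.re k) (jacobiDn z.re k)
        (jacobiSn z.im (complModulus k)) (jacobiCn z.im (complModulus k))
        (jacobiDn z.im (complModulus k)) k Complex.I (by exact_mod_cast rs) (by exact_mod_cast rd)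
        (by exact_mod_cast rs1) (by rw [rk] at rd1; exact_mod_cast rd1) Complex.I_sq
      simp only [← mul_div_assoc]
      rw [← key]
      have rk' : (complModulus k : ℂ) ^ 2 = 1 - (k : ℂ) ^ 2 := by exact_mod_cast rk
      simp [rk']
    · simpa using hzC

open Filter Topology in
/-- Two simple poles with matching residues cancel. -/
lemma exists_tendsto_sub_of_simple_poles {u v : ℂ → ℂ} {s : Set ℂ} {z₀ u' v' : ℂ} (hs : s ∈ 𝓝 z₀)
    (hu : DifferentiableOn ℂ u s) (hv : DifferentiableOn ℂ v s) (hu' : HasDerivAt u u' z₀)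
    (hv' : HasDerivAt v v' z₀) (u0 : u z₀ = 0) (v0 : v z₀ = 0) (hu0 : u' ≠ 0) (hv0 : v' ≠ 0) :
    ∃ L, Tendsto (fun z => (u z)⁻¹ - v' / u' / v z) (𝓝[≠] z₀) (𝓝 L) := by
  -- Dividing out the zero, `u = (z - z₀) U` and `v = (z - z₀) V`. The numerator `n = V - (v'/u') U`
  -- of the difference vanishes at `z₀`, so one more division leaves `N/(U V)`, which is continuous
  -- there.
  set U := dslope u z₀
  set V := dslope v z₀
  have hU : DifferentiableOn ℂ U s := (Complex.differentiableOn_dslope hs).2 hu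
  have hV : DifferentiableOn ℂ V s := (Complex.differentiableOn_dslope hs).2 hv
  have U0 : U z₀ = u' := by simp only [U, dslope_same]; exact hu'.deriv
  have V0 : V z₀ = v' := by simp only [V, dslope_same]; exact hv'.deriv
  set n : ℂ → ℂ := fun z => V z - v' / u' * U z
  have hn : DifferentiableOn ℂ n s := hV.sub (hU.const_mul _)
  have n0 : n z₀ = 0 := by simp only [n, U0, V0]; field_simp; simp
  set N := dslope n z₀
  have hN : DifferentiableOn ℂ N s := (Complex.differentiableOn_dslope hs).2 hn
  have cU := (hU.differentiableAt hs).continuousAt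
  have cV := (hV.differentiableAt hs).continuousAt
  have cN := (hN.differentiableAt hs).continuousAt
  refine ⟨N z₀ / (U z₀ * V z₀), ?_⟩
  have hlim : Tendsto (fun z => N z / (U z * V z)) (𝓝[≠] z₀) (𝓝 (N z₀ / (U z₀ * V z₀))) :=
    (cN.div (cU.mul cV) (by rw [Pi.mul_apply, U0, V0]; exact mul_ne_zero hu0 hv0)).tendsto.mono_left
      nhdsWithin_le_nhds
  refine hlim.congr' ?_
  have e1 : ∀ᶠ z in 𝓝[≠] z₀, U z ≠ 0 :=
    (cU.eventually_ne (by rw [U0]; exact hu0)).filter_mono nhdsWithin_le_nhds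
  have e2 : ∀ᶠ z in 𝓝[≠] z₀, V z ≠ 0 :=
    (cV.eventually_ne (by rw [V0]; exact hv0)).filter_mono nhdsWithin_le_nhds
  filter_upwards [e1, e2, self_mem_nhdsWithin] with z h1 h2 h3
  have h3' : z - z₀ ≠ 0 := sub_ne_zero.2 h3
  have hu1 : u z = (z - z₀) * U z := by
    have := sub_smul_dslope u z₀ z; rw [u0, sub_zero, smul_eq_mul] at this; exact this.symm
  have hv1 : v z = (z - z₀) * V z := by
    have := sub_smul_dslope v z₀ z; rw [v0, sub_zero, smul_eq_mul] at this; exact this.symm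
  have hn1 : V z - v' / u' * U z = (z - z₀) * N z := by
    have := sub_smul_dslope n z₀ z; rw [n0, sub_zero, smul_eq_mul] at this; exact this.symm
  have hN1 : N z = (V z - v' / u' * U z) / (z - z₀) := by rw [hn1]; field_simp
  rw [hu1, hv1, hN1]
  field_simp

/-! ### The complex cosine and the elementary comparison integral. -/

lemma cos_add_mul_I_re (x y : ℝ) : (Complex.cos (x + y * Complex.I)).re = cos x * cosh y := by
  rw [Complex.cos_add_mul_I, ← Complex.ofReal_cos, ← Complex.ofReal_sin, ← Complex.ofReal_cosh,
    ← Complex.ofReal_sinh]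
  simp [-Complex.ofReal_cos, -Complex.ofReal_sin, -Complex.ofReal_cosh, -Complex.ofReal_sinh]

lemma cos_add_mul_I_im (x y : ℝ) : (Complex.cos (x + y * Complex.I)).im = -(sin x * sinh y) := by
  rw [Complex.cos_add_mul_I, ← Complex.ofReal_cos, ← Complex.ofReal_sin, ← Complex.ofReal_cosh,
    ← Complex.ofReal_sinh]
  simp [-Complex.ofReal_cos, -Complex.ofReal_sin, -Complex.ofReal_cosh, -Complex.ofReal_sinh]

lemma sin_add_mul_I_re (x y : ℝ) : (Complex.sin (x + y * Complex.I)).re = sin x * cosh y := by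
  rw [Complex.sin_add_mul_I, ← Complex.ofReal_cos, ← Complex.ofReal_sin, ← Complex.ofReal_cosh,
    ← Complex.ofReal_sinh]
  simp [-Complex.ofReal_cos, -Complex.ofReal_sin, -Complex.ofReal_cosh, -Complex.ofReal_sinh]

lemma sin_add_mul_I_im (x y : ℝ) : (Complex.sin (x + y * Complex.I)).im = cos x * sinh y := by
  rw [Complex.sin_add_mul_I, ← Complex.ofReal_cos, ← Complex.ofReal_sin, ← Complex.ofReal_cosh,
    ← Complex.ofReal_sinh]
  simp [-Complex.ofReal_cos, -Complex.ofReal_sin, -Complex.ofReal_cosh, -Complex.ofReal_sinh]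

/-- For `b ≠ 0`, a real value of `cos(a + ib)` forces `sin a = 0`, and the value is then `±cosh b`,
outside the range of `cos t` on `(0, π)`. For `b = 0` the cosine is injective on `[0, π]`. -/
lemma cos_add_mul_I_ne {a b t : ℝ} (ha : a ∈ Icc 0 π) (ht : t ∈ Ioo 0 π) (h : b ≠ 0 ∨ a ≠ t) :
    Complex.cos (a + b * Complex.I) - (cos t : ℝ) ≠ 0 := by
  intro h0
  have hre := congrArg Complex.re h0
  have him := congrArg Complex.im h0
  rw [Complex.sub_re, cos_add_mul_I_re, Complex.ofReal_re, Complex.zero_re] at hre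
  rw [Complex.sub_im, cos_add_mul_I_im, Complex.ofReal_im, Complex.zero_im] at him
  have hlt : cos t < 1 := by
    have := strictAntiOn_cos ⟨le_rfl, pi_pos.le⟩ ⟨ht.1.le, ht.2.le⟩ ht.1; simpa using this
  have hgt : -1 < cos t := by
    have := strictAntiOn_cos ⟨ht.1.le, ht.2.le⟩ ⟨pi_pos.le, le_rfl⟩ ht.2; simpa using this
  have hc := one_le_cosh b
  by_cases hb : b = 0
  · subst hb
    have hat := h.resolve_left (by simp)
    rw [cosh_zero, mul_one] at hre
    exact hat (injOn_cos ha ⟨ht.1.le, ht.2.le⟩ (by linarith))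
  · have hsb : sinh b ≠ 0 := by rwa [Ne, sinh_eq_zero]
    have hsa : sin a = 0 := by
      have : sin a * sinh b = 0 := by linarith
      exact (mul_eq_zero.1 this).resolve_right hsb
    rcases sin_eq_zero_iff_cos_eq.1 hsa with h1 | h1 <;> rw [h1] at hre <;> nlinarith

/-- A primitive is `-log(cos z - cos t)`, so the imaginary part is minus the change of argument. -/
lemma im_integral_sin_div_cos_sub {w t : ℝ} (hw : 0 < w) (ht : t ∈ Ioo 0 π) :
    (∫ x in (0 : ℝ)..π, Complex.sin (x + (-w : ℝ) * Complex.I) /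
      (Complex.cos (x + (-w : ℝ) * Complex.I) - (cos t : ℝ))).im = -π := by
  -- The factor `-i` rotates the curve into the right half plane, meeting the imaginary axis only at
  -- its two ends. The principal logarithm is thus usable, and the argument runs from `-π/2` to
  -- `π/2`.
  set f : ℝ → ℂ := fun x => -Complex.I * (Complex.cos (x + (-w : ℝ) * Complex.I) - (cos t : ℝ))
  have hlt : cos t < 1 := by
    have := strictAntiOn_cos ⟨le_rfl, pi_pos.le⟩ ⟨ht.1.le, ht.2.le⟩ ht.1; simpa using this
  have hgt : -1 < cos t := by
    have := strictAntiOn_cos ⟨ht.1.le, ht.2.le⟩ ⟨pi_pos.le, le_rfl⟩ ht.2; simpa using this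
  have hc := one_le_cosh w
  have hfre (x : ℝ) : (f x).re = sin x * sinh w := by
    simp only [f, Complex.mul_re, Complex.sub_im, Complex.sub_re, cos_add_mul_I_im,
      cos_add_mul_I_re, Complex.neg_re, Complex.neg_im, Complex.I_re, Complex.I_im, sinh_neg,
      Complex.ofReal_im]
    ring
  have hfim (x : ℝ) : (f x).im = cos t - cos x * cosh w := by
    simp only [f, Complex.mul_im, Complex.sub_im, Complex.sub_re, cos_add_mul_I_im,
      cos_add_mul_I_re, Complex.neg_re, Complex.neg_im, Complex.I_re, Complex.I_im, cosh_neg,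
      Complex.ofReal_im, Complex.ofReal_re]
    ring
  have hslit : ∀ x ∈ uIcc 0 π, f x ∈ Complex.slitPlane := by
    intro x hx
    rw [uIcc_of_le pi_pos.le] at hx
    rw [Complex.mem_slitPlane_iff, hfre, hfim]
    rcases hx.1.eq_or_lt with h0 | h0
    · right; rw [← h0, cos_zero]; nlinarith
    rcases hx.2.eq_or_lt with h1 | h1
    · right; rw [h1, cos_pi]; nlinarith
    · left; exact mul_pos (sin_pos_of_pos_of_lt_pi h0 h1) (sinh_pos_iff.2 hw)
  have hfd (x : ℝ) : HasDerivAt f (Complex.I * Complex.sin (x + (-w : ℝ) * Complex.I)) x := by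
    have h1 : HasDerivAt (fun z : ℂ => z + (-w : ℝ) * Complex.I) 1 (x : ℂ) :=
      (hasDerivAt_id _).add_const _
    convert! ((h1.ccos.sub_const ((cos t : ℝ) : ℂ)).const_mul (-Complex.I)).comp_ofReal using 1
    ring
  have hd : ∀ x ∈ uIcc 0 π, HasDerivAt (fun x => -Complex.log (f x))
      (Complex.sin (x + (-w : ℝ) * Complex.I) /
      (Complex.cos (x + (-w : ℝ) * Complex.I) - (cos t : ℝ))) x := by
    intro x hx
    convert! ((hfd x).clog_real (hslit x hx)).neg using 1
    have : f x ≠ 0 := Complex.slitPlane_ne_zero (hslit x hx)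
    have h2 : Complex.cos (x + (-w : ℝ) * Complex.I) - (cos t : ℝ) ≠ 0 :=
      fun h => this (by simp only [f, h, mul_zero])
    simp only [f]
    field_simp
  have hcont : ContinuousOn (fun x : ℝ => Complex.sin (x + (-w : ℝ) * Complex.I) /
      (Complex.cos (x + (-w : ℝ) * Complex.I) - (cos t : ℝ))) (uIcc 0 π) := by
    refine ContinuousOn.div (by fun_prop) (by fun_prop) fun x hx => ?_
    rw [uIcc_of_le pi_pos.le] at hx
    exact cos_add_mul_I_ne hx ht (Or.inl (neg_ne_zero.2 hw.ne'))
  rw [intervalIntegral.integral_eq_sub_of_hasDerivAt hd hcont.intervalIntegrable]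
  have a0 : (f 0).arg = -(π / 2) := by
    rw [Complex.arg_eq_neg_pi_div_two_iff, hfre, hfim]; simp; linarith
  have a1 : (f π).arg = π / 2 := by
    rw [Complex.arg_eq_pi_div_two_iff, hfre, hfim]; simp; linarith
  simp only [Complex.sub_im, Complex.neg_im, Complex.log_im, a0, a1]
  ring

/-! ### Values of `sn` on the rectangle with vertices `0`, `K`, `K + iK'`, `iK'`. -/

section Rectangle

variable {k : ℝ}

lemma jacobiDn_zero (hk : k ^ 2 < 1) : jacobiDn 0 k = 1 := by
  simp [jacobiDn, jacobiSn_zero hk]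

lemma jacobiDn_ellipticK (hk : k ^ 2 < 1) : jacobiDn (ellipticK k) k = complModulus k := by
  simp [jacobiDn, jacobiSn_ellipticK hk, complModulus]

lemma jacobiDn_complModulus (hk0 : 0 < k) (hk : k ^ 2 < 1) :
    jacobiDn (ellipticK (complModulus k)) (complModulus k) = k := by
  rw [jacobiDn_ellipticK (complModulus_sq_lt_one hk0.ne' hk), complModulus_complModulus hk0.le hk]

lemma eq_ellipticK_of_jacobiCn_eq_zero (hk : k ^ 2 < 1) {u : ℝ} (hu : u ∈ Icc 0 (ellipticK k))
    (h : jacobiCn u k = 0) : u = ellipticK k :=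
  hu.2.eq_of_not_lt fun h1 => (jacobiCn_pos hk hu.1 h1).ne' h

lemma eq_zero_of_jacobiSn_eq_zero (hk : k ^ 2 < 1) {u : ℝ} (hu : u ∈ Icc 0 (ellipticK k))
    (h : jacobiSn u k = 0) : u = 0 :=
  (hu.1.eq_of_not_lt fun h1 => (jacobiSn_pos hk h1 hu.2).ne' h).symm

/-- Both summands are nonnegative: the first vanishes only for `Im z = K'`, and then the second only
for `Re z = 0`. The corner `iK'` is the only pole of `sn` in the closed rectangle. -/
lemma snC_denominator_ne_zero (hk0 : 0 < k) (hk : k ^ 2 < 1) {z : ℂ}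
    (hre : z.re ∈ Icc 0 (ellipticK k)) (him : z.im ∈ Icc 0 (ellipticK (complModulus k)))
    (hz : z ≠ ellipticK (complModulus k) * Complex.I) :
    jacobiCn z.im (complModulus k) ^ 2 +
      k ^ 2 * jacobiSn z.re k ^ 2 * jacobiSn z.im (complModulus k) ^ 2 ≠ 0 := by
  have hk' := complModulus_sq_lt_one hk0.ne' hk
  intro h
  have h1 : jacobiCn z.im (complModulus k) ^ 2 = 0 := by
    nlinarith [sq_nonneg (jacobiCn z.im (complModulus k)),
      mul_nonneg (mul_nonneg (sq_nonneg k) (sq_nonneg (jacobiSn z.re k)))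
        (sq_nonneg (jacobiSn z.im (complModulus k)))]
  have hy := eq_ellipticK_of_jacobiCn_eq_zero hk' him (pow_eq_zero_iff two_ne_zero |>.1 h1)
  rw [h1, hy, jacobiSn_ellipticK hk'] at h
  have hs : jacobiSn z.re k = 0 := by simpa [hk0.ne'] using h
  have hx := eq_zero_of_jacobiSn_eq_zero hk hre hs
  exact hz (by rw [← Complex.re_add_im z, hx, hy]; simp)

lemma snC_ofReal (hk0 : 0 < k) (hk : k ^ 2 < 1) (x : ℝ) : snC k x = jacobiSn x k := by
  have hk' := complModulus_sq_lt_one hk0.ne' hk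
  simp [snC, jacobiSn_zero hk', jacobiCn_zero hk', jacobiDn_zero hk']

lemma snC_top (hk0 : 0 < k) (hk : k ^ 2 < 1) (x : ℝ) :
    snC k (x + ellipticK (complModulus k) * Complex.I) = ((1 / (k * jacobiSn x k) : ℝ) : ℂ) := by
  have hk' := complModulus_sq_lt_one hk0.ne' hk
  have hkC : (k : ℂ) ≠ 0 := by exact_mod_cast hk0.ne'
  simp only [snC, Complex.add_re, Complex.add_im, Complex.ofReal_re, Complex.ofReal_im,
    Complex.mul_re, Complex.mul_im, Complex.I_re, Complex.I_im, mul_zero, mul_one, sub_zero,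
    add_zero, zero_add, jacobiSn_ellipticK hk', jacobiCn_ellipticK hk',
    jacobiDn_complModulus hk0 hk]
  -- At a zero of `sn x` both sides are divisions by zero and equal 0.
  by_cases hs : jacobiSn x k = 0
  · simp [hs]
  · have : (jacobiSn x k : ℂ) ≠ 0 := by exact_mod_cast hs
    push_cast
    field_simp
    simp
    ring

lemma snC_left_sq_im (hk : k ^ 2 < 1) (y : ℝ) :
    (snC k (y * Complex.I) ^ 2).im = 0 := by
  have h : snC k (y * Complex.I) = Complex.I *
      ((jacobiSn y (complModulus k) * jacobiCn y (complModulus k) /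
        jacobiCn y (complModulus k) ^ 2 : ℝ) : ℂ) := by
    simp [snC, jacobiSn_zero hk, jacobiCn_zero hk, jacobiDn_zero hk]
    ring
  rw [h, mul_pow, Complex.I_sq, ← Complex.ofReal_pow, neg_one_mul, Complex.neg_im,
    Complex.ofReal_im, neg_zero]

lemma snC_right_sq_im (hk : k ^ 2 < 1) (y : ℝ) :
    (snC k (ellipticK k + y * Complex.I) ^ 2).im = 0 := by
  have h : snC k (ellipticK k + y * Complex.I) =
      ((jacobiDn y (complModulus k) / (jacobiCn y (complModulus k) ^ 2 +
        k ^ 2 * jacobiSn y (complModulus k) ^ 2) : ℝ) : ℂ) := by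
    simp [snC, jacobiSn_ellipticK hk, jacobiCn_ellipticK hk]
  rw [h, ← Complex.ofReal_pow, Complex.ofReal_im]

/-- Locates the poles of `1/(1 - γ² sn²)` with `γ = k sn τ`. If `γ sn z = ±1`, the imaginary part of
`sn z` vanishes, which puts `z` where `cn x`, `sn y` or `cn y` is zero; only the last case, the top
side, is possible. -/
lemma eq_of_sq_mul_snC_sq_eq_one (hk0 : 0 < k) (hk : k ^ 2 < 1) {τ : ℝ}
    (hτ : τ ∈ Ioo 0 (ellipticK k)) {z : ℂ}
    (hre : z.re ∈ Icc 0 (ellipticK k)) (him : z.im ∈ Icc 0 (ellipticK (complModulus k)))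
    (hz : z ≠ ellipticK (complModulus k) * Complex.I)
    (h : 1 - ((k * jacobiSn τ k : ℝ) : ℂ) ^ 2 * snC k z ^ 2 = 0) :
    z = τ + ellipticK (complModulus k) * Complex.I := by
  have hk' := complModulus_sq_lt_one hk0.ne' hk
  have hden := snC_denominator_ne_zero hk0 hk hre him hz
  have hdenC : ((jacobiCn z.im (complModulus k) ^ 2 +
      k ^ 2 * jacobiSn z.re k ^ 2 * jacobiSn z.im (complModulus k) ^ 2 : ℝ) : ℂ) ≠ 0 :=
    Complex.ofReal_ne_zero.2 hden
  have hst := jacobiSn_pos hk hτ.1 hτ.2.le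
  have hct := jacobiCn_pos hk hτ.1.le hτ.2
  have hst1 : jacobiSn τ k ^ 2 < 1 := by
    have := jacobiCn_sq τ k; nlinarith [pow_pos hct 2]
  have rs := jacobiCn_sq z.re k
  have rd := jacobiDn_sq hk z.re
  have rs1 := jacobiCn_sq z.im (complModulus k)
  have rd1 := jacobiDn_sq hk' z.im
  rw [complModulus_sq hk] at rd1
  have hdpos := jacobiDn_pos hk z.re
  rw [snC] at h
  set s := jacobiSn z.re k
  set c := jacobiCn z.re k
  set d := jacobiDn z.re k
  set s1 := jacobiSn z.im (complModulus k)
  set c1 := jacobiCn z.im (complModulus k)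
  set d1 := jacobiDn z.im (complModulus k)
  set t := jacobiSn τ k
  have hsq : (((k * t : ℝ) : ℂ) * ((s * d1 : ℝ) + Complex.I * (c * d * (s1 * c1) : ℝ))) ^ 2 =
      ((c1 ^ 2 + k ^ 2 * s ^ 2 * s1 ^ 2 : ℝ) : ℂ) ^ 2 := by
    have h' := (sub_eq_zero.1 h).symm
    rw [div_pow, mul_div_assoc', div_eq_one_iff_eq (pow_ne_zero 2 hdenC)] at h'
    rw [mul_pow]; exact h'
  have h0 : k * t * (c * d * (s1 * c1)) = 0 ∧
      (k * t * (s * d1)) ^ 2 = (c1 ^ 2 + k ^ 2 * s ^ 2 * s1 ^ 2) ^ 2 := by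
    rcases sq_eq_sq_iff_eq_or_eq_neg.1 hsq with h1 | h1
    · have hr := congrArg Complex.re h1
      have hi := congrArg Complex.im h1
      simp only [Complex.mul_re, Complex.mul_im, Complex.add_re, Complex.add_im,
        Complex.ofReal_re, Complex.ofReal_im, Complex.I_re, Complex.I_im] at hr hi
      have e : k * t * (s * d1) = (c1 ^ 2 + k ^ 2 * s ^ 2 * s1 ^ 2) := by linear_combination hr
      exact ⟨by linear_combination hi, by rw [e]⟩
    · have hr := congrArg Complex.re h1
      have hi := congrArg Complex.im h1
      simp only [Complex.mul_re, Complex.mul_im, Complex.add_re, Complex.add_im,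
        Complex.ofReal_re, Complex.ofReal_im, Complex.I_re, Complex.I_im, Complex.neg_re,
        Complex.neg_im] at hr hi
      have e : k * t * (s * d1) = -(c1 ^ 2 + k ^ 2 * s ^ 2 * s1 ^ 2) := by linear_combination hr
      exact ⟨by linear_combination hi, by rw [e]; ring⟩
  obtain ⟨h1, h2⟩ := h0
  have hkt : k * t ≠ 0 := (mul_pos hk0 hst).ne'
  have h3 : c = 0 ∨ s1 = 0 ∨ c1 = 0 := by
    rcases mul_eq_zero.1 h1 with h | h
    · exact absurd h hkt
    rcases mul_eq_zero.1 h with h | h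
    · exact Or.inl ((mul_eq_zero.1 h).resolve_right hdpos.ne')
    · exact Or.inr (mul_eq_zero.1 h)
  have hk2 : 0 < k ^ 2 := by positivity
  rcases h3 with h3 | h3 | h3
  -- Right side: the equation becomes `k² sn² τ = dn²(y, k')`, but `dn²(y, k') ≥ k²` and `sn² τ <
  -- 1`.
  · exfalso
    have e1 : s ^ 2 = 1 := by rw [h3] at rs; linarith
    have e2 : c1 ^ 2 + k ^ 2 * s ^ 2 * s1 ^ 2 = d1 ^ 2 := by rw [e1, rs1, rd1]; ring
    rw [e2] at h2 hden
    have hd1 : d1 ^ 2 ≠ 0 := hden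
    have e3 : k ^ 2 * t ^ 2 = d1 ^ 2 := by
      have : d1 ^ 2 * (k ^ 2 * t ^ 2) = d1 ^ 2 * d1 ^ 2 := by
        linear_combination h2 - (k * t * d1) ^ 2 * e1
      exact mul_left_cancel₀ hd1 this
    have e4 : s1 ^ 2 ≤ 1 := by nlinarith [sq_nonneg c1]
    nlinarith
  -- Bottom side: `k² sn² τ sn² x = 1` contradicts `k² sn² τ < 1`.
  · exfalso
    have e1 : c1 ^ 2 = 1 := by rw [rs1, h3]; ring
    have e2 : d1 ^ 2 = 1 := by rw [rd1, h3]; ring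
    have e3 : k ^ 2 * t ^ 2 * s ^ 2 = 1 := by
      rw [h3, e1] at h2
      linear_combination h2 - (k * t * s) ^ 2 * e2
    have e4 : s ^ 2 ≤ 1 := by nlinarith [sq_nonneg c]
    have e5 : k ^ 2 * t ^ 2 < 1 := by nlinarith
    nlinarith [sq_nonneg s, sq_nonneg (k * t)]
  -- Top side: here `sn z = 1/(k sn x)`, so `sn x = sn τ`, and `sn` is injective on `[0, K]`.
  · have hy := eq_ellipticK_of_jacobiCn_eq_zero hk' him h3
    have e1 : s1 ^ 2 = 1 := by rw [h3] at rs1; linarith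
    have e2 : d1 ^ 2 = k ^ 2 := by rw [rd1, e1]; ring
    rw [h3] at h2 hden
    have hs : s ≠ 0 := by rintro hs; rw [hs] at hden; simp at hden
    have e3 : (k ^ 4 * s ^ 2) * t ^ 2 = (k ^ 4 * s ^ 2) * s ^ 2 := by
      have : (k * t * s) ^ 2 * k ^ 2 = k ^ 4 * s ^ 4 := by
        linear_combination h2 - (k * t * s) ^ 2 * e2 +
          (k ^ 4 * s ^ 4 * s1 ^ 2 + k ^ 4 * s ^ 4) * e1
      linear_combination this
    have e4 : t ^ 2 = s ^ 2 := mul_left_cancel₀ (by positivity) e3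
    have hspos : 0 < s := by
      refine jacobiSn_pos hk (hre.1.lt_of_ne' fun h => hs ?_) hre.2
      simp only [s, h, jacobiSn_zero hk]
    have e5 : t = s := by nlinarith
    have hx : τ = z.re := jacobiSn_injOn hk ⟨hτ.1.le, hτ.2.le⟩ hre e5
    rw [← Complex.re_add_im z, ← hx, hy]

lemma snCDeriv_top (hk0 : 0 < k) (hk : k ^ 2 < 1) (x : ℝ) :
    snCDeriv k (x + ellipticK (complModulus k) * Complex.I) =
      ((-(jacobiCn x k * jacobiDn x k) / (k * jacobiSn x k ^ 2) : ℝ) : ℂ) := by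
  have hk' := complModulus_sq_lt_one hk0.ne' hk
  have hkC : (k : ℂ) ≠ 0 := by exact_mod_cast hk0.ne'
  simp only [snCDeriv, Complex.add_re, Complex.add_im, Complex.ofReal_re, Complex.ofReal_im,
    Complex.mul_re, Complex.mul_im, Complex.I_re, Complex.I_im, mul_zero, mul_one, sub_zero,
    add_zero, zero_add, jacobiSn_ellipticK hk', jacobiCn_ellipticK hk',
    jacobiDn_complModulus hk0 hk]
  by_cases hs : jacobiSn x k = 0
  · simp [hs]
  · have : (jacobiSn x k : ℂ) ≠ 0 := by exact_mod_cast hs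
    push_cast
    field_simp
    ring

lemma continuous_jacobi (hk : k ^ 2 < 1) :
    Continuous (fun u => jacobiSn u k) ∧ Continuous (fun u => jacobiCn u k) ∧
      Continuous (fun u => jacobiDn u k) :=
  ⟨(differentiable_jacobi hk).1.continuous, (differentiable_jacobi hk).2.1.continuous,
    (differentiable_jacobi hk).2.2.continuous⟩

end Rectangle

/-! ### The contour integral for the first Fourier coefficient. -/

section Contour

variable {k : ℝ}

/-- `1 / (1 - γ² sn² z)`, with the value `0` at the pole `i K'` of `sn`. -/
def recipOneSub (k γ : ℝ) : ℂ → ℂ :=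
  Function.update (fun z => (1 - (γ : ℂ) ^ 2 * snC k z ^ 2)⁻¹)
    (ellipticK (complModulus k) * Complex.I) 0

/-- `1 / sn z`. -/
def nsC (k : ℝ) (z : ℂ) : ℂ :=
  ((jacobiSn z.re k * jacobiDn z.im (complModulus k) : ℝ) -
    Complex.I * (jacobiCn z.re k * jacobiDn z.re k *
        (jacobiSn z.im (complModulus k) * jacobiCn z.im (complModulus k)) : ℝ)) /
    (jacobiSn z.re k ^ 2 * jacobiCn z.im (complModulus k) ^ 2 +
      jacobiSn z.im (complModulus k) ^ 2 : ℝ)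

/-- The numerator of `sn` times its conjugate factors into the denominators of `sn` and of `1/sn`;
this is what gives `nsC` its form. -/
lemma snC_mul_nsC_identity (s c d s1 c1 d1 k i : ℂ) (hc : c ^ 2 = 1 - s ^ 2)
    (hd : d ^ 2 = 1 - k ^ 2 * s ^ 2) (hc1 : c1 ^ 2 = 1 - s1 ^ 2)
    (hd1 : d1 ^ 2 = 1 - (1 - k ^ 2) * s1 ^ 2) (hi : i ^ 2 = -1) :
    (s * d1 + i * (c * d * (s1 * c1))) * (s * d1 - i * (c * d * (s1 * c1))) =
      (c1 ^ 2 + k ^ 2 * s ^ 2 * s1 ^ 2) * (s ^ 2 * c1 ^ 2 + s1 ^ 2) := by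
  grind

lemma snC_mul_nsC (hk0 : 0 < k) (hk : k ^ 2 < 1) {z : ℂ}
    (h1 : jacobiCn z.im (complModulus k) ^ 2 +
      k ^ 2 * jacobiSn z.re k ^ 2 * jacobiSn z.im (complModulus k) ^ 2 ≠ 0)
    (h2 : jacobiSn z.re k ^ 2 * jacobiCn z.im (complModulus k) ^ 2 +
      jacobiSn z.im (complModulus k) ^ 2 ≠ 0) : snC k z * nsC k z = 1 := by
  have hk' := complModulus_sq_lt_one hk0.ne' hk
  have rs := jacobiCn_sq z.re k
  have rd := jacobiDn_sq hk z.re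
  have rs1 := jacobiCn_sq z.im (complModulus k)
  have rd1 := jacobiDn_sq hk' z.im
  rw [complModulus_sq hk] at rd1
  have h1C := Complex.ofReal_ne_zero.2 h1
  have h2C := Complex.ofReal_ne_zero.2 h2
  rw [snC, nsC, div_mul_div_comm, div_eq_one_iff_eq (mul_ne_zero h1C h2C)]
  push_cast
  exact snC_mul_nsC_identity _ _ _ _ _ _ k _ (by exact_mod_cast rs) (by exact_mod_cast rd)
        (by exact_mod_cast rs1) (by exact_mod_cast rd1) Complex.I_sq

open Filter Topology in
lemma continuousAt_nsC (hk0 : 0 < k) (hk : k ^ 2 < 1) {z : ℂ}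
    (h2 : jacobiSn z.re k ^ 2 * jacobiCn z.im (complModulus k) ^ 2 +
      jacobiSn z.im (complModulus k) ^ 2 ≠ 0) : ContinuousAt (nsC k) z := by
  obtain ⟨a1, a2, a3⟩ := continuous_jacobi hk
  obtain ⟨b1, b2, b3⟩ := continuous_jacobi (complModulus_sq_lt_one hk0.ne' hk)
  have hs : Continuous fun z : ℂ => jacobiSn z.re k := a1.comp Complex.continuous_re
  have hc : Continuous fun z : ℂ => jacobiCn z.re k := a2.comp Complex.continuous_re
  have hd : Continuous fun z : ℂ => jacobiDn z.re k := a3.comp Complex.continuous_re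
  have hs1 : Continuous fun z : ℂ => jacobiSn z.im (complModulus k) :=
    b1.comp Complex.continuous_im
  have hc1 : Continuous fun z : ℂ => jacobiCn z.im (complModulus k) :=
    b2.comp Complex.continuous_im
  have hd1 : Continuous fun z : ℂ => jacobiDn z.im (complModulus k) :=
    b3.comp Complex.continuous_im
  unfold nsC
  refine ContinuousAt.div ?_ ?_ (Complex.ofReal_ne_zero.2 h2) <;>
  · refine Continuous.continuousAt ?_
    fun_prop

lemma isOpen_snC_denominator (hk0 : 0 < k) (hk : k ^ 2 < 1) :
    IsOpen {z : ℂ | jacobiCn z.im (complModulus k) ^ 2 +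
      k ^ 2 * jacobiSn z.re k ^ 2 * jacobiSn z.im (complModulus k) ^ 2 ≠ 0} := by
  obtain ⟨a1, a2, a3⟩ := continuous_jacobi hk
  obtain ⟨b1, b2, b3⟩ := continuous_jacobi (complModulus_sq_lt_one hk0.ne' hk)
  have hs : Continuous fun z : ℂ => jacobiSn z.re k := a1.comp Complex.continuous_re
  have hs1 : Continuous fun z : ℂ => jacobiSn z.im (complModulus k) :=
    b1.comp Complex.continuous_im
  have hc1 : Continuous fun z : ℂ => jacobiCn z.im (complModulus k) :=
    b2.comp Complex.continuous_im
  exact isOpen_ne_fun (by fun_prop) continuous_const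

open Filter Topology in
-- In terms of `ns = 1/sn`, which vanishes at `iK'`, the function is `ns²/(ns² - γ²)`. This extends
-- continuously by the value 0 because `γ ≠ 0`.
lemma continuousWithinAt_recipOneSub_corner (hk0 : 0 < k) (hk : k ^ 2 < 1) {γ : ℝ} (hγ : γ ≠ 0) :
    ContinuousWithinAt (recipOneSub k γ)
      (Icc 0 (ellipticK k) ×ℂ Icc 0 (ellipticK (complModulus k)))
      (ellipticK (complModulus k) * Complex.I) := by
  have hk' := complModulus_sq_lt_one hk0.ne' hk
  set p : ℂ := ellipticK (complModulus k) * Complex.I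
  have hp2 : jacobiSn p.re k ^ 2 * jacobiCn p.im (complModulus k) ^ 2 +
      jacobiSn p.im (complModulus k) ^ 2 ≠ 0 := by
    simp [p, jacobiSn_ellipticK hk', jacobiCn_ellipticK hk']
  have hns : ContinuousAt (nsC k) p := continuousAt_nsC hk0 hk hp2
  have hns0 : nsC k p = 0 := by
    simp [nsC, p, jacobiSn_zero hk, jacobiCn_ellipticK hk']
  have hγC : (γ : ℂ) ≠ 0 := by exact_mod_cast hγ
  have hcont : ContinuousAt (fun z => nsC k z ^ 2 / (nsC k z ^ 2 - (γ : ℂ) ^ 2)) p :=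
    (hns.pow 2).div ((hns.pow 2).sub continuousAt_const) (by simp [hns0, hγC])
  have hE : ∀ᶠ z : ℂ in 𝓝 p, jacobiSn z.re k ^ 2 * jacobiCn z.im (complModulus k) ^ 2 +
      jacobiSn z.im (complModulus k) ^ 2 ≠ 0 := by
    obtain ⟨a1, a2, a3⟩ := continuous_jacobi hk
    obtain ⟨b1, b2, b3⟩ := continuous_jacobi hk'
    have hs : Continuous fun z : ℂ => jacobiSn z.re k := a1.comp Complex.continuous_re
    have hs1 : Continuous fun z : ℂ => jacobiSn z.im (complModulus k) :=
      b1.comp Complex.continuous_im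
    have hc1 : Continuous fun z : ℂ => jacobiCn z.im (complModulus k) :=
      b2.comp Complex.continuous_im
    exact (isOpen_ne_fun (by fun_prop) continuous_const).mem_nhds hp2
  refine hcont.continuousWithinAt.congr_of_eventuallyEq ?_ ?_
  · filter_upwards [hE.filter_mono nhdsWithin_le_nhds, self_mem_nhdsWithin] with z hz hzr
    by_cases hzp : z = p
    · simp [hzp, recipOneSub, p, hns0]
    · have hden := snC_denominator_ne_zero hk0 hk hzr.1 hzr.2 hzp
      have hmul := snC_mul_nsC hk0 hk hden hz
      have hn : nsC k z ≠ 0 := right_ne_zero_of_mul_eq_one hmul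
      have hsn : snC k z = (nsC k z)⁻¹ := eq_inv_of_mul_eq_one_left hmul
      rw [recipOneSub, Function.update_of_ne hzp, hsn, inv_pow]
      rw [show 1 - (γ : ℂ) ^ 2 * (nsC k z ^ 2)⁻¹ = (nsC k z ^ 2 - (γ : ℂ) ^ 2) / nsC k z ^ 2 by
        field_simp, inv_div]
  · simp [recipOneSub, p, hns0]

lemma recipOneSub_im_eq_zero {γ : ℝ} {z : ℂ} (h : (snC k z ^ 2).im = 0) :
    (recipOneSub k γ z).im = 0 := by
  by_cases hz : z = ellipticK (complModulus k) * Complex.I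
  · simp [recipOneSub, hz]
  · have e : snC k z ^ 2 = ((snC k z ^ 2).re : ℝ) := Complex.ext (by simp) (by simp [h])
    rw [recipOneSub, Function.update_of_ne hz, e]
    rw [← Complex.ofReal_pow, ← Complex.ofReal_mul, ← Complex.ofReal_one, ← Complex.ofReal_sub,
      ← Complex.ofReal_inv, Complex.ofReal_im]

open Filter Topology in
lemma recipOneSub_eventuallyEq {γ : ℝ} {z : ℂ}
    (hz : z ≠ ellipticK (complModulus k) * Complex.I) :
    recipOneSub k γ =ᶠ[𝓝 z] fun z => (1 - (γ : ℂ) ^ 2 * snC k z ^ 2)⁻¹ := by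
  filter_upwards [isOpen_ne.mem_nhds hz] with y hy
  rw [recipOneSub, Function.update_of_ne hy]

open Filter Topology in
/-- The difference of `1 / (1 - γ² sn²)` and of an elementary function with the same pole. -/
lemma exists_regular_part (hk0 : 0 < k) (hk : k ^ 2 < 1) {τ : ℝ}
    (hτ : τ ∈ Ioo 0 (ellipticK k)) :
    ∃ H : ℂ → ℂ,
      ContinuousOn H (Icc 0 (ellipticK k) ×ℂ Icc 0 (ellipticK (complModulus k))) ∧
      DifferentiableOn ℂ H (Ioo 0 (ellipticK k) ×ℂ Ioo 0 (ellipticK (complModulus k))) ∧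
      ∀ z ≠ τ + ellipticK (complModulus k) * Complex.I,
        H z = recipOneSub k (k * jacobiSn τ k) z -
          ((-(π / ellipticK k * sin (π / ellipticK k * τ) * jacobiSn τ k /
            (2 * (jacobiCn τ k * jacobiDn τ k))) : ℝ) : ℂ) /
          (Complex.cos ((π / ellipticK k : ℝ) * (z - ellipticK (complModulus k) * Complex.I)) -
            (cos (π / ellipticK k * τ) : ℝ)) := by
  set K := ellipticK k with hKdef
  set K' := ellipticK (complModulus k) with hK'def
  set p : ℂ := K' * Complex.I with hp
  set z₀ : ℂ := τ + p with hz₀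
  set γ := k * jacobiSn τ k with hγ
  have hk' := complModulus_sq_lt_one hk0.ne' hk
  have hK : 0 < K := ellipticK_pos hk
  have hst := jacobiSn_pos hk hτ.1 hτ.2.le
  have hct := jacobiCn_pos hk hτ.1.le hτ.2
  have hdt := jacobiDn_pos hk τ
  have hγ0 : γ ≠ 0 := (mul_pos hk0 hst).ne'
  have ht : π / K * τ ∈ Ioo 0 π := by
    refine ⟨mul_pos (div_pos pi_pos hK) hτ.1, ?_⟩
    rw [div_mul_eq_mul_div, div_lt_iff₀ hK]
    exact mul_lt_mul_of_pos_left hτ.2 pi_pos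
  have hsin : sin (π / K * τ) ≠ 0 := (sin_pos_of_pos_of_lt_pi ht.1 ht.2).ne'
  set u : ℂ → ℂ := fun z => 1 - (γ : ℂ) ^ 2 * snC k z ^ 2 with hu
  set v : ℂ → ℂ := fun z => Complex.cos ((π / K : ℝ) * (z - p)) - (cos (π / K * τ) : ℝ) with hv
  have hvd : Differentiable ℂ v := by fun_prop
  have hud {z : ℂ} (hz : jacobiCn z.im (complModulus k) ^ 2 +
      k ^ 2 * jacobiSn z.re k ^ 2 * jacobiSn z.im (complModulus k) ^ 2 ≠ 0) :
      HasDerivAt u (-((γ : ℂ) ^ 2 * (2 * snC k z * snCDeriv k z))) z := by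
    simpa using! (((hasDerivAt_snC hk0.ne' hk hz).pow 2).const_mul ((γ : ℂ) ^ 2)).const_sub 1
  have hz₀p : z₀ ≠ p := by
    intro h
    have := congrArg Complex.re h
    simp [hz₀, hp] at this
    exact hτ.1.ne' this
  have hz₀re : z₀.re = τ := by simp [hz₀, hp]
  have hz₀im : z₀.im = K' := by simp [hz₀, hp]
  have hK'0 : 0 < K' := ellipticK_pos hk'
  have hden₀ := snC_denominator_ne_zero hk0 hk (z := z₀)
    (by rw [hz₀re]; exact ⟨hτ.1.le, hτ.2.le⟩) (by rw [hz₀im]; exact ⟨hK'0.le, le_rfl⟩) hz₀p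
  have hsn₀ : snC k z₀ = ((1 / γ : ℝ) : ℂ) := snC_top hk0 hk τ
  have hsnd₀ := snCDeriv_top hk0 hk τ
  have hu' : HasDerivAt u ((2 * (jacobiCn τ k * jacobiDn τ k) / jacobiSn τ k : ℝ) : ℂ) z₀ := by
    convert! hud hden₀ using 1
    rw [hsn₀, hsnd₀, hγ]
    norm_cast
    field_simp
  have hv' : HasDerivAt v ((-(π / K * sin (π / K * τ)) : ℝ) : ℂ) z₀ := by
    have h1 : HasDerivAt (fun z : ℂ => (π / K : ℝ) * (z - p)) ((π / K : ℝ) : ℂ) z₀ := by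
      simpa using ((hasDerivAt_id z₀).sub_const p).const_mul ((π / K : ℝ) : ℂ)
    convert! h1.ccos.sub_const _ using 1
    simp only [hz₀, add_sub_cancel_right]
    push_cast
    ring
  have hu0 : u z₀ = 0 := by
    simp only [hu, hsn₀]
    norm_cast
    field_simp
    simp
  have hv0 : v z₀ = 0 := by
    simp only [hv, hz₀, add_sub_cancel_right]
    push_cast
    ring
  obtain ⟨L, hL⟩ := exists_tendsto_sub_of_simple_poles
    ((isOpen_snC_denominator hk0 hk).mem_nhds hden₀)
    (fun z hz => (hud hz).differentiableAt.differentiableWithinAt) hvd.differentiableOn hu' hv'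
    hu0 hv0 (Complex.ofReal_ne_zero.2 (by positivity))
    (Complex.ofReal_ne_zero.2 (neg_ne_zero.2 (mul_ne_zero (by positivity) hsin)))
  -- The ratio `v'/u'` of the derivatives at `z₀`, that is, the coefficient for which the two simple
  -- poles cancel.
  set R : ℂ := ((-(π / K * sin (π / K * τ) * jacobiSn τ k /
            (2 * (jacobiCn τ k * jacobiDn τ k))) : ℝ) : ℂ) with hR
  have hRe : ((-(π / K * sin (π / K * τ)) : ℝ) : ℂ) /
      ((2 * (jacobiCn τ k * jacobiDn τ k) / jacobiSn τ k : ℝ) : ℂ) = R := by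
    rw [hR, ← Complex.ofReal_div]; congr 1; field_simp
  rw [hRe] at hL
  have hL' : Tendsto (fun z => recipOneSub k γ z - R / v z) (𝓝[≠] z₀) (𝓝 L) := by
    refine hL.congr' ?_
    filter_upwards [(recipOneSub_eventuallyEq (γ := γ) hz₀p).filter_mono nhdsWithin_le_nhds]
      with z hz
    rw [hz]
  have hvne {z : ℂ} (hre : z.re ∈ Icc 0 K) (h : z ≠ z₀) : v z ≠ 0 := by
    have e : ((π / K : ℝ) : ℂ) * (z - p) =
        ((π / K * z.re : ℝ) : ℂ) + ((π / K * (z.im - K') : ℝ) : ℂ) * Complex.I := by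
      conv_lhs => rw [← Complex.re_add_im z]
      rw [hp]; push_cast; ring
    simp only [hv, e]
    refine cos_add_mul_I_ne ⟨mul_nonneg (div_pos pi_pos hK).le hre.1, ?_⟩ ht ?_
    · rw [div_mul_eq_mul_div, div_le_iff₀ hK]
      exact mul_le_mul_of_nonneg_left hre.2 pi_pos.le
    · by_contra! hcon
      apply h
      have e1 : z.im = K' := by
        have := (mul_eq_zero.1 hcon.1).resolve_left (div_pos pi_pos hK).ne'
        linarith
      have e2 : z.re = τ := mul_left_cancel₀ (div_pos pi_pos hK).ne' hcon.2
      rw [hz₀, hp, ← Complex.re_add_im z, e1, e2]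
  have hdiff {z : ℂ} (hre : z.re ∈ Icc 0 K) (him : z.im ∈ Icc 0 K') (hzp : z ≠ p) (hz0 : z ≠ z₀) :
      DifferentiableAt ℂ (fun z => recipOneSub k γ z - R / v z) z := by
    have hden := snC_denominator_ne_zero hk0 hk hre him hzp
    have hune : u z ≠ 0 := fun h => hz0 (eq_of_sq_mul_snC_sq_eq_one hk0 hk hτ hre him hzp h)
    refine DifferentiableAt.sub ?_ ((differentiableAt_const R).div hvd.differentiableAt
      (hvne hre hz0))
    exact ((hud hden).differentiableAt.inv hune).congr_of_eventuallyEq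
      (recipOneSub_eventuallyEq hzp)
  refine ⟨Function.update (fun z => recipOneSub k γ z - R / v z) z₀ L, ?_, ?_, ?_⟩
  · rintro z ⟨hre, him⟩
    by_cases hz0 : z = z₀
    · rw [hz0]
      exact (continuousAt_update_same.2 hL').continuousWithinAt
    have hev : Function.update (fun z => recipOneSub k γ z - R / v z) z₀ L =ᶠ[𝓝 z]
        fun z => recipOneSub k γ z - R / v z := by
      filter_upwards [isOpen_ne.mem_nhds hz0] with y hy
      rw [Function.update_of_ne hy]
    -- At the corner `iK'` only continuity within the rectangle is established. This is enough, as
    -- Cauchy's theorem asks for differentiability in the interior alone.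
    by_cases hzp : z = p
    · refine ContinuousWithinAt.congr_of_eventuallyEq ?_ (hev.filter_mono nhdsWithin_le_nhds)
        hev.eq_of_nhds
      refine ContinuousWithinAt.sub ?_ (continuousWithinAt_const.div
        hvd.continuous.continuousWithinAt (hvne hre hz0))
      rw [hzp]
      exact continuousWithinAt_recipOneSub_corner hk0 hk hγ0
    · exact ((hdiff hre him hzp hz0).continuousAt.congr hev.symm).continuousWithinAt
  · rintro z ⟨hre, him⟩
    have hz0 : z ≠ z₀ := fun h => him.2.ne (by rw [h, hz₀im])
    have hzp : z ≠ p := fun h => him.2.ne (by rw [h]; simp [hp])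
    have hev : Function.update (fun z => recipOneSub k γ z - R / v z) z₀ L =ᶠ[𝓝 z]
        fun z => recipOneSub k γ z - R / v z := by
      filter_upwards [isOpen_ne.mem_nhds hz0] with y hy
      rw [Function.update_of_ne hy]
    exact ((hdiff ⟨hre.1.le, hre.2.le⟩ ⟨him.1.le, him.2.le⟩ hzp hz0).congr_of_eventuallyEq
      hev).differentiableWithinAt
  · intro z hz
    rw [Function.update_of_ne hz]

lemma im_mul_eq_zero_of_im {x y : ℂ} (hx : x.im = 0) (hy : y.im = 0) : (x * y).im = 0 := by
  simp [hx, hy]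

lemma re_mul_eq_zero {x y : ℂ} (hx : x.im = 0) (hy : y.re = 0) : (x * y).re = 0 := by
  simp [hx, hy]

lemma intervalIntegral_im {f : ℝ → ℂ} {a b : ℝ} (hf : IntervalIntegrable f MeasureTheory.volume a b) :
    (∫ x in a..b, f x).im = ∫ x in a..b, (f x).im :=
  (Complex.imCLM.intervalIntegral_comp_comm hf).symm

lemma intervalIntegral_re {f : ℝ → ℂ} {a b : ℝ} (hf : IntervalIntegrable f MeasureTheory.volume a b) :
    (∫ x in a..b, f x).re = ∫ x in a..b, (f x).re :=
  (Complex.reCLM.intervalIntegral_comp_comm hf).symm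

/-- The first Fourier coefficient of `1 / (1 - k² sn² τ sn² u)`. -/
theorem integral_cos_div_one_sub_sn_sq (hk0 : 0 < k) (hk : k ^ 2 < 1) {τ : ℝ}
    (hτ : τ ∈ Ioo 0 (ellipticK k)) :
    ∫ u in (0 : ℝ)..ellipticK k,
      cos (π / ellipticK k * u) / (1 - (k * jacobiSn τ k) ^ 2 * jacobiSn u k ^ 2) =
    -(π * sin (π / ellipticK k * τ) * jacobiSn τ k /
      (2 * (jacobiCn τ k * jacobiDn τ k)
        * sinh (π / ellipticK k * ellipticK (complModulus k)))) := by
  obtain ⟨H, hHc, hHd, hH⟩ := exists_regular_part hk0 hk hτ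
  set K := ellipticK k with hKdef
  set K' := ellipticK (complModulus k) with hK'def
  have hk' := complModulus_sq_lt_one hk0.ne' hk
  have hK : 0 < K := ellipticK_pos hk
  have hK' : 0 < K' := ellipticK_pos hk'
  have hst := jacobiSn_pos hk hτ.1 hτ.2.le
  have hct := jacobiCn_pos hk hτ.1.le hτ.2
  have hdt := jacobiDn_pos hk τ
  set γ := k * jacobiSn τ k with hγ
  set R : ℝ := -(π / K * sin (π / K * τ) * jacobiSn τ k /
            (2 * (jacobiCn τ k * jacobiDn τ k))) with hR
  set w := π / K * K' with hw
  have hw0 : 0 < w := mul_pos (div_pos pi_pos hK) hK'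
  have ht : π / K * τ ∈ Ioo 0 π := by
    refine ⟨mul_pos (div_pos pi_pos hK) hτ.1, ?_⟩
    rw [div_mul_eq_mul_div, div_lt_iff₀ hK]
    exact mul_lt_mul_of_pos_left hτ.2 pi_pos
  set ζ : ℂ → ℂ := fun z => (π / K : ℝ) * (z - K' * Complex.I) with hζ
  have hζe (x y : ℝ) : ζ (x + y * Complex.I) =
      ((π / K * x : ℝ) : ℂ) + ((π / K * (y - K') : ℝ) : ℂ) * Complex.I := by
    simp only [hζ]; push_cast; ring
  have hζd : Differentiable ℂ ζ := by fun_prop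
  -- On each of the four sides `sn²` is real, and on the top and vertical sides `cos ζ` is real too,
  -- so `H` is real there (off the pole). Since `sin ζ` is real on the top side and imaginary on the
  -- vertical ones, these three sides contribute nothing to the imaginary part of the contour
  -- integral.
  set f : ℂ → ℂ := fun z => H z * Complex.sin (ζ z) with hf
  have hfc : ContinuousOn f (Icc 0 K ×ℂ Icc 0 K') :=
    hHc.mul (Complex.continuous_sin.comp hζd.continuous).continuousOn
  have hfd : DifferentiableOn ℂ f (Ioo 0 K ×ℂ Ioo 0 K') :=
    hHd.mul (Complex.differentiable_sin.comp hζd).differentiableOn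
  have cauchy := Complex.integral_boundary_rect_eq_zero_of_continuousOn_of_differentiableOn f 0
    (K + K' * Complex.I) (by simpa [uIcc_of_le hK.le, uIcc_of_le hK'.le] using hfc)
    (by simpa [hK.le, hK'.le] using hfd)
  simp only [Complex.zero_re, Complex.zero_im, Complex.add_re, Complex.add_im, Complex.ofReal_re,
    Complex.ofReal_im, Complex.mul_re, Complex.mul_im, Complex.I_re, Complex.I_im, mul_zero,
    mul_one, sub_zero, add_zero, zero_add, smul_eq_mul, zero_mul, Complex.ofReal_zero] at cauchy
  have hkπ : 0 < π / K := div_pos pi_pos hK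
  have hpiK : π / K * K = π := by field_simp
  -- the sides of the rectangle
  have sideR : (∫ y in (0 : ℝ)..K', f (K + y * Complex.I)).re = 0 := by
    rw [intervalIntegral_re]
    · rw [intervalIntegral.integral_congr (g := fun _ => (0 : ℝ)), intervalIntegral.integral_zero]
      intro y _
      have hne : (K : ℂ) + y * Complex.I ≠ τ + K' * Complex.I := fun h => by
        have := congrArg Complex.re h; simp at this; exact hτ.2.ne' this
      refine re_mul_eq_zero ?_ ?_
      · rw [hH _ hne, Complex.sub_im, recipOneSub_im_eq_zero (snC_right_sq_im hk y)]
        have e : Complex.cos (ζ (K + y * Complex.I)) - (cos (π / K * τ) : ℝ) =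
            ((-cosh (π / K * (y - K')) - cos (π / K * τ) : ℝ) : ℂ) := by
          rw [hζe, hpiK]
          apply Complex.ext
          · rw [Complex.sub_re, cos_add_mul_I_re]; simp [-Complex.ofReal_cos, -Complex.ofReal_cosh]
          · rw [Complex.sub_im, cos_add_mul_I_im]; simp [-Complex.ofReal_cos, -Complex.ofReal_cosh]
        change 0 - ((R : ℂ) / (Complex.cos (ζ (K + y * Complex.I)) - (cos (π / K * τ) : ℝ))).im = 0
        rw [e, ← Complex.ofReal_div, Complex.ofReal_im, sub_zero]
      · rw [hζe, hpiK, sin_add_mul_I_re]; simp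
    · refine ContinuousOn.intervalIntegrable ?_
      refine hfc.comp (by fun_prop) fun y hy => ?_
      rw [uIcc_of_le hK'.le] at hy
      simpa [Complex.mem_reProdIm, hK.le] using hy
  have sideL : (∫ y in (0 : ℝ)..K', f (y * Complex.I)).re = 0 := by
    rw [intervalIntegral_re]
    · rw [intervalIntegral.integral_congr (g := fun _ => (0 : ℝ)), intervalIntegral.integral_zero]
      intro y _
      have hne : (y : ℂ) * Complex.I ≠ τ + K' * Complex.I := fun h => by
        have := congrArg Complex.re h; simp at this; exact hτ.1.ne this
      have hζ0 : ζ (y * Complex.I) = ((0 : ℝ) : ℂ) + ((π / K * (y - K') : ℝ) : ℂ) * Complex.I := by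
        have := hζe 0 y; simpa using this
      refine re_mul_eq_zero ?_ ?_
      · rw [hH _ hne, Complex.sub_im, recipOneSub_im_eq_zero (snC_left_sq_im hk y)]
        have e : Complex.cos (ζ (y * Complex.I)) - (cos (π / K * τ) : ℝ) =
            ((cosh (π / K * (y - K')) - cos (π / K * τ) : ℝ) : ℂ) := by
          rw [hζ0]
          apply Complex.ext
          · rw [Complex.sub_re, cos_add_mul_I_re]; simp [-Complex.ofReal_cos, -Complex.ofReal_cosh]
          · rw [Complex.sub_im, cos_add_mul_I_im]; simp [-Complex.ofReal_cos, -Complex.ofReal_cosh]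
        change 0 - ((R : ℂ) / (Complex.cos (ζ (y * Complex.I)) - (cos (π / K * τ) : ℝ))).im = 0
        rw [e, ← Complex.ofReal_div, Complex.ofReal_im, sub_zero]
      · rw [hζ0, sin_add_mul_I_re]; simp
    · refine ContinuousOn.intervalIntegrable ?_
      refine hfc.comp (by fun_prop) fun y hy => ?_
      rw [uIcc_of_le hK'.le] at hy
      simpa [Complex.mem_reProdIm, hK.le] using hy
  have top : (∫ x in (0 : ℝ)..K, f (x + K' * Complex.I)).im = 0 := by
    rw [intervalIntegral_im]
    -- Equality almost everywhere is used because `x = τ` is the pole, where `H` carries its limit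
    -- value instead of the formula.
    · rw [intervalIntegral.integral_congr_ae (g := fun _ => (0 : ℝ)),
        intervalIntegral.integral_zero]
      filter_upwards [MeasureTheory.compl_mem_ae_iff.2 (MeasureTheory.measure_singleton τ)]
        with x hx _
      have hne : (x : ℂ) + K' * Complex.I ≠ τ + K' * Complex.I := fun h => by
        have := congrArg Complex.re h; simp at this; exact hx this
      refine im_mul_eq_zero_of_im ?_ ?_
      · rw [hH _ hne, Complex.sub_im, recipOneSub_im_eq_zero]
        · have e : Complex.cos (ζ (x + K' * Complex.I)) - (cos (π / K * τ) : ℝ) =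
              ((cos (π / K * x) - cos (π / K * τ) : ℝ) : ℂ) := by
            rw [hζe, sub_self, mul_zero]; push_cast; simp
          change 0 - ((R : ℂ) /
            (Complex.cos (ζ (x + K' * Complex.I)) - (cos (π / K * τ) : ℝ))).im = 0
          rw [e, ← Complex.ofReal_div, Complex.ofReal_im, sub_zero]
        · rw [snC_top hk0 hk, ← Complex.ofReal_pow, Complex.ofReal_im]
      · rw [hζe, sub_self, mul_zero, sin_add_mul_I_im]; simp
    · refine ContinuousOn.intervalIntegrable ?_
      refine hfc.comp (by fun_prop) fun y hy => ?_
      rw [uIcc_of_le hK.le] at hy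
      simpa [Complex.mem_reProdIm, hK'.le] using hy
  have bottom : (∫ x in (0 : ℝ)..K, f x).im = 0 := by
    have := congrArg Complex.im cauchy
    simp only [Complex.add_im, Complex.sub_im, Complex.mul_im, Complex.I_re, Complex.I_im,
      zero_mul, one_mul, zero_add, Complex.zero_im] at this
    rw [top, sideR, sideL] at this
    linarith
  -- evaluation on the real axis
  have hζx (x : ℝ) : ζ x = ((π / K * x : ℝ) : ℂ) + ((-w : ℝ) : ℂ) * Complex.I := by
    have := hζe x 0; rw [zero_sub, mul_neg] at this; simpa [hw] using! this
  have hfx (x : ℝ) : f x = ((1 / (1 - γ ^ 2 * jacobiSn x k ^ 2) : ℝ) : ℂ) *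
      Complex.sin (((π / K * x : ℝ) : ℂ) + ((-w : ℝ) : ℂ) * Complex.I) -
      R * (Complex.sin (((π / K * x : ℝ) : ℂ) + ((-w : ℝ) : ℂ) * Complex.I) /
        (Complex.cos (((π / K * x : ℝ) : ℂ) + ((-w : ℝ) : ℂ) * Complex.I)
          - (cos (π / K * τ) : ℝ))) := by
    have hne : (x : ℂ) ≠ τ + K' * Complex.I := fun h => by
      have := congrArg Complex.im h; simp at this; exact hK'.ne this
    have hne2 : (x : ℂ) ≠ K' * Complex.I := fun h => by
      have := congrArg Complex.im h; simp at this; exact hK'.ne this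
    have e1 : recipOneSub k γ x = ((1 / (1 - γ ^ 2 * jacobiSn x k ^ 2) : ℝ) : ℂ) := by
      rw [recipOneSub, Function.update_of_ne hne2, snC_ofReal hk0 hk]; push_cast; ring
    simp only [hf]
    rw [hH _ hne, e1]
    change (_ - (R : ℂ) / (Complex.cos (ζ x) - (cos (π / K * τ) : ℝ))) * _ = _
    rw [hζx]
    ring
  have hγ1 : γ ^ 2 < 1 := by
    have h1 : jacobiSn τ k ^ 2 < 1 := by have := jacobiCn_sq τ k; nlinarith [pow_pos hct 2]
    rw [hγ, mul_pow]; nlinarith [pow_pos hst 2, pow_pos hk0 2]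
  have hmpos (x : ℝ) : 1 - γ ^ 2 * jacobiSn x k ^ 2 ≠ 0 :=
    (one_sub_mul_sin_sq_pos hγ1 (jacobiAm x k)).ne'
  have hsnc := (continuous_jacobi hk).1
  have i1 : Continuous fun x : ℝ => ((1 / (1 - γ ^ 2 * jacobiSn x k ^ 2) : ℝ) : ℂ) *
      Complex.sin (((π / K * x : ℝ) : ℂ) + ((-w : ℝ) : ℂ) * Complex.I) := by
    have : Continuous fun x : ℝ => 1 / (1 - γ ^ 2 * jacobiSn x k ^ 2) :=
      continuous_const.div (by fun_prop) hmpos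
    fun_prop
  have i2 : ContinuousOn (fun x : ℝ =>
      (Complex.sin (((π / K * x : ℝ) : ℂ) + ((-w : ℝ) : ℂ) * Complex.I) /
        (Complex.cos (((π / K * x : ℝ) : ℂ) + ((-w : ℝ) : ℂ) * Complex.I)
          - (cos (π / K * τ) : ℝ)))) (uIcc 0 K) := by
    refine ContinuousOn.div (by fun_prop) (by fun_prop) fun x hx => ?_
    rw [uIcc_of_le hK.le] at hx
    refine cos_add_mul_I_ne ⟨mul_nonneg hkπ.le hx.1, ?_⟩ ht (Or.inl (neg_ne_zero.2 hw0.ne'))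
    calc π / K * x ≤ π / K * K := mul_le_mul_of_nonneg_left hx.2 hkπ.le
      _ = π := hpiK
  have i3 : (∫ x in (0 : ℝ)..K,
      (Complex.sin (((π / K * x : ℝ) : ℂ) + ((-w : ℝ) : ℂ) * Complex.I) /
        (Complex.cos (((π / K * x : ℝ) : ℂ) + ((-w : ℝ) : ℂ) * Complex.I)
          - (cos (π / K * τ) : ℝ)))).im = -K := by
    rw [intervalIntegral.integral_comp_mul_left (fun x : ℝ =>
      (Complex.sin ((x : ℂ) + ((-w : ℝ) : ℂ) * Complex.I) /
        (Complex.cos ((x : ℂ) + ((-w : ℝ) : ℂ) * Complex.I)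
          - (cos (π / K * τ) : ℝ)))) hkπ.ne', mul_zero, hpiK, Complex.real_smul,
      Complex.im_ofReal_mul, im_integral_sin_div_cos_sub hw0 ht]
    field_simp
  rw [intervalIntegral.integral_congr (fun x _ => hfx x), intervalIntegral.integral_sub
    (i1.intervalIntegrable _ _) (i2.intervalIntegrable.const_mul _),
    intervalIntegral.integral_const_mul, Complex.sub_im, Complex.im_ofReal_mul, i3,
    intervalIntegral_im (i1.intervalIntegrable _ _)] at bottom
  have e (x : ℝ) : (((1 / (1 - γ ^ 2 * jacobiSn x k ^ 2) : ℝ) : ℂ) *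
      Complex.sin (((π / K * x : ℝ) : ℂ) + ((-w : ℝ) : ℂ) * Complex.I)).im =
      -sinh w * (cos (π / K * x) / (1 - γ ^ 2 * jacobiSn x k ^ 2)) := by
    rw [Complex.im_ofReal_mul, sin_add_mul_I_im, sinh_neg]; ring
  rw [intervalIntegral.integral_congr (fun x _ => e x),
    intervalIntegral.integral_const_mul] at bottom
  have hsh : sinh w ≠ 0 := (sinh_pos_iff.2 hw0).ne'
  -- The vanishing imaginary part of the bottom side reads `-sinh w · A + R K = 0`, with `A` the
  -- wanted integral.
  have hfin : ∀ A : ℝ, -sinh w * A - R * -K = 0 → A = R * K / sinh w := by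
    intro A hA
    field_simp
    linarith
  rw [hfin _ bottom, hR]
  field_simp

end Contour

/-! ### The potential and its level sets -/

section Potential

variable {α β : ℝ}

/-- The left maximum point of the potential. -/
def maxLeft (α β : ℝ) : ℝ := (-α + √(α ^ 2 - 4 * β)) / (2 * β)

/-- The right maximum point of the potential. -/
def maxRight (α β : ℝ) : ℝ := (-α - √(α ^ 2 - 4 * β)) / (2 * β)

lemma barrier_eq (α β : ℝ) :
    barrier α β = min (potential α β (maxLeft α β)) (potential α β (maxRight α β)) := rfl

lemma discr_sq (hβ : β < 0) : √(α ^ 2 - 4 * β) ^ 2 = α ^ 2 - 4 * β :=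
  sq_sqrt (by nlinarith [sq_nonneg α])

lemma abs_lt_discr (hβ : β < 0) : |α| < √(α ^ 2 - 4 * β) := by
  rw [← sqrt_sq_eq_abs]; exact sqrt_lt_sqrt (sq_nonneg α) (by linarith)

lemma maxLeft_neg (hβ : β < 0) : maxLeft α β < 0 :=
  div_neg_of_pos_of_neg (by linarith [le_abs_self α, abs_lt_discr (α := α) hβ]) (by linarith)

lemma maxRight_pos (hβ : β < 0) : 0 < maxRight α β :=
  div_pos_of_neg_of_neg (by linarith [neg_abs_le α, abs_lt_discr (α := α) hβ]) (by linarith)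

lemma potential_deriv_factor (hβ : β < 0) (q : ℝ) :
    q + α * q ^ 2 + β * q ^ 3 = β * q * (q - maxLeft α β) * (q - maxRight α β) := by
  have h := discr_sq (α := α) hβ
  have hb := hβ.ne
  simp only [maxLeft, maxRight]
  set D := √(α ^ 2 - 4 * β)
  field_simp
  linear_combination q * h

lemma hasStrictDerivAt_potential (q : ℝ) :
    HasStrictDerivAt (potential α β) (q + α * q ^ 2 + β * q ^ 3) q := by
  have h := ((((hasStrictDerivAt_id q).pow 2).div_const 2).add
    (((hasStrictDerivAt_id q).pow 3).const_mul (α / 3))).add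
    (((hasStrictDerivAt_id q).pow 4).const_mul (β / 4))
  convert! h using 1
  simp
  ring

lemma hasDerivAt_potential (q : ℝ) :
    HasDerivAt (potential α β) (q + α * q ^ 2 + β * q ^ 3) q :=
  (hasStrictDerivAt_potential q).hasDerivAt

lemma continuous_potential : Continuous (potential α β) := by
  unfold potential; fun_prop

lemma potential_zero : potential α β 0 = 0 := by simp [potential]

lemma strictMonoOn_potential_Iic (hβ : β < 0) : StrictMonoOn (potential α β) (Iic (maxLeft α β)) := by
  refine strictMonoOn_of_deriv_pos (convex_Iic _) continuous_potential.continuousOn fun x hx => ?_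
  rw [interior_Iic] at hx
  have hx : x < maxLeft α β := hx
  rw [(hasDerivAt_potential x).deriv, potential_deriv_factor hβ]
  have h1 := maxLeft_neg (α := α) hβ
  have h2 := maxRight_pos (α := α) hβ
  have : 0 < β * x := mul_pos_of_neg_of_neg hβ (by linarith)
  exact mul_pos_of_neg_of_neg (mul_neg_of_pos_of_neg this (by linarith)) (by linarith)

lemma strictAntiOn_potential_left (hβ : β < 0) :
    StrictAntiOn (potential α β) (Icc (maxLeft α β) 0) := by
  refine strictAntiOn_of_deriv_neg (convex_Icc _ _) continuous_potential.continuousOn fun x hx => ?_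
  rw [interior_Icc] at hx
  rw [(hasDerivAt_potential x).deriv, potential_deriv_factor hβ]
  have h2 := maxRight_pos (α := α) hβ
  have : 0 < β * x := mul_pos_of_neg_of_neg hβ hx.2
  exact mul_neg_of_pos_of_neg (mul_pos this (by linarith [hx.1])) (by linarith [hx.2])

lemma strictMonoOn_potential_right (hβ : β < 0) :
    StrictMonoOn (potential α β) (Icc 0 (maxRight α β)) := by
  refine strictMonoOn_of_deriv_pos (convex_Icc _ _) continuous_potential.continuousOn fun x hx => ?_
  rw [interior_Icc] at hx
  rw [(hasDerivAt_potential x).deriv, potential_deriv_factor hβ]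
  have h1 := maxLeft_neg (α := α) hβ
  have : β * x < 0 := mul_neg_of_neg_of_pos hβ hx.1
  exact mul_pos_of_neg_of_neg (mul_neg_of_neg_of_pos this (by linarith [hx.1]))
    (by linarith [hx.2])

lemma strictAntiOn_potential_Ici (hβ : β < 0) :
    StrictAntiOn (potential α β) (Ici (maxRight α β)) := by
  refine strictAntiOn_of_deriv_neg (convex_Ici _) continuous_potential.continuousOn fun x hx => ?_
  rw [interior_Ici] at hx
  have hx : maxRight α β < x := hx
  rw [(hasDerivAt_potential x).deriv, potential_deriv_factor hβ]
  have h1 := maxLeft_neg (α := α) hβ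
  have h2 := maxRight_pos (α := α) hβ
  have : β * x < 0 := mul_neg_of_neg_of_pos hβ (by linarith)
  exact mul_neg_of_neg_of_pos (mul_neg_of_neg_of_pos this (by linarith)) (by linarith)

lemma potential_maxLeft (hβ : β < 0) : potential α β (maxLeft α β) =
    (α - √(α ^ 2 - 4 * β)) ^ 2 * (α * (√(α ^ 2 - 4 * β) - α) + 6 * β) / (96 * β ^ 3) := by
  have h := discr_sq (α := α) hβ
  have hb := hβ.ne
  simp only [maxLeft, potential]
  set D := √(α ^ 2 - 4 * β)
  field_simp
  linear_combination (α - D) ^ 2 * 288 * h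

lemma potential_maxRight (hβ : β < 0) : potential α β (maxRight α β) =
    -((√(α ^ 2 - 4 * β) + α) ^ 2 * (α * (√(α ^ 2 - 4 * β) + α) - 6 * β)) / (96 * β ^ 3) := by
  have h := discr_sq (α := α) hβ
  have hb := hβ.ne
  simp only [maxRight, potential]
  set D := √(α ^ 2 - 4 * β)
  field_simp
  linear_combination (α + D) ^ 2 * 288 * h

/-- The difference of the two maxima is `α` times a nonnegative factor, so the sign of `α` decides
which of them is the barrier. -/
lemma potential_maxRight_sub (hβ : β < 0) :
    potential α β (maxRight α β) - potential α β (maxLeft α β) =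
      α * (√(α ^ 2 - 4 * β) / (-β) * (-1 / (3 * β) + α ^ 2 / (12 * β ^ 2))) := by
  have h := discr_sq (α := α) hβ
  have hb := hβ.ne
  rw [potential_maxLeft hβ, potential_maxRight hβ]
  set D := √(α ^ 2 - 4 * β)
  field_simp
  ring_nf
  have h3 : D ^ 3 = D * (α ^ 2 - 4 * β) := by rw [← h]; ring
  rw [h3]
  ring

lemma potential_maxRight_sub_factor_nonneg (hβ : β < 0) :
    0 ≤ √(α ^ 2 - 4 * β) / (-β) * (-1 / (3 * β) + α ^ 2 / (12 * β ^ 2)) := by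
  refine mul_nonneg (div_nonneg (sqrt_nonneg _) (by linarith)) (add_nonneg ?_ (by positivity))
  exact div_nonneg_of_nonpos (by norm_num) (by linarith)

lemma barrier_of_nonneg (hβ : β < 0) (hα : 0 ≤ α) : barrier α β =
    (α - √(α ^ 2 - 4 * β)) ^ 2 * (α * (√(α ^ 2 - 4 * β) - α) + 6 * β) / (96 * β ^ 3) := by
  rw [barrier_eq, min_eq_left, potential_maxLeft hβ]
  have := mul_nonneg hα (potential_maxRight_sub_factor_nonneg (α := α) hβ)
  rw [← potential_maxRight_sub hβ] at this
  linarith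

lemma barrier_of_nonpos (hβ : β < 0) (hα : α ≤ 0) : barrier α β =
    -((√(α ^ 2 - 4 * β) + α) ^ 2 * (α * (√(α ^ 2 - 4 * β) + α) - 6 * β)) / (96 * β ^ 3) := by
  rw [barrier_eq, min_eq_right, potential_maxRight hβ]
  have := mul_nonpos_of_nonpos_of_nonneg hα (potential_maxRight_sub_factor_nonneg (α := α) hβ)
  rw [← potential_maxRight_sub hβ] at this
  linarith

/-- For `|q|` above this explicit bound the quartic term outweighs the quadratic and cubic ones. It
supplies the far endpoints in the intermediate value argument for the outer roots. -/
lemma potential_nonpos_of_le_abs (hβ : β < 0) {q : ℝ}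
    (hq : 1 + (4 * |α| / 3 + 2) / (-β) ≤ |q|) : potential α β q ≤ 0 := by
  have hβ' : 0 < -β := by linarith
  have h0 : 0 ≤ (4 * |α| / 3 + 2) / (-β) := by positivity
  have h1 : 4 * |α| / 3 + 2 ≤ |q| * (-β) := by
    rw [← div_le_iff₀ hβ']; linarith
  have h2 : 1 ≤ |q| := by linarith
  have h3 : α * q ≤ |α| * |q| := by rw [← abs_mul]; exact le_abs_self _
  have h4 : q ^ 2 = |q| ^ 2 := (sq_abs q).symm
  have h5 : potential α β q = q ^ 2 * (1 / 2 + α * q / 3 + β / 4 * q ^ 2) := by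
    rw [potential]; ring
  rw [h5]
  refine mul_nonpos_of_nonneg_of_nonpos (sq_nonneg q) ?_
  rw [h4]
  nlinarith [abs_nonneg α, mul_le_mul_of_nonneg_right h1 (abs_nonneg q)]

/-- The position of the four roots with respect to the critical points of the potential. -/
structure RootsSpec (α β ξ a b c d : ℝ) : Prop where
  hd : d < maxLeft α β
  hc : maxLeft α β < c
  hc0 : c < 0
  hb0 : 0 < b
  hb : b < maxRight α β
  ha : maxRight α β < a
  va : potential α β a = ξ
  vb : potential α β b = ξ
  vc : potential α β c = ξ
  vd : potential α β d = ξ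

/-- One root in each of the four intervals cut out by `maxLeft`, `0` and `maxRight`: the potential
exceeds `ξ` at both maxima and lies below it at `0` and far out. -/
lemma exists_rootsSpec (hβ : β < 0) {ξ : ℝ} (hξ : ξ ∈ Ioo 0 (barrier α β)) :
    ∃ a b c d, RootsSpec α β ξ a b c d := by
  have hl : ξ < potential α β (maxLeft α β) := hξ.2.trans_le (by rw [barrier_eq]; exact min_le_left _ _)
  have hr : ξ < potential α β (maxRight α β) :=
    hξ.2.trans_le (by rw [barrier_eq]; exact min_le_right _ _)
  have h1 := maxLeft_neg (α := α) hβ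
  have h2 := maxRight_pos (α := α) hβ
  set N := 1 + (4 * |α| / 3 + 2) / (-β)
  have hcont : ∀ s, ContinuousOn (potential α β) s := fun s => continuous_potential.continuousOn
  have e1 : potential α β (-(max N (-maxLeft α β))) ≤ 0 := by
    refine potential_nonpos_of_le_abs hβ ?_
    rw [abs_neg]; exact (le_max_left _ _).trans (le_abs_self _)
  have e2 : potential α β (max N (maxRight α β)) ≤ 0 := by
    refine potential_nonpos_of_le_abs hβ ?_
    exact (le_max_left _ _).trans (le_abs_self _)
  obtain ⟨d, hd, vd⟩ := intermediate_value_Ioo (by linarith [le_max_right N (-maxLeft α β)])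
    (hcont (Icc (-(max N (-maxLeft α β))) (maxLeft α β))) ⟨by linarith [hξ.1], hl⟩
  obtain ⟨c, hc, vc⟩ := intermediate_value_Ioo' h1.le (hcont (Icc (maxLeft α β) 0))
    ⟨by rw [potential_zero]; exact hξ.1, hl⟩
  obtain ⟨b, hb, vb⟩ := intermediate_value_Ioo h2.le (hcont (Icc 0 (maxRight α β)))
    ⟨by rw [potential_zero]; exact hξ.1, hr⟩
  obtain ⟨a, ha, va⟩ := intermediate_value_Ioo' (le_max_right N (maxRight α β))
    (hcont (Icc (maxRight α β) (max N (maxRight α β)))) ⟨by linarith [hξ.1], hr⟩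
  exact ⟨a, b, c, d, hd.2, hc.1, hc.2, hb.1, hb.2, ha.1, va, vb, vc, vd⟩

/-- Strict monotonicity on each of the four intervals excludes further roots. -/
lemma RootsSpec.isDescendingRoots (hβ : β < 0) {ξ a b c d : ℝ} (h : RootsSpec α β ξ a b c d) :
    IsDescendingRoots α β ξ a b c d := by
  obtain ⟨hd, hc, hc0, hb0, hb, ha, va, vb, vc, vd⟩ := h
  refine ⟨by linarith, by linarith, by linarith, fun q => ⟨fun hq => ?_, ?_⟩⟩
  · have vq : potential α β q = ξ := by linarith
    rcases le_total q (maxLeft α β) with h1 | h1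
    · right; right; right
      exact (strictMonoOn_potential_Iic hβ).injOn h1 hd.le (vq.trans vd.symm)
    rcases le_total q 0 with h2 | h2
    · right; right; left
      exact (strictAntiOn_potential_left hβ).injOn ⟨h1, h2⟩ ⟨hc.le, hc0.le⟩ (vq.trans vc.symm)
    rcases le_total q (maxRight α β) with h3 | h3
    · right; left
      exact (strictMonoOn_potential_right hβ).injOn ⟨h2, h3⟩ ⟨hb0.le, hb.le⟩ (vq.trans vb.symm)
    · left
      exact (strictAntiOn_potential_Ici hβ).injOn h3 ha.le (vq.trans va.symm)
  · rintro (rfl | rfl | rfl | rfl) <;> linarith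

lemma IsDescendingRoots.unique {ξ a b c d a' b' c' d' : ℝ} (h : IsDescendingRoots α β ξ a b c d)
    (h' : IsDescendingRoots α β ξ a' b' c' d') : a = a' ∧ b = b' ∧ c = c' ∧ d = d' := by
  obtain ⟨h1, h2, h3, h4⟩ := h
  obtain ⟨h1', h2', h3', h4'⟩ := h'
  have key (q : ℝ) : (q = a ∨ q = b ∨ q = c ∨ q = d) ↔ (q = a' ∨ q = b' ∨ q = c' ∨ q = d') :=
    (h4 q).symm.trans (h4' q)
  have ea : a = a' := le_antisymm
    (by rcases (key a).1 (by simp) with e | e | e | e <;> linarith)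
    (by rcases (key a').2 (by simp) with e | e | e | e <;> linarith)
  have eb : b = b' := le_antisymm
    (by rcases (key b).1 (by simp) with e | e | e | e <;> linarith)
    (by rcases (key b').2 (by simp) with e | e | e | e <;> linarith)
  have ec : c = c' := le_antisymm
    (by rcases (key c).1 (by simp) with e | e | e | e <;> linarith)
    (by rcases (key c').2 (by simp) with e | e | e | e <;> linarith)
  have ed : d = d' := le_antisymm
    (by rcases (key d).1 (by simp) with e | e | e | e <;> linarith)
    (by rcases (key d').2 (by simp) with e | e | e | e <;> linarith)
  exact ⟨ea, eb, ec, ed⟩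

lemma IsDescendingRoots.rootsSpec (hβ : β < 0) {ξ a b c d : ℝ} (hξ : ξ ∈ Ioo 0 (barrier α β))
    (h : IsDescendingRoots α β ξ a b c d) : RootsSpec α β ξ a b c d := by
  obtain ⟨a', b', c', d', h'⟩ := exists_rootsSpec hβ hξ
  obtain ⟨rfl, rfl, rfl, rfl⟩ := h.unique (h'.isDescendingRoots hβ)
  exact h'

lemma existsUnique_roots (hβ : β < 0) {ξ : ℝ} (hξ : ξ ∈ Ioo 0 (barrier α β)) :
    ∃! r : ℝ × ℝ × ℝ × ℝ, IsDescendingRoots α β ξ r.1 r.2.1 r.2.2.1 r.2.2.2 := by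
  obtain ⟨a, b, c, d, h⟩ := exists_rootsSpec hβ hξ
  refine ⟨(a, b, c, d), h.isDescendingRoots hβ, fun r hr => ?_⟩
  obtain ⟨h1, h2, h3, h4⟩ := hr.unique (h.isDescendingRoots hβ)
  exact Prod.ext h1 (Prod.ext h2 (Prod.ext h3 h4))

lemma IsDescendingRoots.factor {ξ a b c d : ℝ} (h : IsDescendingRoots α β ξ a b c d) (q : ℝ) :
    ξ - potential α β q = -β / 4 * ((a - q) * (b - q) * (q - c) * (q - d)) := by
  obtain ⟨hab, hbc, hcd, hr⟩ := h
  have va := (hr a).2 (by simp)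
  have vb := (hr b).2 (by simp)
  have vc := (hr c).2 (by simp)
  have vd := (hr d).2 (by simp)
  simp only [potential] at va vb vc vd ⊢
  -- The successive divided differences of the quartic at its roots vanish. Newton's interpolation
  -- formula then recombines them into the factorization.
  have dd2 (x y : ℝ) (hxy : x ≠ y) (hx : ξ - (x ^ 2 / 2 + α / 3 * x ^ 3 + β / 4 * x ^ 4) = 0)
      (hy : ξ - (y ^ 2 / 2 + α / 3 * y ^ 3 + β / 4 * y ^ 4) = 0) :
      (x + y) / 2 + α / 3 * (x ^ 2 + x * y + y ^ 2) +
        β / 4 * (x ^ 3 + x ^ 2 * y + x * y ^ 2 + y ^ 3) = 0 := by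
    apply (mul_eq_zero.1 _).resolve_left (sub_ne_zero.2 hxy)
    linear_combination hy - hx
  have ab := dd2 a b hab.ne' va vb
  have ac := dd2 a c (by linarith) va vc
  have ad := dd2 a d (by linarith) va vd
  have abc : 1 / 2 + α / 3 * (a + b + c) +
      β / 4 * (a ^ 2 + b ^ 2 + c ^ 2 + a * b + a * c + b * c) = 0 := by
    apply (mul_eq_zero.1 _).resolve_left (sub_ne_zero.2 hbc.ne')
    linear_combination ab - ac
  have abd : 1 / 2 + α / 3 * (a + b + d) +
      β / 4 * (a ^ 2 + b ^ 2 + d ^ 2 + a * b + a * d + b * d) = 0 := by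
    have hbd : b - d ≠ 0 := by linarith
    apply (mul_eq_zero.1 _).resolve_left hbd
    linear_combination ab - ad
  have abcd : α / 3 + β / 4 * (a + b + c + d) = 0 := by
    apply (mul_eq_zero.1 _).resolve_left (sub_ne_zero.2 hcd.ne')
    linear_combination abc - abd
  linear_combination va + (q - a) * -ab + (q - a) * (q - b) * -abc +
    (q - a) * (q - b) * (q - c) * -abcd

lemma RootsSpec.qLeft_eq (hβ : β < 0) {ξ a b c d : ℝ} (h : RootsSpec α β ξ a b c d) :
    qLeft α β ξ = c := by
  have hd := (h.isDescendingRoots hβ)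
  refine IsGreatest.csSup_eq ⟨⟨h.hc0, h.vc⟩, ?_⟩
  rintro q ⟨hq, hv⟩
  have hb0 := h.hb0
  rcases (hd.2.2.2 q).1 (by linarith) with e | e | e | e <;> linarith [hd.1, hd.2.1, hd.2.2.1]

lemma RootsSpec.qRight_eq (hβ : β < 0) {ξ a b c d : ℝ} (h : RootsSpec α β ξ a b c d) :
    qRight α β ξ = b := by
  have hd := (h.isDescendingRoots hβ)
  refine IsLeast.csInf_eq ⟨⟨h.hb0, h.vb⟩, ?_⟩
  rintro q ⟨hq, hv⟩
  have hc0 := h.hc0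
  rcases (hd.2.2.2 q).1 (by linarith) with e | e | e | e <;> linarith [hd.1, hd.2.1, hd.2.2.1]

open Filter Topology in
-- A right inverse of `V` with values in an open set where `V` is injective must agree with the
-- local inverse near `x`, so its continuity need not be known beforehand. This serves both for the
-- roots and for the inverse of the action.
lemma hasDerivAt_root {V : ℝ → ℝ} {U : Set ℝ} (hU : IsOpen U) (hinj : InjOn V U) {r : ℝ → ℝ}
    {x V' : ℝ} (hr : ∀ᶠ y in 𝓝 x, r y ∈ U ∧ V (r y) = y) (hV : HasStrictDerivAt V V' (r x))
    (hV' : V' ≠ 0) : HasDerivAt r V'⁻¹ x := by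
  have hx := hr.self_of_nhds
  have h1 := hV.to_localInverse hV'
  have h2 := hV.eventually_right_inverse hV'
  have h3 : hV.localInverse V V' (r x) hV' (V (r x)) = r x :=
    HasStrictFDerivAt.localInverse_apply_image _
  rw [hx.2] at h1 h2 h3
  refine h1.hasDerivAt.congr_of_eventuallyEq ?_
  have h4 : ∀ᶠ y in 𝓝 x, hV.localInverse V V' (r x) hV' y ∈ U :=
    h1.hasDerivAt.continuousAt.eventually_mem (hU.mem_nhds (by rw [h3]; exact hx.1))
  filter_upwards [h2, h4, hr] with y hy2 hy4 hyr
  exact hinj hyr.1 hy4 (hyr.2.trans hy2.symm)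

lemma differentiableAt_roots (hβ : β < 0) {a b c d : ℝ → ℝ}
    (h : ∀ ξ ∈ Ioo 0 (barrier α β), RootsSpec α β ξ (a ξ) (b ξ) (c ξ) (d ξ)) {ξ : ℝ}
    (hξ : ξ ∈ Ioo 0 (barrier α β)) :
    DifferentiableAt ℝ a ξ ∧ DifferentiableAt ℝ b ξ ∧ DifferentiableAt ℝ c ξ ∧
      DifferentiableAt ℝ d ξ := by
  have hev : ∀ᶠ y in nhds ξ, y ∈ Ioo 0 (barrier α β) := isOpen_Ioo.mem_nhds hξ
  have hne {q : ℝ} (h0 : q ≠ 0) (h1 : q ≠ maxLeft α β) (h2 : q ≠ maxRight α β) :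
      q + α * q ^ 2 + β * q ^ 3 ≠ 0 := by
    rw [potential_deriv_factor hβ]
    exact mul_ne_zero (mul_ne_zero (mul_ne_zero hβ.ne h0) (sub_ne_zero.2 h1)) (sub_ne_zero.2 h2)
  have H := h ξ hξ
  have := H.hd; have := H.hc; have := H.hc0; have := H.hb0; have := H.hb; have := H.ha
  refine ⟨?_, ?_, ?_, ?_⟩
  · refine (hasDerivAt_root isOpen_Ioi ((strictAntiOn_potential_Ici hβ).injOn.mono Ioi_subset_Ici_self)
      (hev.mono fun y hy => ⟨(h y hy).ha, (h y hy).va⟩) (hasStrictDerivAt_potential _)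
      (hne ?_ ?_ ?_)).differentiableAt <;> linarith
  · refine (hasDerivAt_root isOpen_Ioo ((strictMonoOn_potential_right hβ).injOn.mono Ioo_subset_Icc_self)
      (hev.mono fun y hy => ⟨⟨(h y hy).hb0, (h y hy).hb⟩, (h y hy).vb⟩)
      (hasStrictDerivAt_potential _) (hne ?_ ?_ ?_)).differentiableAt <;> linarith
  · refine (hasDerivAt_root isOpen_Ioo ((strictAntiOn_potential_left hβ).injOn.mono Ioo_subset_Icc_self)
      (hev.mono fun y hy => ⟨⟨(h y hy).hc, (h y hy).hc0⟩, (h y hy).vc⟩)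
      (hasStrictDerivAt_potential _) (hne ?_ ?_ ?_)).differentiableAt <;> linarith
  · refine (hasDerivAt_root isOpen_Iio ((strictMonoOn_potential_Iic hβ).injOn.mono Iio_subset_Iic_self)
      (hev.mono fun y hy => ⟨(h y hy).hd, (h y hy).vd⟩) (hasStrictDerivAt_potential _)
      (hne ?_ ?_ ?_)).differentiableAt <;> linarith

end Potential

/-! ### The elliptic parametrization of the well -/

section Substitution

variable {a b c d : ℝ}

/-- The parametrization of `[c, b]` by the amplitude. -/
def ampPos (b c d t : ℝ) : ℝ := d + (c - d) / (1 - gammaSq b c d * sin t ^ 2)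

/-- The amplitude of a point of `[c, b]`. -/
def ampOf (b c d q : ℝ) : ℝ := arcsin √((b - d) * (q - c) / ((b - c) * (q - d)))

lemma gammaSq_mem (hcd : d < c) (hbc : c < b) : gammaSq b c d ∈ Ioo 0 1 := by
  refine ⟨div_pos (by linarith) (by linarith), ?_⟩
  rw [gammaSq, div_lt_one (by linarith)]; linarith

lemma modulus_sq (hcd : d < c) (hbc : c < b) (hab : b < a) :
    modulus a b c d ^ 2 = (b - c) * (a - d) / ((a - c) * (b - d)) := by
  refine sq_sqrt (div_nonneg (mul_nonneg ?_ ?_) (mul_nonneg ?_ ?_)) <;> linarith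

lemma modulus_sq_lt_one (hcd : d < c) (hbc : c < b) (hab : b < a) : modulus a b c d ^ 2 < 1 := by
  have h : 0 < (a - c) * (b - d) := mul_pos (by linarith) (by linarith)
  rw [modulus_sq hcd hbc hab, div_lt_one h]
  nlinarith [mul_pos (sub_pos.2 hab) (sub_pos.2 hcd)]

lemma modulus_pos (hcd : d < c) (hbc : c < b) (hab : b < a) : 0 < modulus a b c d := by
  refine sqrt_pos.2 (div_pos (mul_pos ?_ ?_) (mul_pos ?_ ?_)) <;> linarith

lemma modulus_mem (hcd : d < c) (hbc : c < b) (hab : b < a) : modulus a b c d ∈ Ioo 0 1 := by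
  refine ⟨modulus_pos hcd hbc hab, ?_⟩
  have h1 := modulus_sq_lt_one hcd hbc hab
  have h2 := modulus_pos hcd hbc hab
  nlinarith

lemma one_sub_gammaSq_mul_pos (hcd : d < c) (hbc : c < b) (t : ℝ) :
    0 < 1 - gammaSq b c d * sin t ^ 2 := by
  have h := gammaSq_mem hcd hbc
  nlinarith [sin_sq_le_one t, h.1, h.2, sq_nonneg (sin t)]

lemma ampPos_zero : ampPos b c d 0 = c := by simp [ampPos]

lemma ampPos_pi_div_two (hcd : d < c) (hbc : c < b) : ampPos b c d (π / 2) = b := by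
  have h1 : b - d ≠ 0 := by linarith
  have h2 : c - d ≠ 0 := by linarith
  rw [ampPos, sin_pi_div_two, gammaSq, show 1 - (b - c) / (b - d) * 1 ^ 2 = (c - d) / (b - d) by
    field_simp; ring]
  field_simp
  ring

lemma continuous_ampPos (hcd : d < c) (hbc : c < b) : Continuous (ampPos b c d) :=
  continuous_const.add (continuous_const.div (by fun_prop)
    fun t => (one_sub_gammaSq_mul_pos hcd hbc t).ne')

lemma hasDerivAt_ampPos (hcd : d < c) (hbc : c < b) (t : ℝ) :
    HasDerivAt (ampPos b c d) ((c - d) * (2 * gammaSq b c d * sin t * cos t) /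
      (1 - gammaSq b c d * sin t ^ 2) ^ 2) t := by
  have hD := one_sub_gammaSq_mul_pos hcd hbc t
  have h := (((((hasDerivAt_sin t).pow 2).const_mul (gammaSq b c d)).const_sub 1).inv
    hD.ne').const_mul (c - d)
  convert! h.const_add d using 1
  simp
  ring

lemma strictMonoOn_ampPos (hcd : d < c) (hbc : c < b) :
    StrictMonoOn (ampPos b c d) (Icc 0 (π / 2)) := by
  refine strictMonoOn_of_deriv_pos (convex_Icc _ _) (continuous_ampPos hcd hbc).continuousOn
    fun t ht => ?_
  rw [interior_Icc] at ht
  rw [(hasDerivAt_ampPos hcd hbc t).deriv]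
  have h1 := one_sub_gammaSq_mul_pos hcd hbc t
  have h2 := (gammaSq_mem hcd hbc).1
  have h3 := sin_pos_of_pos_of_lt_pi ht.1 (by linarith [ht.2, pi_pos])
  have h4 := cos_pos_of_mem_Ioo ⟨by linarith [ht.1, pi_pos], ht.2⟩
  have h5 := sub_pos.2 hcd
  positivity

lemma ampOf_arg_mem (hcd : d < c) (hbc : c < b) {q : ℝ} (hq : q ∈ Icc c b) :
    (b - d) * (q - c) / ((b - c) * (q - d)) ∈ Icc 0 1 := by
  have h1 : 0 < b - c := by linarith
  have h2 : 0 < q - d := by linarith [hq.1]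
  refine ⟨div_nonneg (mul_nonneg (by linarith) (by linarith [hq.1])) (by positivity), ?_⟩
  rw [div_le_one (by positivity)]
  nlinarith [hq.2, mul_nonneg (sub_nonneg.2 hq.2) (sub_pos.2 hcd).le]

lemma ampOf_mem (b c d q : ℝ) :
    ampOf b c d q ∈ Icc 0 (π / 2) :=
  ⟨arcsin_nonneg.2 (sqrt_nonneg _), arcsin_le_pi_div_two _⟩

lemma sin_ampOf_sq (hcd : d < c) (hbc : c < b) {q : ℝ} (hq : q ∈ Icc c b) :
    sin (ampOf b c d q) ^ 2 = (b - d) * (q - c) / ((b - c) * (q - d)) := by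
  have h := ampOf_arg_mem hcd hbc hq
  rw [ampOf, sin_arcsin (by linarith [sqrt_nonneg ((b - d) * (q - c) / ((b - c) * (q - d)))])
    (sqrt_le_one.2 h.2), sq_sqrt h.1]

lemma ampPos_ampOf (hcd : d < c) (hbc : c < b) {q : ℝ} (hq : q ∈ Icc c b) :
    ampPos b c d (ampOf b c d q) = q := by
  have h1 : b - c ≠ 0 := by linarith
  have h2 : q - d ≠ 0 := by linarith [hq.1]
  have h3 : b - d ≠ 0 := by linarith
  have h4 : c - d ≠ 0 := by linarith
  rw [ampPos, sin_ampOf_sq hcd hbc hq, gammaSq,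
    show 1 - (b - c) / (b - d) * ((b - d) * (q - c) / ((b - c) * (q - d))) = (c - d) / (q - d) by
      field_simp; ring]
  field_simp
  ring

lemma ampPos_mem_Icc (hcd : d < c) (hbc : c < b) {t : ℝ} (ht : t ∈ Icc 0 (π / 2)) :
    ampPos b c d t ∈ Icc c b := by
  have hm := (strictMonoOn_ampPos hcd hbc).monotoneOn
  have h0 := hm ⟨le_rfl, by positivity⟩ ht ht.1
  have h1 := hm ht ⟨by positivity, le_rfl⟩ ht.2
  rw [ampPos_zero] at h0
  rw [ampPos_pi_div_two hcd hbc] at h1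
  exact ⟨h0, h1⟩

lemma ampOf_ampPos (hcd : d < c) (hbc : c < b) {t : ℝ} (ht : t ∈ Icc 0 (π / 2)) :
    ampOf b c d (ampPos b c d t) = t :=
  (strictMonoOn_ampPos hcd hbc).injOn (ampOf_mem _ _ _ _) ht
    (ampPos_ampOf hcd hbc (ampPos_mem_Icc hcd hbc ht))

lemma ampOf_mem_Ioo (hcd : d < c) (hbc : c < b) {q : ℝ} (hq : q ∈ Ioo c b) :
    ampOf b c d q ∈ Ioo 0 (π / 2) := by
  have h := ampOf_mem b c d q
  have e := ampPos_ampOf hcd hbc ⟨hq.1.le, hq.2.le⟩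
  refine ⟨h.1.lt_of_ne fun h0 => ?_, h.2.lt_of_ne fun h0 => ?_⟩
  · rw [← h0, ampPos_zero] at e; exact hq.1.ne e
  · rw [h0, ampPos_pi_div_two hcd hbc] at e; exact hq.2.ne' e

lemma ampPos_mem_Ioo (hcd : d < c) (hbc : c < b) {t : ℝ} (ht : t ∈ Ioo 0 (π / 2)) :
    ampPos b c d t ∈ Ioo c b := by
  have hm := strictMonoOn_ampPos hcd hbc
  have h0 := hm ⟨le_rfl, by positivity⟩ ⟨ht.1.le, ht.2.le⟩ ht.1
  have h1 := hm ⟨ht.1.le, ht.2.le⟩ ⟨by positivity, le_rfl⟩ ht.2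
  rw [ampPos_zero] at h0
  rw [ampPos_pi_div_two hcd hbc] at h1
  exact ⟨h0, h1⟩

lemma image_ampPos_Ioo (hcd : d < c) (hbc : c < b) {φ : ℝ} (hφ : φ ∈ Icc 0 (π / 2)) :
    ampPos b c d '' Ioo 0 φ = Ioo c (ampPos b c d φ) := by
  have hm := strictMonoOn_ampPos hcd hbc
  have h0 : (0 : ℝ) ∈ Icc 0 (π / 2) := ⟨le_rfl, by positivity⟩
  ext q
  constructor
  · rintro ⟨t, ht, rfl⟩
    have ht' : t ∈ Icc 0 (π / 2) := ⟨ht.1.le, ht.2.le.trans hφ.2⟩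
    have := hm h0 ht' ht.1
    rw [ampPos_zero] at this
    exact ⟨this, hm ht' hφ ht.2⟩
  · intro hq
    have hqI : q ∈ Icc c b := ⟨hq.1.le, hq.2.le.trans (ampPos_mem_Icc hcd hbc hφ).2⟩
    have e := ampPos_ampOf hcd hbc hqI
    have ht := ampOf_mem b c d q
    refine ⟨ampOf b c d q, ⟨?_, ?_⟩, e⟩
    · rw [← hm.lt_iff_lt h0 ht, e, ampPos_zero]; exact hq.1
    · rw [← hm.lt_iff_lt ht hφ, e]; exact hq.2

open MeasureTheory in
/-- Change of variables `q = ampPos t`. -/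
lemma integral_comp_ampPos (hcd : d < c) (hbc : c < b) {φ : ℝ} (hφ : φ ∈ Icc 0 (π / 2))
    {g h : ℝ → ℝ} (hh : IntervalIntegrable h volume 0 φ)
    (hg : ∀ t ∈ Ioo 0 φ, (c - d) * (2 * gammaSq b c d * sin t * cos t) /
      (1 - gammaSq b c d * sin t ^ 2) ^ 2 * g (ampPos b c d t) = h t) :
    IntervalIntegrable g volume c (ampPos b c d φ) ∧
      ∫ q in c..ampPos b c d φ, g q = ∫ t in (0 : ℝ)..φ, h t := by
  have hle : c ≤ ampPos b c d φ := (ampPos_mem_Icc hcd hbc hφ).1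
  have hm : MonotoneOn (ampPos b c d) (Ioo 0 φ) := (strictMonoOn_ampPos hcd hbc).monotoneOn.mono
    fun t ht => ⟨ht.1.le, ht.2.le.trans hφ.2⟩
  have hd : ∀ t ∈ Ioo 0 φ, HasDerivWithinAt (ampPos b c d) _ (Ioo 0 φ) t :=
    fun t _ => (hasDerivAt_ampPos hcd hbc t).hasDerivWithinAt
  constructor
  -- The open interval and the monotone form of the substitution rule are used since the main
  -- integrand, `1/p`, is unbounded at the turning points.
  · rw [intervalIntegrable_iff_integrableOn_Ioo_of_le hle, ← image_ampPos_Ioo hcd hbc hφ,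
      integrableOn_image_iff_integrableOn_deriv_smul_of_monotoneOn measurableSet_Ioo hd hm]
    rw [intervalIntegrable_iff_integrableOn_Ioo_of_le hφ.1] at hh
    exact hh.congr_fun (fun t ht => (hg t ht).symm) measurableSet_Ioo
  · rw [intervalIntegral.integral_of_le hle, integral_Ioc_eq_integral_Ioo,
      ← image_ampPos_Ioo hcd hbc hφ,
      integral_image_eq_integral_deriv_smul_of_monotoneOn measurableSet_Ioo hd hm,
      intervalIntegral.integral_of_le hφ.1, integral_Ioc_eq_integral_Ioo]
    exact setIntegral_congr_fun measurableSet_Ioo hg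

/-- With `D = 1 - γ² sin² t` the factors are `q - d = (c-d)/D`, `q - c = (c-d)γ² sin² t/D`, `b - q =
(b-c) cos² t/D` and `a - q = (a-c)(1 - k² sin² t)/D`, the last because `k² = γ²(a-d)/(a-c)`. -/
lemma quartic_ampPos (hcd : d < c) (hbc : c < b) (hab : b < a) (t : ℝ) :
    (a - ampPos b c d t) * (b - ampPos b c d t) * (ampPos b c d t - c) * (ampPos b c d t - d) =
      ((c - d) * (b - c) * (a - c) * (sin t * cos t)
        * √(1 - modulus a b c d ^ 2 * sin t ^ 2) / (1 - gammaSq b c d * sin t ^ 2) ^ 2) ^ 2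
        / ((a - c) * (b - d)) := by
  have hD := one_sub_gammaSq_mul_pos hcd hbc t
  have hΔ := one_sub_mul_sin_sq_pos (modulus_sq_lt_one hcd hbc hab) t
  have h1 : a - c ≠ 0 := by linarith
  have h2 : b - d ≠ 0 := by linarith
  rw [div_pow, mul_pow _ (√_), sq_sqrt hΔ.le, modulus_sq hcd hbc hab, mul_pow _ (sin t * cos t),
    mul_pow (sin t), cos_sq', ampPos]
  rw [gammaSq] at hD ⊢
  have hD' : (b - d) - (b - c) * sin t ^ 2 ≠ 0 := by
    intro h
    apply hD.ne'
    field_simp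
    linear_combination h
  have e : 1 - (b - c) / (b - d) * sin t ^ 2 = ((b - d) - (b - c) * sin t ^ 2) / (b - d) := by
    field_simp
  rw [e]
  field_simp
  ring

lemma momentum_ampPos {α β ξ : ℝ} (hβ : β < 0) (h : IsDescendingRoots α β ξ a b c d) {t : ℝ}
    (ht : t ∈ Icc 0 (π / 2)) :
    momentum α β (ampPos b c d t) ξ = √(|β| / 2) / √((a - c) * (b - d)) *
      ((c - d) * (b - c) * (a - c) * (sin t * cos t)
        * √(1 - modulus a b c d ^ 2 * sin t ^ 2) / (1 - gammaSq b c d * sin t ^ 2) ^ 2) := by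
  have hf := h.factor (ampPos b c d t)
  obtain ⟨hab, hbc, hcd, -⟩ := h
  rw [momentum, hf, quartic_ampPos hcd hbc hab]
  set Y := (c - d) * (b - c) * (a - c) * (sin t * cos t)
        * √(1 - modulus a b c d ^ 2 * sin t ^ 2) / (1 - gammaSq b c d * sin t ^ 2) ^ 2 with hY
  have hY0 : 0 ≤ Y := by
    have h1 := sub_pos.2 hcd
    have h2 := sub_pos.2 hbc
    have h3 : 0 < a - c := by linarith
    have h4 := sin_nonneg_of_nonneg_of_le_pi ht.1 (by linarith [ht.2, pi_pos])
    have h5 := cos_nonneg_of_mem_Icc ⟨by linarith [ht.1, pi_pos], ht.2⟩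
    positivity
  rw [abs_of_neg hβ, show 2 * (-β / 4 * (Y ^ 2 / ((a - c) * (b - d)))) =
    (-β / 2) * Y ^ 2 / ((a - c) * (b - d)) by ring, sqrt_div (by nlinarith [sq_nonneg Y]),
    sqrt_mul (by linarith), sqrt_sq hY0]
  ring

end Substitution

/-! ### The time integral, and the reduction of the action to complete elliptic integrals. -/

section Action

variable {a b c d : ℝ}

/-- The factor between time and the elliptic integral of the first kind. -/
def timeScale (β a b c d : ℝ) : ℝ := 2 / (√(|β| / 2) * √((a - c) * (b - d)))

lemma timeScale_pos {β : ℝ} (hβ : β < 0) (hcd : d < c) (hbc : c < b) (hab : b < a) :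
    0 < timeScale β a b c d := by
  have h1 : 0 < |β| := abs_pos.2 hβ.ne
  have h2 : 0 < a - c := by linarith
  have h3 : 0 < b - d := by linarith
  unfold timeScale
  positivity

lemma sin_mul_cos_pos {t : ℝ} (ht : t ∈ Ioo 0 (π / 2)) : 0 < sin t * cos t :=
  mul_pos (sin_pos_of_pos_of_lt_pi ht.1 (by linarith [ht.2, pi_pos]))
    (cos_pos_of_mem_Ioo ⟨by linarith [ht.1, pi_pos], ht.2⟩)

/-- The factors `sin t cos t / D²` of the momentum and of `dq/dt` cancel, leaving a multiple of
`1/√(1 - k² sin² t)`. -/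
lemma integral_inv_momentum {α β ξ : ℝ} (hβ : β < 0) (h : IsDescendingRoots α β ξ a b c d)
    {φ : ℝ} (hφ : φ ∈ Icc 0 (π / 2)) :
    IntervalIntegrable (fun q => (momentum α β q ξ)⁻¹) MeasureTheory.volume c (ampPos b c d φ) ∧
      ∫ q in c..ampPos b c d φ, (momentum α β q ξ)⁻¹ =
        timeScale β a b c d * ellipticF (modulus a b c d) φ := by
  have h' := h
  obtain ⟨hab, hbc, hcd, -⟩ := h'
  have hk := modulus_sq_lt_one hcd hbc hab
  rw [ellipticF, ← intervalIntegral.integral_const_mul]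
  refine integral_comp_ampPos hcd hbc hφ
    (((continuous_one_div_sqrt hk).const_smul (timeScale β a b c d)).intervalIntegrable _ _) ?_
  intro t ht
  have htI : t ∈ Ioo 0 (π / 2) := ⟨ht.1, ht.2.trans_le hφ.2⟩
  rw [momentum_ampPos hβ h ⟨htI.1.le, htI.2.le⟩]
  have h1 : 0 < |β| := abs_pos.2 hβ.ne
  have h2 : 0 < a - c := by linarith
  have h3 : 0 < b - d := by linarith
  have h4 := sub_pos.2 hcd
  have h5 := sub_pos.2 hbc
  have h6 := one_sub_gammaSq_mul_pos hcd hbc t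
  have h7 := sqrt_one_sub_mul_sin_sq_pos hk t
  have h8 : sin t ≠ 0 := left_ne_zero_of_mul (sin_mul_cos_pos htI).ne'
  have h9 : cos t ≠ 0 := right_ne_zero_of_mul (sin_mul_cos_pos htI).ne'
  have hW : 0 < √((a - c) * (b - d)) := sqrt_pos.2 (mul_pos h2 h3)
  have hW2 : √((a - c) * (b - d)) ^ 2 = (a - c) * (b - d) := sq_sqrt (mul_pos h2 h3).le
  have hB : 0 < √(|β| / 2) := sqrt_pos.2 (by positivity)
  have hg : gammaSq b c d * (b - d) = b - c := by rw [gammaSq]; field_simp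
  simp only [timeScale]
  set W := √((a - c) * (b - d))
  set B := √(|β| / 2)
  set Δ := √(1 - modulus a b c d ^ 2 * sin t ^ 2)
  set n := gammaSq b c d
  set D := 1 - n * sin t ^ 2
  field_simp
  rw [hW2]
  linear_combination (a - c) * hg

/-- With `x = sin² t` and `D = 1 - n x`, the `Xᵢ` are the coefficients of `x(1-x)(1-mx)` in powers
of `D`, and the `Aᵢ` those of the ansatz for the primitive. The hypotheses `h4`, …, `h0`, `hm1`
compare the coefficients of `D⁻⁴`, …, `D⁰`, `D¹`. -/
lemma reduction_identity {n m A₁ A₂ A₃ e f g X₀ X₁ X₂ X₃ x : ℝ} (hn : n ≠ 0)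
    (hX₀ : n ^ 3 * X₀ = n ^ 2 - (1 + m) * n + m)
    (hX₁ : n ^ 3 * X₁ = -n ^ 2 + 2 * (1 + m) * n - 3 * m)
    (hX₂ : n ^ 3 * X₂ = -(1 + m) * n + 3 * m) (hX₃ : n ^ 3 * X₃ = -m)
    (h4 : X₀ = 6 * n * X₀ * A₃) (h3 : X₁ = n * (5 * X₁ * A₃ + 4 * X₀ * A₂))
    (h2 : X₂ = n * (4 * X₂ * A₃ + 3 * X₁ * A₂ + 2 * X₀ * A₁))
    (h1 : X₃ = n * (3 * X₃ * A₃ + 2 * X₂ * A₂ + X₁ * A₁) + g)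
    (h0 : 0 = n ^ 2 * X₃ * A₂ + e * (n - m) + n * f)
    (hm1 : 0 = -n ^ 2 * X₃ * A₁ + e * m) (hD : 1 - n * x ≠ 0) :
    x * (1 - x) * (1 - m * x) / (1 - n * x) ^ 4 =
      ((1 - 2 * x) * (1 - m * x) - m * x * (1 - x)) *
        (A₁ / (1 - n * x) + A₂ / (1 - n * x) ^ 2 + A₃ / (1 - n * x) ^ 3) +
      2 * n * (x * (1 - x) * (1 - m * x)) *
        (A₁ / (1 - n * x) ^ 2 + 2 * A₂ / (1 - n * x) ^ 3 + 3 * A₃ / (1 - n * x) ^ 4) +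
      (e * (1 - m * x) + f + g / (1 - n * x)) := by
  obtain ⟨D, hDdef⟩ : ∃ D, D = 1 - n * x := ⟨_, rfl⟩
  rw [← hDdef] at hD ⊢
  have eX : x * (1 - x) * (1 - m * x) = X₀ + X₁ * D + X₂ * D ^ 2 + X₃ * D ^ 3 := by
    apply mul_left_cancel₀ (pow_ne_zero 3 hn)
    rw [hDdef]
    linear_combination -hX₀ - (1 - n * x) * hX₁ - (1 - n * x) ^ 2 * hX₂ - (1 - n * x) ^ 3 * hX₃
  have eL : (1 - 2 * x) * (1 - m * x) - m * x * (1 - x) =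
      -n * (X₁ + 2 * X₂ * D + 3 * X₃ * D ^ 2) := by
    apply mul_left_cancel₀ (pow_ne_zero 2 hn)
    rw [hDdef]
    linear_combination hX₁ + 2 * (1 - n * x) * hX₂ + 3 * (1 - n * x) ^ 2 * hX₃
  have eM : e * (1 - m * x) + f = n * X₃ * A₁ * D - n * X₃ * A₂ := by
    apply mul_left_cancel₀ hn
    rw [hDdef]
    linear_combination -h0 - (1 - n * x) * hm1
  rw [eX, eL, eM]
  field_simp
  linear_combination h4 + D * h3 + D ^ 2 * h2 + D ^ 3 * h1

/-- The reduction of `∫ sin² cos² Δ / D⁴` to complete integrals. -/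
lemma hasDerivAt_reduction {n m A₁ A₂ A₃ e f g X₀ X₁ X₂ X₃ : ℝ} (hn : n ≠ 0)
    (hX₀ : n ^ 3 * X₀ = n ^ 2 - (1 + m) * n + m)
    (hX₁ : n ^ 3 * X₁ = -n ^ 2 + 2 * (1 + m) * n - 3 * m)
    (hX₂ : n ^ 3 * X₂ = -(1 + m) * n + 3 * m) (hX₃ : n ^ 3 * X₃ = -m)
    (h4 : X₀ = 6 * n * X₀ * A₃) (h3 : X₁ = n * (5 * X₁ * A₃ + 4 * X₀ * A₂))
    (h2 : X₂ = n * (4 * X₂ * A₃ + 3 * X₁ * A₂ + 2 * X₀ * A₁))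
    (h1 : X₃ = n * (3 * X₃ * A₃ + 2 * X₂ * A₂ + X₁ * A₁) + g)
    (h0 : 0 = n ^ 2 * X₃ * A₂ + e * (n - m) + n * f) (hm1 : 0 = -n ^ 2 * X₃ * A₁ + e * m) {t : ℝ}
    (hD : 1 - n * sin t ^ 2 ≠ 0) (hΔ : 0 < 1 - m * sin t ^ 2) :
    HasDerivAt (fun t => sin t * cos t * √(1 - m * sin t ^ 2) *
      (A₁ / (1 - n * sin t ^ 2) + A₂ / (1 - n * sin t ^ 2) ^ 2 + A₃ / (1 - n * sin t ^ 2) ^ 3))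
      (sin t ^ 2 * cos t ^ 2 * √(1 - m * sin t ^ 2) / (1 - n * sin t ^ 2) ^ 4 -
        (e * √(1 - m * sin t ^ 2) + f * (1 / √(1 - m * sin t ^ 2)) +
          g * (1 / ((1 - n * sin t ^ 2) * √(1 - m * sin t ^ 2))))) t := by
  have hs := hasDerivAt_sin t
  have hc := hasDerivAt_cos t
  have hden := (((hs.pow 2).const_mul n).const_sub 1)
  have hΔ' := (((hs.pow 2).const_mul m).const_sub 1).sqrt hΔ.ne'
  have hY := ((hs.mul hc).mul hΔ').mul ((((hasDerivAt_const t A₁).div hden hD).add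
    ((hasDerivAt_const t A₂).div (hden.pow 2) (pow_ne_zero 2 hD))).add
    ((hasDerivAt_const t A₃).div (hden.pow 3) (pow_ne_zero 3 hD)))
  convert! hY using 1
  simp only [Pi.pow_apply, Pi.mul_apply, Pi.add_apply, Pi.div_apply]
  have hsq : √(1 - m * sin t ^ 2) ^ 2 = 1 - m * sin t ^ 2 := sq_sqrt hΔ.le
  have hpos := sqrt_pos.2 hΔ
  have hcos := cos_sq' t
  set s := sin t
  set cc := cos t
  set S := √(1 - m * s ^ 2)
  have key := reduction_identity hn hX₀ hX₁ hX₂ hX₃ h4 h3 h2 h1 h0 hm1 hD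
  have hS : S ≠ 0 := hpos.ne'
  -- Multiplying by the square root leaves only its even powers, which turns the claim into the
  -- rational identity `key`.
  apply mul_left_cancel₀ hS
  have e1 : S * (s ^ 2 * cc ^ 2 * S / (1 - n * s ^ 2) ^ 4 -
        (e * S + f * (1 / S) + g * (1 / ((1 - n * s ^ 2) * S)))) =
      s ^ 2 * (1 - s ^ 2) * (1 - m * s ^ 2) / (1 - n * s ^ 2) ^ 4 -
        (e * (1 - m * s ^ 2) + f + g / (1 - n * s ^ 2)) := by
    rw [← hsq, ← hcos]
    field_simp
  rw [e1, key, add_sub_cancel_right, ← hsq]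
  norm_num
  field_simp
  rw [hcos]
  ring

/-- The primitive carries the factor `sin t cos t` and vanishes at both ends. -/
lemma integral_eq_of_reduction {k n e f g A₁ A₂ A₃ : ℝ} (hk : k ^ 2 < 1) (hn : n ∈ Ioo 0 1)
    (hd : ∀ t, HasDerivAt (fun t => sin t * cos t * √(1 - k ^ 2 * sin t ^ 2) *
      (A₁ / (1 - n * sin t ^ 2) + A₂ / (1 - n * sin t ^ 2) ^ 2 + A₃ / (1 - n * sin t ^ 2) ^ 3))
      (sin t ^ 2 * cos t ^ 2 * √(1 - k ^ 2 * sin t ^ 2) / (1 - n * sin t ^ 2) ^ 4 -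
        (e * √(1 - k ^ 2 * sin t ^ 2) + f * (1 / √(1 - k ^ 2 * sin t ^ 2)) +
          g * (1 / ((1 - n * sin t ^ 2) * √(1 - k ^ 2 * sin t ^ 2))))) t) :
    ∫ t in (0 : ℝ)..(π / 2), sin t ^ 2 * cos t ^ 2 * √(1 - k ^ 2 * sin t ^ 2) /
      (1 - n * sin t ^ 2) ^ 4 = e * ellipticE k + f * ellipticK k + g * ellipticPi n k := by
  have hD (t : ℝ) : 1 - n * sin t ^ 2 ≠ 0 := by
    have : 0 < 1 - n * sin t ^ 2 := by nlinarith [sin_sq_le_one t, sq_nonneg (sin t), hn.1, hn.2]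
    exact this.ne'
  have hΔ (t : ℝ) := (sqrt_one_sub_mul_sin_sq_pos hk t).ne'
  have c1 : Continuous fun t => sin t ^ 2 * cos t ^ 2 * √(1 - k ^ 2 * sin t ^ 2) /
      (1 - n * sin t ^ 2) ^ 4 :=
    Continuous.div (by fun_prop) (by fun_prop) fun t => pow_ne_zero 4 (hD t)
  have c2 : Continuous fun t => e * √(1 - k ^ 2 * sin t ^ 2) := by fun_prop
  have c3 : Continuous fun t => f * (1 / √(1 - k ^ 2 * sin t ^ 2)) :=
    continuous_const.mul (continuous_one_div_sqrt hk)
  have c4 : Continuous fun t => g * (1 / ((1 - n * sin t ^ 2) * √(1 - k ^ 2 * sin t ^ 2))) :=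
    continuous_const.mul (continuous_const.div (by fun_prop) fun t => mul_ne_zero (hD t) (hΔ t))
  have c23 : Continuous fun t => e * √(1 - k ^ 2 * sin t ^ 2) +
      f * (1 / √(1 - k ^ 2 * sin t ^ 2)) := c2.add c3
  have c234 : Continuous fun t => e * √(1 - k ^ 2 * sin t ^ 2) +
      f * (1 / √(1 - k ^ 2 * sin t ^ 2)) +
      g * (1 / ((1 - n * sin t ^ 2) * √(1 - k ^ 2 * sin t ^ 2))) := c23.add c4
  have h := intervalIntegral.integral_eq_sub_of_hasDerivAt (a := 0) (b := π / 2)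
    (fun t _ => hd t) ((c1.sub c234).intervalIntegrable _ _)
  rw [intervalIntegral.integral_sub (c1.intervalIntegrable _ _) (c234.intervalIntegrable _ _),
    intervalIntegral.integral_add (c23.intervalIntegrable _ _) (c4.intervalIntegrable _ _),
    intervalIntegral.integral_add (c2.intervalIntegrable _ _) (c3.intervalIntegrable _ _)] at h
  simp only [intervalIntegral.integral_const_mul, cos_pi_div_two, sin_zero, mul_zero, zero_mul,
    sub_zero] at h
  rw [ellipticE, ellipticK, ellipticF, ellipticPi]
  linarith

lemma closedAction_eq_integral {β : ℝ} (hcd : d < c) (hbc : c < b) (hab : b < a) :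
    π * closedAction β a b c d =
      √(2 * |β|) / √((a - c) * (b - d)) * ((c - d) ^ 2 * (b - c) * (a - c) * gammaSq b c d) *
      ∫ t in (0 : ℝ)..(π / 2), sin t ^ 2 * cos t ^ 2 * √(1 - modulus a b c d ^ 2 * sin t ^ 2) /
        (1 - gammaSq b c d * sin t ^ 2) ^ 4 := by
  have hk := modulus_sq_lt_one hcd hbc hab
  have hγ := gammaSq_mem hcd hbc
  have hD (t : ℝ) := (one_sub_gammaSq_mul_pos hcd hbc t).ne'
  have hΔ (t : ℝ) := one_sub_mul_sin_sq_pos hk t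
  have hm := modulus_sq hcd hbc hab
  -- In terms of the gaps between consecutive roots every denominator is a product of positive
  -- quantities, and the remaining claims are polynomial identities.
  obtain ⟨q, hq⟩ : ∃ q, q = c - d := ⟨_, rfl⟩
  obtain ⟨p, hp⟩ : ∃ p, p = b - c := ⟨_, rfl⟩
  obtain ⟨r, hr⟩ : ∃ r, r = a - b := ⟨_, rfl⟩
  have hq0 : 0 < q := by linarith
  have hp0 : 0 < p := by linarith
  have hr0 : 0 < r := by linarith
  have e1 : b - d = p + q := by rw [hp, hq]; ring
  have e2 : a - c = p + r := by rw [hp, hr]; ring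
  have e3 : a - d = p + q + r := by rw [hp, hq, hr]; ring
  have ec : c = d + q := by rw [hq]; ring
  have eb : b = d + q + p := by rw [hp, hq]; ring
  have ea : a = d + q + p + r := by rw [hp, hq, hr]; ring
  have hn : gammaSq b c d = p / (p + q) := by rw [gammaSq, ← hp, e1]
  rw [e1, e2, e3, ← hp] at hm
  -- The `Xᵢ` expand the cubic, the `Aᵢ` solve the triangular system `h4`, `h3`, `h2`, and `e`, `f`,
  -- `g` are the coefficients of `E`, `K`, `Π` in `closedAction`, up to the common prefactor.
  have key := integral_eq_of_reduction hk hγ (fun t => hasDerivAt_reduction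
    (n := gammaSq b c d) (m := modulus a b c d ^ 2)
    (X₀ := (p + q) * q ^ 2 / (p ^ 2 * (p + r)))
    (X₁ := -((p + q) * q * (2 * p + r + 3 * q)) / (p ^ 2 * (p + r)))
    (X₂ := (p + q) * (p ^ 2 + p * r + 4 * p * q + 2 * q * r + 3 * q ^ 2) / (p ^ 2 * (p + r)))
    (X₃ := -((p + q) ^ 2 * (p + q + r)) / (p ^ 2 * (p + r)))
    (A₁ := (p + q) / (2 * p * q ^ 2) * ((p ^ 2 + p * r + 4 * p * q + 2 * q * r + 3 * q ^ 2) / 3 -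
      (2 * p + r + 3 * q) ^ 2 / 8))
    (A₂ := -((2 * p + r + 3 * q) * (p + q)) / (24 * p * q)) (A₃ := 1 / (6 * (p / (p + q))))
    (e := (a - c) * (b - d) * (3 * a ^ 2 - 2 * a * (b + c + d) + 3 * b ^ 2 - 2 * b * (c + d) +
      3 * c ^ 2 - 2 * c * d + 3 * d ^ 2) / (48 * (q ^ 2 * p * (p + r) * (p / (p + q)))))
    (f := -((c - d) * ((d - b) * (a ^ 2 + a * (-4 * b - 4 * c + 6 * d) + 3 * b ^ 2 - 2 * b * c +
      3 * c ^ 2 - 3 * d ^ 2))) / (48 * (q ^ 2 * p * (p + r) * (p / (p + q)))))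
    (g := -((c - d) * (3 * (a ^ 3 - a ^ 2 * (b + c + d) - a * (b ^ 2 - 2 * b * (c + d) +
      (c - d) ^ 2) + b ^ 3 - b ^ 2 * (c + d) - b * (c - d) ^ 2 + (c - d) ^ 2 * (c + d)))) /
      (48 * (q ^ 2 * p * (p + r) * (p / (p + q)))))
    hγ.1.ne' (by rw [hm, hn]; field_simp; ring) (by rw [hm, hn]; field_simp; ring)
    (by rw [hm, hn]; field_simp; ring) (by rw [hm, hn]; field_simp)
    (by rw [hn]; field_simp) (by rw [hn]; field_simp; ring) (by rw [hn]; field_simp; ring)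
    (by rw [hn, ea, eb, ec]; field_simp; ring)
    (by rw [hn, hm, ea, eb, ec]; field_simp; ring)
    (by rw [hn, hm, ea, eb, ec]; field_simp; ring) (hD t) (hΔ t))
  rw [key, closedAction, hn, e1, e2, ← hp, ← hq]
  have hW : √((p + r) * (p + q)) ≠ 0 := (sqrt_pos.2 (by positivity)).ne'
  field_simp
  ring

end Action

/-! ### Dependence of the elliptic integrals on the modulus -/

section Modulus

lemma hasDerivAt_integrand_modulus {k : ℝ} (hk : k ^ 2 < 1) (t : ℝ) :
    HasDerivAt (fun k : ℝ => 1 / √(1 - k ^ 2 * sin t ^ 2))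
      (k * sin t ^ 2 / √(1 - k ^ 2 * sin t ^ 2) ^ 3) k := by
  have hpos := one_sub_mul_sin_sq_pos hk t
  have hS := sqrt_pos.2 hpos
  have h := (((((hasDerivAt_id k).pow 2).mul_const (sin t ^ 2)).const_sub 1).sqrt
    hpos.ne').inv hS.ne'
  convert! h using 1
  · ext; simp
  · simp
    field_simp

lemma hasDerivAt_ellipticF_modulus {k : ℝ} (hk : k ^ 2 < 1) (φ : ℝ) :
    HasDerivAt (fun k => ellipticF k φ)
      (∫ t in (0 : ℝ)..φ, k * sin t ^ 2 / √(1 - k ^ 2 * sin t ^ 2) ^ 3) k := by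
  have hk1 : |k| < 1 := by rwa [sq_lt_one_iff_abs_lt_one] at hk
  -- A bound strictly between `|k|` and 1, so that the derivative of the integrand is dominated
  -- uniformly in a neighbourhood of `k`.
  set m := (1 + |k|) / 2
  have hm1 : m < 1 := by simp only [m]; linarith
  have hm0 : 0 < m := by simp only [m]; positivity
  have hkm : |k| < m := by simp only [m]; linarith
  have hs : {x : ℝ | |x| < m} ∈ nhds k := (isOpen_lt continuous_abs continuous_const).mem_nhds hkm
  have hsq {x : ℝ} (hx : |x| < m) : x ^ 2 < 1 := by
    rw [sq_lt_one_iff_abs_lt_one]; linarith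
  have hm2 : 0 < 1 - m ^ 2 := by nlinarith
  refine (intervalIntegral.hasDerivAt_integral_of_dominated_loc_of_deriv_le (𝕜 := ℝ) (E := ℝ)
    (μ := MeasureTheory.volume) (a := 0) (b := φ) (s := {x | |x| < m})
    (F := fun k t => 1 / √(1 - k ^ 2 * sin t ^ 2))
    (F' := fun k t => k * sin t ^ 2 / √(1 - k ^ 2 * sin t ^ 2) ^ 3)
    (bound := fun _ => 1 / √(1 - m ^ 2) ^ 3) hs ?_ ?_ ?_ ?_ ?_ ?_).2
  · filter_upwards [hs] with x hx
    exact (continuous_one_div_sqrt (hsq hx)).aestronglyMeasurable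
  · exact (continuous_one_div_sqrt hk).intervalIntegrable _ _
  · exact Continuous.aestronglyMeasurable (Continuous.div (by fun_prop) (by fun_prop)
      fun t => pow_ne_zero 3 (sqrt_one_sub_mul_sin_sq_pos hk t).ne')
  · refine Filter.Eventually.of_forall fun t _ x hx => ?_
    have hx' : |x| < m := hx
    have hS := sqrt_one_sub_mul_sin_sq_pos (hsq hx') t
    have h1 : √(1 - m ^ 2) ≤ √(1 - x ^ 2 * sin t ^ 2) := by
      apply sqrt_le_sqrt
      have : x ^ 2 ≤ m ^ 2 := by rw [← sq_abs x]; exact pow_le_pow_left₀ (abs_nonneg x) hx'.le 2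
      nlinarith [sin_sq_le_one t, sq_nonneg x]
    have h2 : |x * sin t ^ 2| ≤ 1 := by
      rw [abs_mul, abs_of_nonneg (sq_nonneg (sin t))]
      exact mul_le_one₀ (hx'.le.trans hm1.le) (sq_nonneg _) (sin_sq_le_one t)
    rw [norm_eq_abs, abs_div, abs_of_pos (pow_pos hS 3)]
    exact div_le_div₀ zero_le_one h2 (pow_pos (sqrt_pos.2 hm2) 3)
      (pow_le_pow_left₀ (sqrt_nonneg _) h1 3)
  · exact intervalIntegrable_const
  · exact Filter.Eventually.of_forall fun t _ x hx => hasDerivAt_integrand_modulus (hsq hx) t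

lemma isOpen_sq_lt_one : IsOpen {p : ℝ × ℝ | p.1 ^ 2 < 1} :=
  isOpen_lt (by fun_prop) continuous_const

lemma continuousAt_modulus_integral {k φ : ℝ} (hk : k ^ 2 < 1) :
    ContinuousAt (fun p : ℝ × ℝ =>
      ∫ t in (0 : ℝ)..p.2, p.1 * sin t ^ 2 / √(1 - p.1 ^ 2 * sin t ^ 2) ^ 3) (k, φ) := by
  have h : ContinuousOn (fun p : ℝ × ℝ =>
      ∫ t in (0 : ℝ)..p.2, p.1 * sin t ^ 2 / √(1 - p.1 ^ 2 * sin t ^ 2) ^ 3)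
      {p : ℝ × ℝ | p.1 ^ 2 < 1} := by
    rw [continuousOn_iff_continuous_domRestrict]
    refine intervalIntegral.continuous_parametric_intervalIntegral_of_continuous
      (f := fun (p : {p : ℝ × ℝ | p.1 ^ 2 < 1}) t =>
        p.1.1 * sin t ^ 2 / √(1 - p.1.1 ^ 2 * sin t ^ 2) ^ 3) ?_ (by fun_prop)
    refine Continuous.div (by fun_prop) (by fun_prop) fun p => ?_
    exact pow_ne_zero 3 (sqrt_one_sub_mul_sin_sq_pos p.1.2 _).ne'
  exact h.continuousAt (isOpen_sq_lt_one.mem_nhds hk)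

/-- Continuous partial derivatives give joint differentiability, needed because modulus and
amplitude both vary with the energy. -/
lemma differentiableAt_ellipticF {k φ : ℝ} (hk : k ^ 2 < 1) :
    DifferentiableAt ℝ (fun p : ℝ × ℝ => ellipticF p.1 p.2) (k, φ) := by
  have hev : ∀ᶠ p : ℝ × ℝ in nhds (k, φ), p.1 ^ 2 < 1 := isOpen_sq_lt_one.mem_nhds hk
  have h := hasStrictFDerivAt_uncurry_coprod (𝕜 := ℝ) (u := (k, φ)) (f := fun k φ => ellipticF k φ)
    (f₁ := fun k φ => ContinuousLinearMap.toSpanSingleton ℝ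
      (∫ t in (0 : ℝ)..φ, k * sin t ^ 2 / √(1 - k ^ 2 * sin t ^ 2) ^ 3))
    (f₂ := fun k φ => ContinuousLinearMap.toSpanSingleton ℝ (1 / √(1 - k ^ 2 * sin φ ^ 2)))
    (hev.mono fun p hp => (hasDerivAt_ellipticF_modulus hp p.2).hasFDerivAt)
    (hev.mono fun p hp => (hasDerivAt_ellipticF hp p.2).hasFDerivAt) ?_ ?_
  · exact h.hasFDerivAt.differentiableAt
  · exact (ContinuousLinearMap.toSpanSingletonCLE (𝕜 := ℝ)).continuous.continuousAt.comp
      (continuousAt_modulus_integral hk)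
  · refine (ContinuousLinearMap.toSpanSingletonCLE (𝕜 := ℝ)).continuous.continuousAt.comp
      (x := (k, φ)) (f := fun p : ℝ × ℝ => 1 / √(1 - p.1 ^ 2 * sin p.2 ^ 2)) ?_
    exact ContinuousAt.div (by fun_prop) (by fun_prop) (sqrt_one_sub_mul_sin_sq_pos hk φ).ne'

lemma DifferentiableAt.ellipticF {f g : ℝ → ℝ} {x : ℝ} (hf : DifferentiableAt ℝ f x)
    (hg : DifferentiableAt ℝ g x) (h : f x ^ 2 < 1) :
    DifferentiableAt ℝ (fun x => ellipticF (f x) (g x)) x :=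
  (differentiableAt_ellipticF h).comp (f := fun x => (f x, g x)) x (hf.prodMk hg)

lemma ContinuousAt.ellipticF {f g : ℝ → ℝ} {x : ℝ} (hf : ContinuousAt f x)
    (hg : ContinuousAt g x) (h : f x ^ 2 < 1) :
    ContinuousAt (fun x => ellipticF (f x) (g x)) x :=
  (differentiableAt_ellipticF h).continuousAt.comp (f := fun x => (f x, g x)) (hf.prodMk hg)

end Modulus

open MeasureTheory in
/-- The derivative of `∫ √(2 (e - V))` with respect to `e`, in integrated form. -/
lemma integral_sqrt_sub_eq_integral {V : ℝ → ℝ} (hV : Continuous V) {L q e₀ e₁ : ℝ} (hLq : L ≤ q)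
    (he : e₀ ≤ e₁)
    (hi : ∀ e ∈ Icc e₀ e₁, IntervalIntegrable (fun x => (√(2 * (e - V x)))⁻¹) volume L q)
    (hT : ContinuousOn (fun e => ∫ x in L..q, (√(2 * (e - V x)))⁻¹) (Icc e₀ e₁)) :
    (∫ x in L..q, √(2 * (e₁ - V x))) - ∫ x in L..q, √(2 * (e₀ - V x)) =
      ∫ e in e₀..e₁, ∫ x in L..q, (√(2 * (e - V x)))⁻¹ := by
  set f : ℝ → ℝ → ℝ := fun e x => (√(2 * (e - V x)))⁻¹ with hf
  have hmeas : Measurable (Function.uncurry f) := by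
    have : Measurable V := hV.measurable
    simp only [hf]
    fun_prop
  have hint : Integrable (Function.uncurry f)
      ((volume.restrict (Ioc e₀ e₁)).prod (volume.restrict (Ioc L q))) := by
    rw [integrable_prod_iff hmeas.aestronglyMeasurable]
    constructor
    · filter_upwards [ae_restrict_mem measurableSet_Ioc] with e he'
      have := hi e (Ioc_subset_Icc_self he')
      rwa [intervalIntegrable_iff_integrableOn_Ioc_of_le hLq] at this
    · have h1 : IntegrableOn (fun e => ∫ x in L..q, (√(2 * (e - V x)))⁻¹) (Ioc e₀ e₁) :=
        (hT.integrableOn_Icc).mono_set Ioc_subset_Icc_self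
      refine h1.congr (Filter.Eventually.of_forall fun e => ?_)
      simp only [intervalIntegral.integral_of_le hLq, Function.uncurry, hf]
      refine integral_congr_ae (Filter.Eventually.of_forall fun x => ?_)
      exact (norm_of_nonneg (inv_nonneg.2 (sqrt_nonneg _))).symm
  -- The integrand is nonnegative, so its integrability on the product follows from that of the
  -- inner integrals, which `hT` controls.
  have hswap := integral_integral_swap hint
  have hcont (e : ℝ) : Continuous fun x => √(2 * (e - V x)) := by fun_prop
  rw [← intervalIntegral.integral_sub ((hcont e₁).intervalIntegrable _ _)
    ((hcont e₀).intervalIntegrable _ _)]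
  simp only [intervalIntegral.integral_of_le hLq, intervalIntegral.integral_of_le he]
  simp only [hf] at hswap
  rw [hswap]
  refine integral_congr_ae ?_
  filter_upwards [hint.swap.prod_right_ae] with x hx
  have hxi : IntervalIntegrable (fun e => (√(2 * (e - V x)))⁻¹) volume e₀ e₁ := by
    rw [intervalIntegrable_iff_integrableOn_Ioc_of_le he]; exact hx
  rw [← intervalIntegral.integral_of_le he]
  symm
  -- For fixed `x` the square root is a primitive in `e` except at `e = V x`; for `e < V x` both it
  -- and the inverse are zero by convention.
  refine integral_eq_of_hasDerivAt_off_countable (fun e => √(2 * (e - V x)))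
    (fun e => (√(2 * (e - V x)))⁻¹) (countable_singleton (V x)) (by fun_prop) ?_ hxi
  rintro e ⟨-, he'⟩
  rcases lt_or_gt_of_ne he' with h | h
  · have hz : ∀ᶠ y in nhds e, √(2 * (y - V x)) = 0 := by
      filter_upwards [isOpen_Iio.mem_nhds h] with y hy
      have : y < V x := hy
      exact sqrt_eq_zero_of_nonpos (by linarith)
    rw [hz.self_of_nhds, inv_zero]
    exact (hasDerivAt_const e (0 : ℝ)).congr_of_eventuallyEq hz
  · have hpos : 0 < 2 * (e - V x) := by
      have : V x < e := h
      linarith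
    convert! (((hasDerivAt_id e).sub_const (V x)).const_mul 2).sqrt hpos.ne' using 1
    simp only [id]
    field_simp

/-! ### The derivative of the action integrals with respect to the energy -/

section Energy

open MeasureTheory

variable {α β : ℝ}

lemma momentum_eq_zero {e x : ℝ} (h : e ≤ potential α β x) : momentum α β x e = 0 :=
  sqrt_eq_zero_of_nonpos (by linarith)

lemma continuous_momentum (e : ℝ) : Continuous fun x => momentum α β x e := by
  have := continuous_potential (α := α) (β := β)
  unfold momentum
  fun_prop

lemma RootsSpec.le_potential_left (hβ : β < 0) {e a b c d x : ℝ} (h : RootsSpec α β e a b c d)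
    (hx : x ∈ Icc (maxLeft α β) c) : e ≤ potential α β x := by
  rw [← h.vc]
  exact (strictAntiOn_potential_left hβ).antitoneOn ⟨hx.1, hx.2.trans h.hc0.le⟩
    ⟨h.hc.le, h.hc0.le⟩ hx.2

lemma RootsSpec.le_potential_right (hβ : β < 0) {e a b c d x : ℝ} (h : RootsSpec α β e a b c d)
    (hx : x ∈ Icc b (maxRight α β)) : e ≤ potential α β x := by
  rw [← h.vb]
  exact (strictMonoOn_potential_right hβ).monotoneOn ⟨h.hb0.le, h.hb.le⟩
    ⟨h.hb0.le.trans hx.1, hx.2⟩ hx.1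

lemma RootsSpec.mono (hβ : β < 0) {e e' a b c d a' b' c' d' : ℝ} (h : RootsSpec α β e a b c d)
    (h' : RootsSpec α β e' a' b' c' d') (hee : e ≤ e') : c' ≤ c ∧ b ≤ b' := by
  constructor
  · rw [← (strictAntiOn_potential_left hβ).le_iff_ge ⟨h.hc.le, h.hc0.le⟩ ⟨h'.hc.le, h'.hc0.le⟩,
      h.vc, h'.vc]
    exact hee
  · rw [← (strictMonoOn_potential_right hβ).le_iff_le ⟨h.hb0.le, h.hb.le⟩ ⟨h'.hb0.le, h'.hb.le⟩,
      h.vb, h'.vb]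
    exact hee

/-- Beyond a turning point the momentum is 0, and so is its inverse. An energy-dependent endpoint
can thus be replaced by a fixed one. -/
lemma integral_extend {g : ℝ → ℝ} {L c q : ℝ} (hLc : L ≤ c) (h0 : ∀ x ∈ Icc L c, g x = 0)
    (hi : IntervalIntegrable g volume c q) :
    IntervalIntegrable g volume L q ∧ ∫ x in L..q, g x = ∫ x in c..q, g x := by
  have h1 : EqOn (fun _ => (0 : ℝ)) g (uIoc L c) := fun x hx => by
    rw [uIoc_of_le hLc] at hx; exact (h0 x ⟨hx.1.le, hx.2⟩).symm
  have h2 : IntervalIntegrable g volume L c := intervalIntegrable_const.congr h1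
  refine ⟨h2.trans hi, ?_⟩
  rw [← intervalIntegral.integral_add_adjacent_intervals h2 hi,
    intervalIntegral.integral_congr (g := fun _ => (0 : ℝ)), intervalIntegral.integral_zero,
    zero_add]
  intro x hx
  rw [uIcc_of_le hLc] at hx
  exact h0 x hx

lemma integral_extend_right {g : ℝ → ℝ} {c b R : ℝ} (hbR : b ≤ R) (h0 : ∀ x ∈ Icc b R, g x = 0)
    (hi : IntervalIntegrable g volume c b) :
    IntervalIntegrable g volume c R ∧ ∫ x in c..R, g x = ∫ x in c..b, g x := by
  have h1 : EqOn (fun _ => (0 : ℝ)) g (uIoc b R) := fun x hx => by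
    rw [uIoc_of_le hbR] at hx; exact (h0 x ⟨hx.1.le, hx.2⟩).symm
  have h2 : IntervalIntegrable g volume b R := intervalIntegrable_const.congr h1
  refine ⟨hi.trans h2, ?_⟩
  rw [← intervalIntegral.integral_add_adjacent_intervals hi h2, add_eq_left,
    intervalIntegral.integral_congr (g := fun _ => (0 : ℝ)), intervalIntegral.integral_zero]
  intro x hx
  rw [uIcc_of_le hbR] at hx
  exact h0 x hx

/-- The integrated formula writes the left side as a constant plus `∫ T` from `l`, and the
fundamental theorem of calculus applies because `T` is continuous. -/
lemma hasDerivAt_integral_sqrt {V T : ℝ → ℝ} (hV : Continuous V) {L q l u E : ℝ} (hLq : L ≤ q)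
    (hE : E ∈ Ioo l u)
    (hi : ∀ e ∈ Icc l u, IntervalIntegrable (fun x => (√(2 * (e - V x)))⁻¹) volume L q)
    (hT : ∀ e ∈ Icc l u, ∫ x in L..q, (√(2 * (e - V x)))⁻¹ = T e)
    (hTc : ContinuousOn T (Icc l u)) :
    HasDerivAt (fun e => ∫ x in L..q, √(2 * (e - V x))) (T E) E := by
  have key : ∀ e ∈ Icc l u, (∫ x in L..q, √(2 * (e - V x))) =
      (∫ x in L..q, √(2 * (l - V x))) + ∫ e in l..e, T e := by
    intro e he
    have hsub : Icc l e ⊆ Icc l u := Icc_subset_Icc_right he.2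
    have h := integral_sqrt_sub_eq_integral hV hLq he.1 (fun x hx => hi x (hsub hx))
      ((hTc.congr hT).mono hsub)
    have h2 : ∫ e in l..e, ∫ x in L..q, (√(2 * (e - V x)))⁻¹ = ∫ e in l..e, T e :=
      intervalIntegral.integral_congr fun x hx => hT x (by
        rw [uIcc_of_le he.1] at hx; exact hsub hx)
    linarith
  have hnhds : Icc l u ∈ nhds E := Icc_mem_nhds hE.1 hE.2
  have hd : HasDerivAt (fun e => ∫ x in l..e, T x) (T E) E := by
    refine intervalIntegral.integral_hasDerivAt_right ?_ ?_ (hTc.continuousAt hnhds)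
    · refine (hTc.mono ?_).intervalIntegrable
      rw [uIcc_of_le hE.1.le]
      exact Icc_subset_Icc_right hE.2.le
    · exact ContinuousOn.stronglyMeasurableAtFilter isOpen_Ioo (hTc.mono Ioo_subset_Icc_self) E hE
  refine (hd.const_add (∫ x in L..q, √(2 * (l - V x)))).congr_of_eventuallyEq ?_
  filter_upwards [hnhds] with e he using key e he

variable {a b c d : ℝ → ℝ}

/-- `∫ dq / p` over the half orbit. -/
def halfPeriod (β a b c d : ℝ) : ℝ := timeScale β a b c d * ellipticK (modulus a b c d)

lemma continuousAt_modulus_of {E : ℝ} (ha : ContinuousAt a E) (hb : ContinuousAt b E)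
    (hc : ContinuousAt c E) (hd : ContinuousAt d E) (hcd : d E < c E) (hbc : c E < b E)
    (hab : b E < a E) : ContinuousAt (fun e => modulus (a e) (b e) (c e) (d e)) E := by
  unfold modulus
  refine (ContinuousAt.div (by fun_prop) (by fun_prop) ?_).sqrt
  exact (mul_pos (by linarith) (by linarith)).ne'

lemma differentiableAt_modulus_of {E : ℝ} (ha : DifferentiableAt ℝ a E)
    (hb : DifferentiableAt ℝ b E) (hc : DifferentiableAt ℝ c E) (hd : DifferentiableAt ℝ d E)
    (hcd : d E < c E) (hbc : c E < b E) (hab : b E < a E) :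
    DifferentiableAt ℝ (fun e => modulus (a e) (b e) (c e) (d e)) E := by
  unfold modulus
  have h1 : 0 < (a E - c E) * (b E - d E) := mul_pos (by linarith) (by linarith)
  have h2 : 0 < (b E - c E) * (a E - d E) := mul_pos (by linarith) (by linarith)
  have e1 : DifferentiableAt ℝ (fun e => (a e - c e) * (b e - d e)) E := by fun_prop
  have e2 : DifferentiableAt ℝ (fun e => (b e - c e) * (a e - d e)) E := by fun_prop
  exact (e2.div e1 h1.ne').sqrt (div_pos h2 h1).ne'

lemma continuousAt_timeScale_of (hβ : β < 0) {E : ℝ} (ha : ContinuousAt a E)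
    (hb : ContinuousAt b E) (hc : ContinuousAt c E) (hd : ContinuousAt d E) (hcd : d E < c E)
    (hbc : c E < b E) (hab : b E < a E) :
    ContinuousAt (fun e => timeScale β (a e) (b e) (c e) (d e)) E := by
  unfold timeScale
  have h0 : 0 < |β| := abs_pos.2 hβ.ne
  have h1 : 0 < (a E - c E) * (b E - d E) := mul_pos (by linarith) (by linarith)
  refine ContinuousAt.div (by fun_prop) (by fun_prop) ?_
  have := sqrt_pos.2 h1
  positivity

lemma continuousAt_ampOf_of {E q : ℝ} (hb : ContinuousAt b E) (hc : ContinuousAt c E)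
    (hd : ContinuousAt d E) (hbc : c E < b E) (hq : d E < q) :
    ContinuousAt (fun e => ampOf (b e) (c e) (d e) q) E := by
  unfold ampOf
  refine continuous_arcsin.continuousAt.comp (ContinuousAt.div (by fun_prop) (by fun_prop) ?_).sqrt
  exact (mul_pos (by linarith) (by linarith)).ne'

end Energy

/-! ### Action, frequency and angle as functions of the energy. -/

section Energy

open MeasureTheory

variable {α β : ℝ} {a b c d : ℝ → ℝ}

lemma RootsSpec.order (hβ : β < 0) {e a b c d : ℝ} (h : RootsSpec α β e a b c d) :
    d < c ∧ c < b ∧ b < a := by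
  have := h.isDescendingRoots hβ
  exact ⟨this.2.2.1, this.2.1, this.1⟩

lemma RootsSpec.integral_inv_momentum (hβ : β < 0) {e a b c d q : ℝ}
    (h : RootsSpec α β e a b c d) (hq : q ∈ Icc c b) :
    IntervalIntegrable (fun x => (momentum α β x e)⁻¹) volume c q ∧
      ∫ x in c..q, (momentum α β x e)⁻¹ =
        timeScale β a b c d * ellipticF (modulus a b c d) (ampOf b c d q) := by
  obtain ⟨hcd, hbc, hab⟩ := h.order hβ
  have := QuarticEscape.integral_inv_momentum hβ (h.isDescendingRoots hβ) (ampOf_mem b c d q)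
  rwa [ampPos_ampOf hcd hbc hq] at this

lemma ampOf_right {b c d : ℝ} (hcd : d < c) (hbc : c < b) : ampOf b c d b = π / 2 := by
  have := ampOf_ampPos hcd hbc (t := π / 2) ⟨by positivity, le_rfl⟩
  rwa [ampPos_pi_div_two hcd hbc] at this

/-- A choice of the four roots at every energy below the barrier. -/
def RootFamily (α β : ℝ) (a b c d : ℝ → ℝ) : Prop :=
  ∀ ξ ∈ Ioo 0 (barrier α β), RootsSpec α β ξ (a ξ) (b ξ) (c ξ) (d ξ)

lemma RootFamily.continuousAt (hβ : β < 0) (hR : RootFamily α β a b c d) {E : ℝ}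
    (hE : E ∈ Ioo 0 (barrier α β)) :
    ContinuousAt a E ∧ ContinuousAt b E ∧ ContinuousAt c E ∧ ContinuousAt d E := by
  obtain ⟨h1, h2, h3, h4⟩ := differentiableAt_roots hβ hR hE
  exact ⟨h1.continuousAt, h2.continuousAt, h3.continuousAt, h4.continuousAt⟩

lemma RootFamily.continuousAt_modulus (hβ : β < 0) (hR : RootFamily α β a b c d) {E : ℝ}
    (hE : E ∈ Ioo 0 (barrier α β)) :
    ContinuousAt (fun e => modulus (a e) (b e) (c e) (d e)) E := by
  obtain ⟨h1, h2, h3, h4⟩ := hR.continuousAt hβ hE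
  obtain ⟨hcd, hbc, hab⟩ := (hR E hE).order hβ
  exact continuousAt_modulus_of h1 h2 h3 h4 hcd hbc hab

lemma RootFamily.modulus_sq_lt_one (hβ : β < 0) (hR : RootFamily α β a b c d) {E : ℝ}
    (hE : E ∈ Ioo 0 (barrier α β)) : modulus (a E) (b E) (c E) (d E) ^ 2 < 1 := by
  obtain ⟨hcd, hbc, hab⟩ := (hR E hE).order hβ
  exact QuarticEscape.modulus_sq_lt_one hcd hbc hab

lemma RootFamily.continuousAt_timeScale (hβ : β < 0) (hR : RootFamily α β a b c d) {E : ℝ}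
    (hE : E ∈ Ioo 0 (barrier α β)) :
    ContinuousAt (fun e => timeScale β (a e) (b e) (c e) (d e)) E := by
  obtain ⟨h1, h2, h3, h4⟩ := hR.continuousAt hβ hE
  obtain ⟨hcd, hbc, hab⟩ := (hR E hE).order hβ
  exact continuousAt_timeScale_of hβ h1 h2 h3 h4 hcd hbc hab

lemma RootFamily.continuousAt_halfPeriod (hβ : β < 0) (hR : RootFamily α β a b c d) {E : ℝ}
    (hE : E ∈ Ioo 0 (barrier α β)) :
    ContinuousAt (fun e => halfPeriod β (a e) (b e) (c e) (d e)) E :=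
  (hR.continuousAt_timeScale hβ hE).mul
    (ContinuousAt.ellipticF (hR.continuousAt_modulus hβ hE) continuousAt_const
      (hR.modulus_sq_lt_one hβ hE))

lemma RootFamily.halfPeriod_pos (hβ : β < 0) (hR : RootFamily α β a b c d) {E : ℝ}
    (hE : E ∈ Ioo 0 (barrier α β)) : 0 < halfPeriod β (a E) (b E) (c E) (d E) := by
  obtain ⟨hcd, hbc, hab⟩ := (hR E hE).order hβ
  exact mul_pos (timeScale_pos hβ hcd hbc hab) (ellipticK_pos (hR.modulus_sq_lt_one hβ hE))

/-- The derivative of the integral of the momentum up to a fixed point. -/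
lemma RootFamily.hasDerivAt_phaseUp (hβ : β < 0) (hR : RootFamily α β a b c d) {E q : ℝ}
    (hE : E ∈ Ioo 0 (barrier α β)) (hq : q ∈ Ioo (c E) (b E)) :
    HasDerivAt (fun e => phaseUp α β q e) (timeScale β (a E) (b E) (c E) (d E) *
      ellipticF (modulus (a E) (b E) (c E) (d E)) (ampOf (b E) (c E) (d E) q)) E := by
  obtain ⟨h1, h2, h3, h4⟩ := hR.continuousAt hβ hE
  have hev : ∀ᶠ e in nhds E, e ∈ Ioo 0 (barrier α β) ∧ q ∈ Ioo (c e) (b e) :=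
    (show ∀ᶠ e in nhds E, e ∈ Ioo 0 (barrier α β) from isOpen_Ioo.mem_nhds hE).and
      ((h3.eventually_lt continuousAt_const hq.1).and (continuousAt_const.eventually_lt h2 hq.2))
  obtain ⟨ε, hε, hball⟩ := Metric.nhds_basis_closedBall.eventually_iff.1 hev
  rw [Real.closedBall_eq_Icc] at hball
  set l := E - ε
  set u := E + ε
  have hEI : E ∈ Ioo l u := ⟨by simp [l, hε], by simp [u, hε]⟩
  have hu : u ∈ Icc l u := ⟨hEI.1.le.trans hEI.2.le, le_rfl⟩
  have huJ := (hball hu).1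
  have hcu := (hball hu).2.1.le
  -- The left turning point moves left as the energy grows, so `c u`, at the top energy `u`, serves
  -- as the common left endpoint.
  have hzero : ∀ e ∈ Icc l u, ∀ x ∈ Icc (c u) (c e), momentum α β x e = 0 := by
    intro e he x hx
    exact momentum_eq_zero ((hR e (hball he).1).le_potential_left hβ
      ⟨(hR u huJ).hc.le.trans hx.1, hx.2⟩)
  have hcle : ∀ e ∈ Icc l u, c u ≤ c e := fun e he =>
    ((hR e (hball he).1).mono hβ (hR u huJ) he.2).1
  have hint : ∀ e ∈ Icc l u,
      IntervalIntegrable (fun x => (momentum α β x e)⁻¹) volume (c u) q ∧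
      ∫ x in (c u)..q, (momentum α β x e)⁻¹ = timeScale β (a e) (b e) (c e) (d e) *
      ellipticF (modulus (a e) (b e) (c e) (d e)) (ampOf (b e) (c e) (d e) q) := by
    intro e he
    obtain ⟨i1, i2⟩ := (hR e (hball he).1).integral_inv_momentum hβ
      ⟨(hball he).2.1.le, (hball he).2.2.le⟩
    have := integral_extend (hcle e he)
      (fun x hx => by rw [hzero e he x hx, inv_zero]) i1
    rwa [i2] at this
  have hmain := hasDerivAt_integral_sqrt (continuous_potential (α := α) (β := β)) hcu hEI
    (fun e he => (hint e he).1) (fun e he => (hint e he).2) (fun e he => by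
      have heJ := (hball he).1
      obtain ⟨h1, h2, h3, h4⟩ := hR.continuousAt hβ heJ
      obtain ⟨hcd, hbc, hab⟩ := (hR e heJ).order hβ
      exact ((hR.continuousAt_timeScale hβ heJ).mul (ContinuousAt.ellipticF
        (hR.continuousAt_modulus hβ heJ) (continuousAt_ampOf_of h2 h3 h4 hbc
          (hcd.trans (hball he).2.1)) (hR.modulus_sq_lt_one hβ heJ))).continuousWithinAt)
  refine hmain.congr_of_eventuallyEq ?_
  filter_upwards [Icc_mem_nhds hEI.1 hEI.2] with e he
  have := (integral_extend (hcle e he) (hzero e he)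
    ((continuous_momentum e).intervalIntegrable (c e) q)).2
  rw [phaseUp, (hR e (hball he).1).qLeft_eq hβ, ← this]
  rfl

/-- The derivative of the integral of the momentum over the whole upper branch. -/
lemma RootFamily.hasDerivAt_halfAction (hβ : β < 0) (hR : RootFamily α β a b c d) {E : ℝ}
    (hE : E ∈ Ioo 0 (barrier α β)) :
    HasDerivAt (fun e => ∫ x in (qLeft α β e)..(qRight α β e), momentum α β x e)
      (halfPeriod β (a E) (b E) (c E) (d E)) E := by
  have hev : ∀ᶠ e in nhds E, e ∈ Ioo 0 (barrier α β) := isOpen_Ioo.mem_nhds hE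
  obtain ⟨ε, hε, hball⟩ := Metric.nhds_basis_closedBall.eventually_iff.1 hev
  rw [Real.closedBall_eq_Icc] at hball
  set l := E - ε
  set u := E + ε
  have hEI : E ∈ Ioo l u := ⟨by simp [l, hε], by simp [u, hε]⟩
  have hu : u ∈ Icc l u := ⟨hEI.1.le.trans hEI.2.le, le_rfl⟩
  have huJ := hball hu
  have hz1 : ∀ e ∈ Icc l u, ∀ x ∈ Icc (c u) (c e), momentum α β x e = 0 := fun e he x hx =>
    momentum_eq_zero ((hR e (hball he)).le_potential_left hβ ⟨(hR u huJ).hc.le.trans hx.1, hx.2⟩)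
  have hz2 : ∀ e ∈ Icc l u, ∀ x ∈ Icc (b e) (b u), momentum α β x e = 0 := fun e he x hx =>
    momentum_eq_zero ((hR e (hball he)).le_potential_right hβ ⟨hx.1, hx.2.trans (hR u huJ).hb.le⟩)
  have hle : ∀ e ∈ Icc l u, c u ≤ c e ∧ b e ≤ b u := fun e he =>
    (hR e (hball he)).mono hβ (hR u huJ) he.2
  have hint : ∀ e ∈ Icc l u,
      IntervalIntegrable (fun x => (momentum α β x e)⁻¹) volume (c u) (b u) ∧
      ∫ x in (c u)..(b u), (momentum α β x e)⁻¹ = halfPeriod β (a e) (b e) (c e) (d e) := by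
    intro e he
    obtain ⟨hcd, hbc, hab⟩ := (hR e (hball he)).order hβ
    obtain ⟨i1, i2⟩ := (hR e (hball he)).integral_inv_momentum hβ ⟨hbc.le, le_rfl⟩
    obtain ⟨j1, j2⟩ := integral_extend_right (hle e he).2
      (fun x hx => by rw [hz2 e he x hx, inv_zero]) i1
    have := integral_extend (hle e he).1 (fun x hx => by rw [hz1 e he x hx, inv_zero]) j1
    rwa [j2, i2, ampOf_right hcd hbc] at this
  obtain ⟨-, hbcu, -⟩ := (hR u huJ).order hβ
  have hmain := hasDerivAt_integral_sqrt (continuous_potential (α := α) (β := β)) hbcu.le hEI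
    (fun e he => (hint e he).1) (fun e he => (hint e he).2)
    (fun e he => (hR.continuousAt_halfPeriod hβ (hball he)).continuousWithinAt)
  refine hmain.congr_of_eventuallyEq ?_
  filter_upwards [Icc_mem_nhds hEI.1 hEI.2] with e he
  obtain ⟨j1, j2⟩ := integral_extend_right (hle e he).2 (hz2 e he)
    ((continuous_momentum e).intervalIntegrable (c e) (b e))
  have := (integral_extend (hle e he).1 (hz1 e he) j1).2
  rw [(hR e (hball he)).qLeft_eq hβ, (hR e (hball he)).qRight_eq hβ, ← j2, ← this]
  rfl

lemma actionVar_eq (α β E : ℝ) :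
    actionVar α β E = 1 / π * ∫ x in (qLeft α β E)..(qRight α β E), momentum α β x E := by
  rw [actionVar, phaseDown, intervalIntegral.integral_neg,
    intervalIntegral.integral_symm (qLeft α β E)]
  have := pi_ne_zero
  field_simp
  ring

lemma phaseDown_eq (α β q E : ℝ) : phaseDown α β q E =
    2 * (∫ x in (qLeft α β E)..(qRight α β E), momentum α β x E) - phaseUp α β q E := by
  have h := intervalIntegral.integral_add_adjacent_intervals
    ((continuous_momentum (α := α) (β := β) E).intervalIntegrable (μ := volume) (qLeft α β E) q)
    ((continuous_momentum (α := α) (β := β) E).intervalIntegrable (μ := volume) q (qRight α β E))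
  rw [phaseDown, phaseUp, intervalIntegral.integral_neg, intervalIntegral.integral_symm q, neg_neg]
  linarith

lemma RootFamily.hasDerivAt_actionVar (hβ : β < 0) (hR : RootFamily α β a b c d) {E : ℝ}
    (hE : E ∈ Ioo 0 (barrier α β)) :
    HasDerivAt (actionVar α β) (1 / π * halfPeriod β (a E) (b E) (c E) (d E)) E :=
  ((hR.hasDerivAt_halfAction hβ hE).const_mul (1 / π)).congr_of_eventuallyEq
    (Filter.Eventually.of_forall fun e => actionVar_eq α β e)

lemma RootFamily.strictMonoOn_actionVar (hβ : β < 0) (hR : RootFamily α β a b c d) :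
    StrictMonoOn (actionVar α β) (Ioo 0 (barrier α β)) := by
  refine strictMonoOn_of_deriv_pos (convex_Ioo _ _)
    (fun E hE => (hR.hasDerivAt_actionVar hβ hE).continuousAt.continuousWithinAt) fun E hE => ?_
  rw [interior_Ioo] at hE
  rw [(hR.hasDerivAt_actionVar hβ hE).deriv]
  have := hR.halfPeriod_pos hβ hE
  positivity

/-- Continuity of the half period upgrades the derivative to a strict one, as the inverse function
theorem requires. -/
lemma RootFamily.hasStrictDerivAt_actionVar (hβ : β < 0) (hR : RootFamily α β a b c d) {E : ℝ}
    (hE : E ∈ Ioo 0 (barrier α β)) :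
    HasStrictDerivAt (actionVar α β) (1 / π * halfPeriod β (a E) (b E) (c E) (d E)) E := by
  refine hasStrictDerivAt_of_hasDerivAt_of_continuousAt
    (f' := fun E => 1 / π * halfPeriod β (a E) (b E) (c E) (d E)) ?_
    (continuousAt_const.mul (hR.continuousAt_halfPeriod hβ hE))
  filter_upwards [isOpen_Ioo.mem_nhds hE] with e he using hR.hasDerivAt_actionVar hβ he

lemma RootFamily.energyOfAction_actionVar (hβ : β < 0) (hR : RootFamily α β a b c d) {E : ℝ}
    (hE : E ∈ Ioo 0 (barrier α β)) : energyOfAction α β (actionVar α β E) = E :=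
  (hR.strictMonoOn_actionVar hβ).injOn.leftInvOn_invFunOn hE

lemma RootFamily.hasDerivAt_energyOfAction (hβ : β < 0) (hR : RootFamily α β a b c d) {E : ℝ}
    (hE : E ∈ Ioo 0 (barrier α β)) :
    HasDerivAt (energyOfAction α β) (π / halfPeriod β (a E) (b E) (c E) (d E))
      (actionVar α β E) := by
  have hpos := hR.halfPeriod_pos hβ hE
  have hs := hR.hasStrictDerivAt_actionVar hβ hE
  have hne : 1 / π * halfPeriod β (a E) (b E) (c E) (d E) ≠ 0 := by positivity
  -- The nonzero strict derivative makes the action an open map at `E`, so every nearby value of the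
  -- action is attained below the barrier.
  have himg : actionVar α β '' Ioo 0 (barrier α β) ∈ nhds (actionVar α β E) := by
    rw [← hs.map_nhds_eq hne]
    exact Filter.image_mem_map (isOpen_Ioo.mem_nhds hE)
  have h := hasDerivAt_root (r := energyOfAction α β) (x := actionVar α β E) isOpen_Ioo
    (hR.strictMonoOn_actionVar hβ).injOn (by
      filter_upwards [himg] with y hy
      exact ⟨Function.invFunOn_mem hy, Function.invFunOn_eq hy⟩)
    (by rw [hR.energyOfAction_actionVar hβ hE]; exact hs) hne
  convert! h using 1
  field_simp

/-- Chain rule `∂/∂I = (dE/dI) ∂/∂E`: the time scale cancels against the one in the half period,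
leaving `π F/K`. -/
lemma RootFamily.hasDerivAt_phaseUp_action (hβ : β < 0) (hR : RootFamily α β a b c d) {E q : ℝ}
    (hE : E ∈ Ioo 0 (barrier α β)) (hq : q ∈ Ioo (c E) (b E)) :
    HasDerivAt (fun I => phaseUp α β q (energyOfAction α β I))
      (π * ellipticF (modulus (a E) (b E) (c E) (d E)) (ampOf (b E) (c E) (d E) q) /
        ellipticK (modulus (a E) (b E) (c E) (d E))) (actionVar α β E) := by
  obtain ⟨hcd, hbc, hab⟩ := (hR E hE).order hβ
  have h1 := hR.hasDerivAt_phaseUp hβ hE hq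
  rw [← hR.energyOfAction_actionVar hβ hE] at h1
  have h2 := h1.comp (actionVar α β E) (hR.hasDerivAt_energyOfAction hβ hE)
  rw [hR.energyOfAction_actionVar hβ hE] at h2
  convert! h2 using 1
  have hκ := (timeScale_pos hβ hcd hbc hab).ne'
  have hK := (ellipticK_pos (hR.modulus_sq_lt_one hβ hE)).ne'
  rw [halfPeriod]
  field_simp

lemma RootFamily.hasDerivAt_phaseDown_action (hβ : β < 0) (hR : RootFamily α β a b c d) {E q : ℝ}
    (hE : E ∈ Ioo 0 (barrier α β)) (hq : q ∈ Ioo (c E) (b E)) :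
    HasDerivAt (fun I => phaseDown α β q (energyOfAction α β I))
      (2 * π - π * ellipticF (modulus (a E) (b E) (c E) (d E)) (ampOf (b E) (c E) (d E) q) /
        ellipticK (modulus (a E) (b E) (c E) (d E))) (actionVar α β E) := by
  have h1 := hR.hasDerivAt_halfAction hβ hE
  rw [← hR.energyOfAction_actionVar hβ hE] at h1
  have h2 := h1.comp (actionVar α β E) (hR.hasDerivAt_energyOfAction hβ hE)
  rw [hR.energyOfAction_actionVar hβ hE] at h2
  have h3 := (h2.const_mul 2).sub (hR.hasDerivAt_phaseUp_action hβ hE hq)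
  convert! h3 using 1
  · ext I
    exact phaseDown_eq α β q _
  · have := (hR.halfPeriod_pos hβ hE).ne'
    field_simp

lemma RootFamily.angleUp_eq (hβ : β < 0) (hR : RootFamily α β a b c d) {E q : ℝ}
    (hE : E ∈ Ioo 0 (barrier α β)) (hq : q ∈ Ioo (c E) (b E)) : angleUp α β E q =
    π * ellipticF (modulus (a E) (b E) (c E) (d E)) (ampOf (b E) (c E) (d E) q) /
        ellipticK (modulus (a E) (b E) (c E) (d E)) :=
  (hR.hasDerivAt_phaseUp_action hβ hE hq).deriv

lemma RootFamily.angleDown_eq (hβ : β < 0) (hR : RootFamily α β a b c d) {E q : ℝ}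
    (hE : E ∈ Ioo 0 (barrier α β)) (hq : q ∈ Ioo (c E) (b E)) : angleDown α β E q =
    2 * π - π * ellipticF (modulus (a E) (b E) (c E) (d E)) (ampOf (b E) (c E) (d E) q) /
        ellipticK (modulus (a E) (b E) (c E) (d E)) :=
  (hR.hasDerivAt_phaseDown_action hβ hE hq).deriv

/-- The closed form of the action. -/
lemma RootsSpec.actionVar_eq_closedAction (hβ : β < 0) {ξ a b c d : ℝ}
    (h : RootsSpec α β ξ a b c d) : actionVar α β ξ = closedAction β a b c d := by
  obtain ⟨hcd, hbc, hab⟩ := h.order hβ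
  have hk := QuarticEscape.modulus_sq_lt_one hcd hbc hab
  have hI := closedAction_eq_integral (β := β) hcd hbc hab
  have hD (t : ℝ) := one_sub_gammaSq_mul_pos hcd hbc t
  have hcont : Continuous fun t => sin t ^ 2 * cos t ^ 2 *
      √(1 - modulus a b c d ^ 2 * sin t ^ 2) / (1 - gammaSq b c d * sin t ^ 2) ^ 4 :=
    Continuous.div (by fun_prop) (by fun_prop) fun t => pow_ne_zero 4 (hD t).ne'
  have hsub := (integral_comp_ampPos hcd hbc (φ := π / 2) ⟨by positivity, le_rfl⟩
    (g := fun x => momentum α β x ξ)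
    (h := fun t => √(2 * |β|) / √((a - c) * (b - d)) *
      ((c - d) ^ 2 * (b - c) * (a - c) * gammaSq b c d) *
      (sin t ^ 2 * cos t ^ 2 * √(1 - modulus a b c d ^ 2 * sin t ^ 2) /
        (1 - gammaSq b c d * sin t ^ 2) ^ 4)) ((continuous_const.mul hcont).intervalIntegrable _ _) ?_).2
  · rw [ampPos_pi_div_two hcd hbc, intervalIntegral.integral_const_mul, ← hI] at hsub
    rw [actionVar_eq, h.qLeft_eq hβ, h.qRight_eq hβ, hsub]
    field_simp
  · intro t ht
    rw [momentum_ampPos hβ (h.isDescendingRoots hβ) ⟨ht.1.le, ht.2.le⟩]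
    have e : √(2 * |β|) = 2 * √(|β| / 2) := by
      rw [show 2 * |β| = 2 ^ 2 * (|β| / 2) by ring, sqrt_mul (by norm_num), sqrt_sq (by norm_num)]
    rw [e]
    have := (hD t).ne'
    have hW : √((a - c) * (b - d)) ≠ 0 :=
      (sqrt_pos.2 (mul_pos (by linarith) (by linarith))).ne'
    field_simp

end Energy

/-! ### The displacement as a function of the angle, and its first harmonic. -/

section Angle

open MeasureTheory

variable {α β : ℝ} {a b c d k : ℝ}

/-- The point of angle `θ` on an orbit with turning points `c` and `b`. -/
def anglePos (a b c d θ : ℝ) : ℝ :=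
  ampPos b c d (jacobiAm (ellipticK (modulus a b c d) * θ / π) (modulus a b c d))

lemma continuous_anglePos (hcd : d < c) (hbc : c < b) (hab : b < a) :
    Continuous (anglePos a b c d) :=
  (continuous_ampPos hcd hbc).comp
    ((continuous_jacobiAm (modulus_sq_lt_one hcd hbc hab)).comp (by fun_prop))

lemma ampPos_add_pi (b c d t : ℝ) : ampPos b c d (t + π) = ampPos b c d t := by
  simp [ampPos, sin_add_pi]

lemma ampPos_pi_sub (b c d t : ℝ) : ampPos b c d (π - t) = ampPos b c d t := by
  simp [ampPos, sin_pi_sub]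

lemma anglePos_periodic (hcd : d < c) (hbc : c < b) (hab : b < a) :
    Function.Periodic (anglePos a b c d) (2 * π) := by
  intro θ
  have hπ := pi_ne_zero
  rw [anglePos, show ellipticK (modulus a b c d) * (θ + 2 * π) / π =
      ellipticK (modulus a b c d) * θ / π + 2 * ellipticK (modulus a b c d) by field_simp,
    jacobiAm_add_two_mul (modulus_sq_lt_one hcd hbc hab), ampPos_add_pi, anglePos]

lemma anglePos_two_pi_sub (hcd : d < c) (hbc : c < b) (hab : b < a) (θ : ℝ) :
    anglePos a b c d (2 * π - θ) = anglePos a b c d θ := by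
  have hπ := pi_ne_zero
  rw [anglePos, show ellipticK (modulus a b c d) * (2 * π - θ) / π =
      2 * ellipticK (modulus a b c d) - ellipticK (modulus a b c d) * θ / π by field_simp,
    jacobiAm_two_mul_sub (modulus_sq_lt_one hcd hbc hab), ampPos_pi_sub, anglePos]

lemma anglePos_zero (hcd : d < c) (hbc : c < b) (hab : b < a) : anglePos a b c d 0 = c := by
  rw [anglePos, mul_zero, zero_div, jacobiAm_zero (modulus_sq_lt_one hcd hbc hab), ampPos_zero]

lemma anglePos_pi (hcd : d < c) (hbc : c < b) (hab : b < a) : anglePos a b c d π = b := by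
  rw [anglePos, mul_div_cancel_right₀ _ pi_ne_zero,
    jacobiAm_ellipticK (modulus_sq_lt_one hcd hbc hab), ampPos_pi_div_two hcd hbc]

lemma mul_div_pi_mem {K θ : ℝ} (hK : 0 < K) (hθ : θ ∈ Ioo 0 π) : K * θ / π ∈ Ioo 0 K := by
  have := pi_pos
  refine ⟨div_pos (mul_pos hK hθ.1) this, ?_⟩
  rw [div_lt_iff₀ this]
  exact mul_lt_mul_of_pos_left hθ.2 hK

lemma invOn_anglePos (hcd : d < c) (hbc : c < b) (hab : b < a) {f : ℝ → ℝ}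
    (hf : ∀ q ∈ Ioo c b, f q = π * ellipticF (modulus a b c d) (ampOf b c d q) /
      ellipticK (modulus a b c d)) :
    InvOn (anglePos a b c d) f (Ioo c b) (Ioo 0 π) ∧ MapsTo f (Ioo c b) (Ioo 0 π) ∧
      MapsTo (anglePos a b c d) (Ioo 0 π) (Ioo c b) := by
  have hk := modulus_sq_lt_one hcd hbc hab
  have hK := ellipticK_pos hk
  have hπ := pi_pos
  have hm : MapsTo (anglePos a b c d) (Ioo 0 π) (Ioo c b) := fun θ hθ =>
    ampPos_mem_Ioo hcd hbc (jacobiAm_mem hk (mul_div_pi_mem hK hθ))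
  refine ⟨⟨fun q hq => ?_, fun θ hθ => ?_⟩, fun q hq => ?_, hm⟩
  · rw [hf q hq, anglePos, show ∀ x : ℝ, ellipticK (modulus a b c d) *
        (π * x / ellipticK (modulus a b c d)) / π = x from fun x => by field_simp,
      jacobiAm_ellipticF hk, ampPos_ampOf hcd hbc ⟨hq.1.le, hq.2.le⟩]
  · have h := jacobiAm_mem hk (mul_div_pi_mem hK hθ)
    rw [hf _ (hm hθ), anglePos, ampOf_ampPos hcd hbc ⟨h.1.le, h.2.le⟩, ellipticF_jacobiAm hk]
    field_simp
  · have h := jacobiAm_ellipticF_mem hk (ampOf_mem_Ioo hcd hbc hq)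
    rw [hf q hq]
    refine ⟨div_pos (mul_pos hπ h.1) hK, ?_⟩
    rw [div_lt_iff₀ hK]
    exact mul_lt_mul_of_pos_left h.2 hπ

lemma invFunOn_eq_of_invOn {f g : ℝ → ℝ} {s t : Set ℝ} (h : InvOn g f s t) (hg : MapsTo g t s)
    {x : ℝ} (hx : x ∈ t) : Function.invFunOn f s x = g x := by
  have h1 : f (Function.invFunOn f s x) = x := Function.invFunOn_eq ⟨g x, hg hx, h.2 hx⟩
  have h2 : Function.invFunOn f s x ∈ s := Function.invFunOn_mem ⟨g x, hg hx, h.2 hx⟩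
  rw [← h.1 h2, h1]

variable {ra rb rc rd : ℝ → ℝ} {E : ℝ}

lemma RootFamily.invOn_angleUp (hβ : β < 0) (hR : RootFamily α β ra rb rc rd)
    (hE : E ∈ Ioo 0 (barrier α β)) :
    InvOn (anglePos (ra E) (rb E) (rc E) (rd E)) (angleUp α β E) (Ioo (rc E) (rb E)) (Ioo 0 π) ∧
      MapsTo (angleUp α β E) (Ioo (rc E) (rb E)) (Ioo 0 π) ∧
      MapsTo (anglePos (ra E) (rb E) (rc E) (rd E)) (Ioo 0 π) (Ioo (rc E) (rb E)) := by
  obtain ⟨hcd, hbc, hab⟩ := (hR E hE).order hβ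
  exact invOn_anglePos hcd hbc hab fun q hq => hR.angleUp_eq hβ hE hq

lemma RootFamily.invOn_angleDown (hβ : β < 0) (hR : RootFamily α β ra rb rc rd)
    (hE : E ∈ Ioo 0 (barrier α β)) :
    InvOn (anglePos (ra E) (rb E) (rc E) (rd E)) (angleDown α β E) (Ioo (rc E) (rb E))
        (Ioo π (2 * π)) ∧
      MapsTo (angleDown α β E) (Ioo (rc E) (rb E)) (Ioo π (2 * π)) ∧
      MapsTo (anglePos (ra E) (rb E) (rc E) (rd E)) (Ioo π (2 * π)) (Ioo (rc E) (rb E)) := by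
  obtain ⟨hcd, hbc, hab⟩ := (hR E hE).order hβ
  obtain ⟨⟨h1, h2⟩, h3, h4⟩ := hR.invOn_angleUp hβ hE
  have hd : ∀ q ∈ Ioo (rc E) (rb E), angleDown α β E q = 2 * π - angleUp α β E q := fun q hq => by
    rw [hR.angleDown_eq hβ hE hq, hR.angleUp_eq hβ hE hq]
  have hr : ∀ {θ : ℝ}, θ ∈ Ioo π (2 * π) → 2 * π - θ ∈ Ioo 0 π := fun hθ =>
    ⟨by linarith [hθ.2], by linarith [hθ.1]⟩
  have h5 : MapsTo (anglePos (ra E) (rb E) (rc E) (rd E)) (Ioo π (2 * π)) (Ioo (rc E) (rb E)) :=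
    fun θ hθ => by rw [← anglePos_two_pi_sub hcd hbc hab]; exact h4 (hr hθ)
  refine ⟨⟨fun q hq => ?_, fun θ hθ => ?_⟩, fun q hq => ?_, h5⟩
  · rw [hd q hq, anglePos_two_pi_sub hcd hbc hab, h1 hq]
  · rw [hd _ (h5 hθ), ← anglePos_two_pi_sub hcd hbc hab, h2 (hr hθ), sub_sub_cancel]
  · rw [hd q hq]
    exact ⟨by linarith [(h3 hq).2], by linarith [(h3 hq).1]⟩

lemma RootFamily.bijOn_angleUp (hβ : β < 0) (hR : RootFamily α β ra rb rc rd)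
    (hE : E ∈ Ioo 0 (barrier α β)) :
    BijOn (angleUp α β E) (Ioo (rc E) (rb E)) (Ioo 0 π) :=
  let h := hR.invOn_angleUp hβ hE
  h.1.bijOn h.2.1 h.2.2

lemma RootFamily.bijOn_angleDown (hβ : β < 0) (hR : RootFamily α β ra rb rc rd)
    (hE : E ∈ Ioo 0 (barrier α β)) :
    BijOn (angleDown α β E) (Ioo (rc E) (rb E)) (Ioo π (2 * π)) :=
  let h := hR.invOn_angleDown hβ hE
  h.1.bijOn h.2.1 h.2.2

/-- The pieces of `position` all agree with one formula in `sn²`, which is continuous and periodic;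
on the lower branch this rests on the symmetry `θ ↦ 2π - θ`. -/
lemma RootFamily.position_eq (hβ : β < 0) (hR : RootFamily α β ra rb rc rd)
    (hE : E ∈ Ioo 0 (barrier α β)) :
    position α β E = anglePos (ra E) (rb E) (rc E) (rd E) := by
  obtain ⟨hcd, hbc, hab⟩ := (hR E hE).order hβ
  have hup := hR.invOn_angleUp hβ hE
  have hdown := hR.invOn_angleDown hβ hE
  ext θ
  have hmem := toIcoMod_mem_Ico two_pi_pos 0 θ
  have hθ : anglePos (ra E) (rb E) (rc E) (rd E) θ =
      anglePos (ra E) (rb E) (rc E) (rd E) (toIcoMod two_pi_pos 0 θ) := by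
    rw [toIcoMod, (anglePos_periodic hcd hbc hab).sub_zsmul_eq]
  rw [hθ, position, (hR E hE).qLeft_eq hβ, (hR E hE).qRight_eq hβ]
  generalize toIcoMod two_pi_pos 0 θ = φ at hmem
  rw [zero_add] at hmem
  split_ifs with h0 h1 h2
  · rw [h0, anglePos_zero hcd hbc hab]
  · exact invFunOn_eq_of_invOn hup.1 hup.2.2 ⟨hmem.1.lt_of_ne' h0, h1⟩
  · rw [h2, anglePos_pi hcd hbc hab]
  · exact invFunOn_eq_of_invOn hdown.1 hdown.2.2
      ⟨(not_lt.1 h1).lt_of_ne' h2, hmem.2⟩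

lemma integral_cos_mul_pi_div {K : ℝ} (hK : K ≠ 0) : ∫ u in (0 : ℝ)..K, cos (π / K * u) = 0 := by
  have hπ := pi_ne_zero
  rw [intervalIntegral.integral_comp_mul_left _ (by positivity), integral_cos, mul_zero,
    div_mul_cancel₀ _ hK]
  simp

/-- The first Fourier coefficient of an even `2π`-periodic function. -/
lemma fourierCoeffOn_one_of_even {f : ℝ → ℝ} (hf : Continuous f)
    (hsymm : ∀ θ, f (2 * π - θ) = f θ) :
    fourierCoeffOn two_pi_pos (fun θ => (f θ : ℂ)) 1 =
      ((1 / π * ∫ θ in (0 : ℝ)..π, cos θ * f θ : ℝ) : ℂ) := by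
  have hπ := pi_ne_zero
  have hcexp (θ : ℝ) : (fourier (-1) (θ : AddCircle (2 * π - 0)) : ℂ) =
      Complex.exp (-(θ * Complex.I)) := by
    rw [fourier_coe_apply]
    congr 1
    push_cast
    have : (π : ℂ) ≠ 0 := by exact_mod_cast hπ
    field_simp
    ring
  have hc : Continuous fun θ : ℝ => Complex.exp (-(θ * Complex.I)) * (f θ : ℂ) := by fun_prop
  -- The reflection `θ ↦ 2π - θ` folds the second half of the period onto the first, turning the
  -- exponential into twice a cosine.
  have h2 : ∫ θ in π..(2 * π), Complex.exp (-(θ * Complex.I)) * (f θ : ℂ) =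
      ∫ θ in (0 : ℝ)..π, Complex.exp (θ * Complex.I) * (f θ : ℂ) := by
    have := intervalIntegral.integral_comp_sub_left (a := 0) (b := π)
      (fun θ : ℝ => Complex.exp (-(θ * Complex.I)) * (f θ : ℂ)) (2 * π)
    rw [show 2 * π - π = π by ring, sub_zero] at this
    rw [← this]
    congr 1
    ext θ
    rw [hsymm]
    congr 1
    push_cast
    rw [show -((2 * (π : ℂ) - θ) * Complex.I) = θ * Complex.I - 2 * π * Complex.I by ring,
      Complex.exp_sub, Complex.exp_two_pi_mul_I, div_one]
  rw [fourierCoeffOn_eq_integral]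
  simp only [hcexp, smul_eq_mul, sub_zero]
  rw [← intervalIntegral.integral_add_adjacent_intervals (b := π) (hc.intervalIntegrable _ _)
    (hc.intervalIntegrable _ _), h2, ← intervalIntegral.integral_add
    (hc.intervalIntegrable _ _) (Continuous.intervalIntegrable (by fun_prop) _ _)]
  have h3 : ∫ θ in (0 : ℝ)..π, (Complex.exp (-(θ * Complex.I)) * (f θ : ℂ) +
      Complex.exp (θ * Complex.I) * (f θ : ℂ)) =
      ((∫ θ in (0 : ℝ)..π, 2 * (cos θ * f θ) : ℝ) : ℂ) := by
    rw [← intervalIntegral.integral_ofReal]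
    congr 1
    ext θ
    push_cast
    rw [Complex.cos, neg_mul]
    ring
  rw [h3, intervalIntegral.integral_const_mul, Complex.real_smul, ← Complex.ofReal_mul]
  congr 1
  field_simp

/-- After `θ = πu/K` the constant `d` integrates to zero against the cosine, and the rest is `(c-d)`
times the contour integral, provided that `γ² = k² sn² τ`. -/
lemma integral_cos_mul_anglePos (hcd : d < c) (hbc : c < b) (hab : b < a) {τ : ℝ}
    (hτ : τ ∈ Ioo 0 (ellipticK (modulus a b c d)))
    (hcn : jacobiCn τ (modulus a b c d) = √((c - d) / (a - d))) :
    1 / π * ∫ θ in (0 : ℝ)..π, cos θ * anglePos a b c d θ =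
      -(π * √((b - d) * (a - c)) * sin (π * τ / ellipticK (modulus a b c d)) /
              (2 * ellipticK (modulus a b c d) * sinh (2 * omegaZero a b c d))) := by
  have hk0 := modulus_pos hcd hbc hab
  have hk := modulus_sq_lt_one hcd hbc hab
  have hksq := modulus_sq hcd hbc hab
  have hmain := integral_cos_div_one_sub_sn_sq hk0 hk hτ
  have hcsq := jacobiCn_sq τ (modulus a b c d)
  have hdsq := jacobiDn_sq hk τ
  have hdpos := jacobiDn_pos hk τ
  have hspos := jacobiSn_pos hk hτ.1 hτ.2.le
  have hcpos := jacobiCn_pos hk hτ.1.le hτ.2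
  have hK := ellipticK_pos hk
  have hπ := pi_pos
  have hac : 0 < a - c := by linarith
  have had : 0 < a - d := by linarith
  have hbd : 0 < b - d := by linarith
  have hcd' : 0 < c - d := by linarith
  have hs : jacobiSn τ (modulus a b c d) ^ 2 = (a - c) / (a - d) := by
    rw [hcn, sq_sqrt (by positivity)] at hcsq
    field_simp at hcsq ⊢
    linarith
  -- The prescribed `cn τ` gives `sn² τ = (a-c)/(a-d)`, exactly the value for which `k² sn² τ = γ²`.
  have hγ : (modulus a b c d * jacobiSn τ (modulus a b c d)) ^ 2 = gammaSq b c d := by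
    rw [mul_pow, hs, hksq, gammaSq]
    field_simp
  -- Turns the factor `(c-d) sn τ/(cn τ dn τ)` into `√((b-d)(a-c))`. Both sides are positive, so
  -- their squares are compared.
  have hW : jacobiSn τ (modulus a b c d) * (c - d) = √((b - d) * (a - c)) *
      (jacobiCn τ (modulus a b c d) * jacobiDn τ (modulus a b c d)) := by
    rw [← abs_of_pos (mul_pos hspos hcd'), ← abs_of_pos (show 0 < √((b - d) * (a - c)) *
      (jacobiCn τ (modulus a b c d) * jacobiDn τ (modulus a b c d)) by positivity), ← sq_eq_sq_iff_abs_eq_abs,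
      mul_pow, mul_pow, mul_pow, sq_sqrt (by positivity), hdsq, hcn, sq_sqrt (by positivity), hs,
      hksq]
    field_simp
    ring
  rw [hγ] at hmain
  generalize hkk : modulus a b c d = k at *
  have hsub := intervalIntegral.integral_comp_mul_left (a := 0) (b := ellipticK k)
    (fun θ => cos θ * anglePos a b c d θ) (show π / ellipticK k ≠ 0 by positivity)
  rw [mul_zero, div_mul_cancel₀ _ hK.ne'] at hsub
  have hpt (u : ℝ) : cos (π / ellipticK k * u) * anglePos a b c d (π / ellipticK k * u) =
      d * cos (π / ellipticK k * u) + (c - d) *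
        (cos (π / ellipticK k * u) / (1 - gammaSq b c d * jacobiSn u k ^ 2)) := by
    rw [anglePos, hkk, show ellipticK k * (π / ellipticK k * u) / π = u by field_simp, ampPos,
      jacobiSn]
    ring
  have hc2 : Continuous fun u => cos (π / ellipticK k * u) /
      (1 - gammaSq b c d * jacobiSn u k ^ 2) :=
    Continuous.div (by fun_prop) (continuous_const.sub (continuous_const.mul
      ((continuous_sin.comp (continuous_jacobiAm hk)).pow 2)))
      fun u => (one_sub_gammaSq_mul_pos hcd hbc _).ne'
  have hc3 : Continuous fun u => (c - d) * (cos (π / ellipticK k * u) /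
      (1 - gammaSq b c d * jacobiSn u k ^ 2)) := continuous_const.mul hc2
  simp only [hpt] at hsub
  rw [intervalIntegral.integral_add (Continuous.intervalIntegrable (by fun_prop) _ _)
    (hc3.intervalIntegrable _ _), intervalIntegral.integral_const_mul,
    intervalIntegral.integral_const_mul, integral_cos_mul_pi_div hK.ne', hmain, smul_eq_mul,
    inv_div] at hsub
  have hω : 2 * omegaZero a b c d = π / ellipticK k * ellipticK (complModulus k) := by
    rw [omegaZero, hkk]; field_simp
  have hsinh : 0 < sinh (π / ellipticK k * ellipticK (complModulus k)) := by
    refine sinh_pos_iff.2 (mul_pos (by positivity) (ellipticK_pos ?_))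
    exact complModulus_sq_lt_one hk0.ne' hk
  rw [hω, show π * τ / ellipticK k = π / ellipticK k * τ by ring]
  have hfin : ∫ θ in (0 : ℝ)..π, cos θ * anglePos a b c d θ =
      π / ellipticK k * (d * 0 + (c - d) * -(π * sin (π / ellipticK k * τ) * jacobiSn τ k /
        (2 * (jacobiCn τ k * jacobiDn τ k) *
          sinh (π / ellipticK k * ellipticK (complModulus k))))) := by
    rw [hsub]; field_simp
  rw [hfin]
  have h4 : √((b - d) * (a - c)) = jacobiSn τ k * (c - d) / (jacobiCn τ k * jacobiDn τ k) := by
    rw [hW]; field_simp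
  rw [h4]
  field_simp
  ring

lemma RootFamily.qHarmonic_eq (hβ : β < 0) (hR : RootFamily α β ra rb rc rd)
    (hE : E ∈ Ioo 0 (barrier α β)) {τ : ℝ}
    (hτ : τ ∈ Ioo 0 (ellipticK (modulus (ra E) (rb E) (rc E) (rd E))))
    (hcn : jacobiCn τ (modulus (ra E) (rb E) (rc E) (rd E)) =
      √((rc E - rd E) / (ra E - rd E))) :
    qHarmonic α β 1 E = ((-(π * √((rb E - rd E) * (ra E - rc E)) *
      sin (π * τ / ellipticK (modulus (ra E) (rb E) (rc E) (rd E))) /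
        (2 * ellipticK (modulus (ra E) (rb E) (rc E) (rd E)) *
          sinh (2 * omegaZero (ra E) (rb E) (rc E) (rd E)))) : ℝ) : ℂ) := by
  obtain ⟨hcd, hbc, hab⟩ := (hR E hE).order hβ
  rw [qHarmonic, hR.position_eq hβ hE,
    fourierCoeffOn_one_of_even (continuous_anglePos hcd hbc hab)
      (anglePos_two_pi_sub hcd hbc hab), integral_cos_mul_anglePos hcd hbc hab hτ hcn]

end Angle

/-! ### The closed form of `G`, its differentiability, and conservation. -/

section Harmonic

variable {α β : ℝ} {a b c d k : ℝ}

/-- On this vertical line `cn(Re ν, k')` vanishes and `sn(Re ν, k')` is 1, so only the imaginary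
term survives; the modulus complementary to `k'` is `k` again. -/
lemma jacobiCnC_of_re_eq (hk0 : 0 < k) (hk : k ^ 2 < 1) {ν : ℂ}
    (hν : ν.re = ellipticK (complModulus k)) :
    jacobiCnC ν (complModulus k) =
      -Complex.I * ((k * jacobiSn ν.im k / jacobiDn ν.im k : ℝ) : ℂ) := by
  have hk' := complModulus_sq_lt_one hk0.ne' hk
  have hd := jacobiDn_pos hk ν.im
  have hden : jacobiCn ν.im k ^ 2 + (1 - k ^ 2) * 1 ^ 2 * jacobiSn ν.im k ^ 2 =
      jacobiDn ν.im k ^ 2 := by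
    rw [jacobiCn_sq, jacobiDn_sq hk]; ring
  rw [jacobiCnC, hν, complModulus_complModulus hk0.le hk, jacobiCn_ellipticK hk',
    jacobiSn_ellipticK hk', jacobiDn_complModulus hk0 hk, complModulus_sq hk, hden]
  have hdC : (jacobiDn ν.im k : ℂ) ≠ 0 := by exact_mod_cast hd.ne'
  push_cast
  field_simp
  ring

lemma isNu_iff (hcd : d < c) (hbc : c < b) (hab : b < a) {ν : ℂ} :
    IsNu a b c d ν ↔ ν.re = ellipticK (complModulus (modulus a b c d)) ∧
      ν.im ∈ Ioo 0 (ellipticK (modulus a b c d)) ∧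
      jacobiCn ν.im (modulus a b c d) = √((c - d) / (a - d)) := by
  have hk0 := modulus_pos hcd hbc hab
  have hk := modulus_sq_lt_one hcd hbc hab
  have hksq := modulus_sq hcd hbc hab
  refine and_congr_right fun hre => and_congr_right fun him => ?_
  rw [jacobiCnC_of_re_eq hk0 hk hre, mul_right_inj' (neg_ne_zero.2 Complex.I_ne_zero),
    Complex.ofReal_inj]
  have hd := jacobiDn_pos hk ν.im
  have hs := jacobiSn_pos hk him.1 him.2.le
  have hc := jacobiCn_pos hk him.1.le him.2
  have hdsq := jacobiDn_sq hk ν.im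
  have hcsq := jacobiCn_sq ν.im (modulus a b c d)
  have hac : 0 < a - c := by linarith
  have had : 0 < a - d := by linarith
  have hbd : 0 < b - d := by linarith
  have hcd' : 0 < c - d := by linarith
  have hbc' : 0 < b - c := by linarith
  rw [eq_comm, sqrt_eq_iff_eq_sq (by positivity) (by positivity), eq_comm (b := √_),
    sqrt_eq_iff_eq_sq (by positivity) hc.le, div_pow, mul_pow, hdsq, hcsq]
  have hd' : 0 < 1 - modulus a b c d ^ 2 * jacobiSn ν.im (modulus a b c d) ^ 2 := by
    rw [← hdsq]; positivity
  rw [div_eq_div_iff hcd'.ne' hd'.ne', hksq]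
  generalize jacobiSn ν.im (modulus a b c d) ^ 2 = x
  -- The two squared conditions on `x = sn²` are linear, and their defects differ by the nonzero
  -- factor `(b-c)/(a-c)`.
  have key : (b - c) * (1 - (b - c) * (a - d) / ((a - c) * (b - d)) * x) -
      (b - c) * (a - d) / ((a - c) * (b - d)) * x * (c - d) =
      (b - c) / (a - c) * ((1 - x) * (a - d) - (c - d)) := by
    field_simp
    ring
  rw [div_eq_iff had.ne']
  constructor <;> intro h
  · have h0 : (b - c) / (a - c) * ((1 - x) * (a - d) - (c - d)) = 0 := by rw [← key]; linarith
    linarith [(mul_eq_zero.1 h0).resolve_left (by positivity)]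
  · rw [sub_eq_zero.2 h.symm, mul_zero] at key
    linarith

/-- The argument at which `cn = √((c - d) / (a - d))`. -/
def cnArg (a b c d : ℝ) : ℝ := ellipticF (modulus a b c d) (arccos √((c - d) / (a - d)))

lemma sqrt_ratio_mem (hcd : d < c) (hca : c < a) : √((c - d) / (a - d)) ∈ Ioo 0 1 := by
  have had : 0 < a - d := by linarith
  refine ⟨sqrt_pos.2 (div_pos (by linarith) had), ?_⟩
  rw [sqrt_lt' one_pos, one_pow, div_lt_one had]
  linarith

lemma cnArg_mem (hcd : d < c) (hbc : c < b) (hab : b < a) :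
    cnArg a b c d ∈ Ioo 0 (ellipticK (modulus a b c d)) := by
  have h := sqrt_ratio_mem hcd (hbc.trans hab)
  exact jacobiAm_ellipticF_mem (modulus_sq_lt_one hcd hbc hab)
    ⟨arccos_pos.2 h.2, arccos_lt_pi_div_two.2 h.1⟩

lemma jacobiCn_cnArg (hcd : d < c) (hbc : c < b) (hab : b < a) :
    jacobiCn (cnArg a b c d) (modulus a b c d) = √((c - d) / (a - d)) := by
  have h := sqrt_ratio_mem hcd (hbc.trans hab)
  rw [jacobiCn, cnArg, jacobiAm_ellipticF (modulus_sq_lt_one hcd hbc hab),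
    cos_arccos (by linarith [h.1]) h.2.le]

lemma eq_cnArg (hcd : d < c) (hbc : c < b) (hab : b < a) {τ : ℝ}
    (hτ : τ ∈ Ioo 0 (ellipticK (modulus a b c d)))
    (h : jacobiCn τ (modulus a b c d) = √((c - d) / (a - d))) : τ = cnArg a b c d := by
  have hk := modulus_sq_lt_one hcd hbc hab
  have hm := jacobiAm_mem hk hτ
  have : jacobiAm τ (modulus a b c d) = arccos √((c - d) / (a - d)) := by
    rw [← h, jacobiCn, arccos_cos hm.1.le (by linarith [hm.2, pi_pos])]
  rw [cnArg, ← this, ellipticF_jacobiAm hk]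

lemma existsUnique_isNu (hcd : d < c) (hbc : c < b) (hab : b < a) : ∃! ν : ℂ, IsNu a b c d ν := by
  refine ⟨⟨ellipticK (complModulus (modulus a b c d)), cnArg a b c d⟩,
    (isNu_iff hcd hbc hab).2 ⟨rfl, cnArg_mem hcd hbc hab, jacobiCn_cnArg hcd hbc hab⟩,
    fun ν hν => ?_⟩
  obtain ⟨h1, h2, h3⟩ := (isNu_iff hcd hbc hab).1 hν
  exact Complex.ext h1 (eq_cnArg hcd hbc hab h2 h3)

/-- The real closed form of the amplitude of the first harmonic. -/
def realG (a b c d : ℝ) : ℝ :=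
  π * √((b - d) * (a - c)) * sin (π * cnArg a b c d / ellipticK (modulus a b c d)) /
    (2 * ellipticK (modulus a b c d) * sinh (2 * omegaZero a b c d))

/-- With `ν = K' + iτ`, `2ω = -iπτ/K` and `sinh(2ω) = -i sin(πτ/K)`; this `-i` cancels the `i` of
the imaginary square root. -/
lemma closedG_eq_realG (hcd : d < c) (hbc : c < b) (hab : b < a) {ν : ℂ}
    (hν : IsNu a b c d ν) : closedG a b c d ν = (realG a b c d : ℂ) := by
  obtain ⟨h1, h2, h3⟩ := (isNu_iff hcd hbc hab).1 hν
  have hK := ellipticK_pos (modulus_sq_lt_one hcd hbc hab)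
  have hKC : (ellipticK (modulus a b c d) : ℂ) ≠ 0 := by exact_mod_cast hK.ne'
  have hω : 2 * omega a b c d ν =
      -(((π * cnArg a b c d / ellipticK (modulus a b c d) : ℝ) : ℂ) * Complex.I) := by
    rw [omega, ← h1, ← eq_cnArg hcd hbc hab h2 h3]
    have : (ν.re : ℂ) - ν = -(ν.im * Complex.I) := by
      linear_combination Complex.re_add_im ν
    rw [this]
    push_cast
    field_simp
  rw [closedG, hω, Complex.sinh_neg, Complex.sinh_mul_I, realG]
  push_cast
  congr 1
  linear_combination (-(π : ℂ) * (√((b - d) * (a - c)) : ℝ) *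
    Complex.sin (π * cnArg a b c d / ellipticK (modulus a b c d))) * Complex.I_sq

variable {ra rb rc rd : ℝ → ℝ} {E : ℝ}

lemma RootFamily.qHarmonic_eq_realG (hβ : β < 0) (hR : RootFamily α β ra rb rc rd)
    (hE : E ∈ Ioo 0 (barrier α β)) :
    qHarmonic α β 1 E = ((-realG (ra E) (rb E) (rc E) (rd E) : ℝ) : ℂ) := by
  obtain ⟨hcd, hbc, hab⟩ := (hR E hE).order hβ
  exact hR.qHarmonic_eq hβ hE (cnArg_mem hcd hbc hab) (jacobiCn_cnArg hcd hbc hab)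

lemma RootFamily.differentiableAt_realG (hβ : β < 0) (hR : RootFamily α β ra rb rc rd)
    (hE : E ∈ Ioo 0 (barrier α β)) :
    DifferentiableAt ℝ (fun e => realG (ra e) (rb e) (rc e) (rd e)) E := by
  obtain ⟨ha, hb, hc, hd⟩ := differentiableAt_roots hβ hR hE
  obtain ⟨hcd, hbc, hab⟩ := (hR E hE).order hβ
  have hk0 := modulus_pos hcd hbc hab
  have hk := QuarticEscape.modulus_sq_lt_one hcd hbc hab
  have hK := ellipticK_pos hk
  have hk' := complModulus_sq_lt_one hk0.ne' hk
  have hK' := ellipticK_pos hk'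
  have hmod := differentiableAt_modulus_of ha hb hc hd hcd hbc hab
  have hmod' : DifferentiableAt ℝ
      (fun e => complModulus (modulus (ra e) (rb e) (rc e) (rd e))) E :=
    ((hmod.pow 2).const_sub 1).sqrt (sub_pos.2 hk).ne'
  have hKd : DifferentiableAt ℝ (fun e => ellipticK (modulus (ra e) (rb e) (rc e) (rd e))) E :=
    DifferentiableAt.ellipticF hmod (differentiableAt_const _) hk
  have hKd' : DifferentiableAt ℝ
      (fun e => ellipticK (complModulus (modulus (ra e) (rb e) (rc e) (rd e)))) E :=
    DifferentiableAt.ellipticF hmod' (differentiableAt_const _) hk'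
  have hrat := sqrt_ratio_mem hcd (hbc.trans hab)
  have had : rd E < ra E := by linarith
  have hsq : DifferentiableAt ℝ (fun e => √((rc e - rd e) / (ra e - rd e))) E :=
    ((hc.sub hd).div (ha.sub hd) (by simpa [sub_eq_zero] using had.ne')).sqrt
      (sqrt_pos.1 hrat.1).ne'
  have hτ : DifferentiableAt ℝ (fun e => cnArg (ra e) (rb e) (rc e) (rd e)) E :=
    DifferentiableAt.ellipticF hmod (DifferentiableAt.fun_comp' (g := arccos) E (differentiableAt_arccos.2
      ⟨by linarith [hrat.1], hrat.2.ne⟩) hsq) hk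
  have hω : DifferentiableAt ℝ (fun e => omegaZero (ra e) (rb e) (rc e) (rd e)) E :=
    (hKd'.const_mul π).div (hKd.const_mul 2) (by positivity)
  have hωpos : 0 < omegaZero (ra E) (rb E) (rc E) (rd E) := by
    unfold omegaZero; have := pi_pos; positivity
  have hprod : 0 < (rb E - rd E) * (ra E - rc E) := mul_pos (by linarith) (by linarith)
  have hden : DifferentiableAt ℝ (fun e => 2 * ellipticK (modulus (ra e) (rb e) (rc e) (rd e)) *
      sinh (2 * omegaZero (ra e) (rb e) (rc e) (rd e))) E :=
    (hKd.const_mul 2).mul (hω.const_mul 2).sinh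
  refine ((((((hb.sub hd).mul (ha.sub hc)).sqrt hprod.ne').const_mul π).mul
    ((hτ.const_mul π).div hKd hK.ne').sin)).div hden ?_
  have := sinh_pos_iff.2 (mul_pos two_pos hωpos)
  positivity

lemma RootFamily.eventually_energyOfAction (hβ : β < 0) (hR : RootFamily α β ra rb rc rd)
    (hE : E ∈ Ioo 0 (barrier α β)) :
    ∀ᶠ y in nhds (actionVar α β E), energyOfAction α β y ∈ Ioo 0 (barrier α β) := by
  refine (hR.hasDerivAt_energyOfAction hβ hE).continuousAt.eventually_mem (isOpen_Ioo.mem_nhds ?_)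
  rwa [hR.energyOfAction_actionVar hβ hE]

/-- The first harmonic as a differentiable real function of the action. -/
lemma RootFamily.hasDerivAt_realG_energyOfAction (hβ : β < 0) (hR : RootFamily α β ra rb rc rd)
    (hE : E ∈ Ioo 0 (barrier α β)) :
    ∃ G' : ℝ, HasDerivAt (fun y => realG (ra (energyOfAction α β y)) (rb (energyOfAction α β y))
        (rc (energyOfAction α β y)) (rd (energyOfAction α β y))) G' (actionVar α β E) ∧
      HasDerivAt (harmonicOfAction α β) ((-G' : ℝ) : ℂ) (actionVar α β E) := by
  have h1 := hR.differentiableAt_realG hβ hE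
  rw [← hR.energyOfAction_actionVar hβ hE] at h1
  have h2 := (h1.comp (actionVar α β E)
    (hR.hasDerivAt_energyOfAction hβ hE).differentiableAt).hasDerivAt
  refine ⟨_, h2, h2.neg.ofReal_comp.congr_of_eventuallyEq ?_⟩
  filter_upwards [hR.eventually_energyOfAction hβ hE] with y hy
  exact hR.qHarmonic_eq_realG hβ hy

lemma conservedQuantity_eq {F Ω ϑ ξ G : ℝ} (hq : qHarmonic α β 1 ξ = ((-G : ℝ) : ℂ)) :
    conservedQuantity α β F Ω ϑ ξ = ((ξ - F * G * sin ϑ - Ω * actionVar α β ξ : ℝ) : ℂ) := by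
  rw [conservedQuantity, hq, Complex.conj_ofReal]
  push_cast
  rw [Complex.sin, show -Complex.I * (ϑ : ℂ) = -ϑ * Complex.I by ring,
    mul_comm Complex.I (ϑ : ℂ)]
  ring

/-- Conservation along the averaged slow flow. -/
lemma RootFamily.isSlowFlow_conserved (hβ : β < 0) (hR : RootFamily α β ra rb rc rd)
    {F Ω : ℝ} {s : Set ℝ} {J ϑ : ℝ → ℝ} (hs : s.OrdConnected) (h : IsSlowFlow α β F Ω s J ϑ) :
    ∃ C₀ : ℝ, ∀ t ∈ s, energyOfAction α β (J t) -
      F * realG (ra (energyOfAction α β (J t))) (rb (energyOfAction α β (J t)))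
        (rc (energyOfAction α β (J t))) (rd (energyOfAction α β (J t))) * sin (ϑ t) -
      Ω * J t = C₀ := by
  set C : ℝ → ℝ := fun t => energyOfAction α β (J t) -
      F * realG (ra (energyOfAction α β (J t))) (rb (energyOfAction α β (J t)))
        (rc (energyOfAction α β (J t))) (rd (energyOfAction α β (J t))) * sin (ϑ t) -
      Ω * J t with hC
  have hderiv : ∀ t ∈ s, HasDerivWithinAt C 0 s t := by
    intro t ht
    obtain ⟨⟨E, hE, hEJ⟩, hJ, hϑ⟩ := h t ht
    obtain ⟨G', hG, hq⟩ := hR.hasDerivAt_realG_energyOfAction hβ hE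
    have hH := hR.hasDerivAt_energyOfAction hβ hE
    have hqv : harmonicOfAction α β (actionVar α β E) =
        ((-realG (ra (energyOfAction α β (J t))) (rb (energyOfAction α β (J t)))
        (rc (energyOfAction α β (J t))) (rd (energyOfAction α β (J t))) : ℝ) : ℂ) := by
      rw [← hEJ, harmonicOfAction, hR.energyOfAction_actionVar hβ hE,
        hR.qHarmonic_eq_realG hβ hE]
    have hconj : HasDerivAt (fun j => (starRingEnd ℂ) (harmonicOfAction α β j))
        ((-G' : ℝ) : ℂ) (actionVar α β E) := by
      have := hq.star
      rwa [Complex.star_def, Complex.conj_ofReal] at this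
    rw [hEJ] at hG hq hH hqv hconj
    rw [hqv, Complex.conj_ofReal] at hJ
    rw [hq.deriv, hconj.deriv, hH.deriv] at hϑ
    generalize π / halfPeriod β (ra E) (rb E) (rc E) (rd E) = H' at hH hϑ
    generalize hGv : realG (ra (energyOfAction α β (J t))) (rb (energyOfAction α β (J t)))
        (rc (energyOfAction α β (J t))) (rd (energyOfAction α β (J t))) = G at hJ
    have hJ' : HasDerivWithinAt J (F * G * cos (ϑ t)) s t := by
      have e : -(F / 2 : ℂ) * (((-G : ℝ) : ℂ) * Complex.exp (Complex.I * ϑ t) +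
          ((-G : ℝ) : ℂ) * Complex.exp (-Complex.I * ϑ t)) = ((F * G * cos (ϑ t) : ℝ) : ℂ) := by
        push_cast
        rw [Complex.cos, neg_mul, neg_mul, mul_comm Complex.I]
        ring_nf
      rw [e] at hJ
      exact Complex.reCLM.hasFDerivAt.comp_hasDerivWithinAt t hJ
    have hϑ' : HasDerivWithinAt ϑ (H' - F * G' * sin (ϑ t) - Ω) s t := by
      have e : (H' : ℂ) - Complex.I * F / 2 *
          (((-G' : ℝ) : ℂ) * Complex.exp (Complex.I * ϑ t) -
            ((-G' : ℝ) : ℂ) * Complex.exp (-Complex.I * ϑ t)) - Ω =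
          ((H' - F * G' * sin (ϑ t) - Ω : ℝ) : ℂ) := by
        push_cast
        rw [Complex.sin, neg_mul, neg_mul, mul_comm Complex.I (ϑ t : ℂ)]
        ring_nf
      rw [e] at hϑ
      exact Complex.reCLM.hasFDerivAt.comp_hasDerivWithinAt t hϑ
    have hHt := hH.comp_hasDerivWithinAt t hJ'
    have hGt := hG.comp_hasDerivWithinAt t hJ'
    -- With `J' = F G cos ϑ` and `ϑ' = H' - F G' sin ϑ - Ω`, the derivative of `C` is `J' ϑ' - ϑ' J'
    -- = 0`.
    have := (hHt.sub ((hGt.const_mul F).mul hϑ'.sin)).sub (hJ'.const_mul Ω)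
    convert! this using 1
    simp only [Function.comp_apply, hGv]
    ring
  rcases s.eq_empty_or_nonempty with rfl | ⟨t₀, ht₀⟩
  · exact ⟨0, by simp⟩
  refine ⟨C t₀, fun t ht => ?_⟩
  -- The mean value inequality with bound 0 on the convex set `s` gives constancy.
  have := hs.convex.norm_image_sub_le_of_norm_hasDerivWithin_le (C := 0) hderiv (by simp) ht₀ ht
  rw [zero_mul, norm_le_zero_iff, sub_eq_zero] at this
  exact this

end Harmonic

end QuarticEscape

end

/-! ### The main theorem. -/

theorem mainTheorem2 (α β : ℝ) (hβ : β < 0) :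
    -- closed form of the barrier
    (0 ≤ α → barrier α β =
      (α - √(α ^ 2 - 4 * β)) ^ 2 * (α * (√(α ^ 2 - 4 * β) - α) + 6 * β) / (96 * β ^ 3)) ∧
    (α ≤ 0 → barrier α β =
      -((√(α ^ 2 - 4 * β) + α) ^ 2 * (α * (√(α ^ 2 - 4 * β) + α) - 6 * β)) / (96 * β ^ 3)) ∧
    -- the action-angle variables are well defined below the barrier
    StrictMonoOn (actionVar α β) (Ioo 0 (barrier α β)) ∧
    (∀ E ∈ Ioo 0 (barrier α β),
      DifferentiableAt ℝ (energyOfAction α β) (actionVar α β E) ∧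
      DifferentiableAt ℝ (harmonicOfAction α β) (actionVar α β E) ∧
      (∀ q ∈ Ioo (qLeft α β E) (qRight α β E),
        DifferentiableAt ℝ (fun I => phaseUp α β q (energyOfAction α β I)) (actionVar α β E) ∧
        DifferentiableAt ℝ (fun I => phaseDown α β q (energyOfAction α β I)) (actionVar α β E)) ∧
      BijOn (angleUp α β E) (Ioo (qLeft α β E) (qRight α β E)) (Ioo 0 π) ∧
      BijOn (angleDown α β E) (Ioo (qLeft α β E) (qRight α β E)) (Ioo π (2 * π)) ∧
      Continuous (position α β E)) ∧
    -- the roots exist, and the auxiliary quantity `ν` is well defined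
    (∀ ξ ∈ Ioo 0 (barrier α β),
      (∃! r : ℝ × ℝ × ℝ × ℝ, IsDescendingRoots α β ξ r.1 r.2.1 r.2.2.1 r.2.2.2) ∧
      ∀ a b c d : ℝ, IsDescendingRoots α β ξ a b c d → ∃! ν : ℂ, IsNu a b c d ν) ∧
    ∀ (a b c d : ℝ → ℝ) (ν : ℝ → ℂ),
      (∀ ξ ∈ Ioo 0 (barrier α β), IsDescendingRoots α β ξ (a ξ) (b ξ) (c ξ) (d ξ) ∧
        IsNu (a ξ) (b ξ) (c ξ) (d ξ) (ν ξ)) →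
      (∀ ξ ∈ Ioo 0 (barrier α β),
        qLeft α β ξ = c ξ ∧ qRight α β ξ = b ξ ∧
        modulus (a ξ) (b ξ) (c ξ) (d ξ) ∈ Ioo 0 1 ∧
        -- closed form of the action
        actionVar α β ξ = closedAction β (a ξ) (b ξ) (c ξ) (d ξ) ∧
        -- closed form of the first harmonic, and its real form
        qHarmonic α β 1 ξ = -closedG (a ξ) (b ξ) (c ξ) (d ξ) (ν ξ) ∧
        (∃ τ ∈ Ioo 0 (ellipticK (modulus (a ξ) (b ξ) (c ξ) (d ξ))),
          jacobiCn τ (modulus (a ξ) (b ξ) (c ξ) (d ξ)) = √((c ξ - d ξ) / (a ξ - d ξ)) ∧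
          closedG (a ξ) (b ξ) (c ξ) (d ξ) (ν ξ) =
            (π * √((b ξ - d ξ) * (a ξ - c ξ)) *
                sin (π * τ / ellipticK (modulus (a ξ) (b ξ) (c ξ) (d ξ))) /
              (2 * ellipticK (modulus (a ξ) (b ξ) (c ξ) (d ξ)) *
                sinh (2 * omegaZero (a ξ) (b ξ) (c ξ) (d ξ))) : ℝ)) ∧
        -- closed form of the conservation law
        ∀ F Ω ϑ : ℝ, conservedQuantity α β F Ω ϑ ξ =
          ξ - F * closedG (a ξ) (b ξ) (c ξ) (d ξ) (ν ξ) * (sin ϑ : ℝ) -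
            Ω * closedAction β (a ξ) (b ξ) (c ξ) (d ξ)) ∧
      -- it is a first integral of the averaged slow flow, along `ξ = H₀(J)`
      ∀ (F Ω : ℝ) (s : Set ℝ) (J ϑ : ℝ → ℝ), s.OrdConnected → IsSlowFlow α β F Ω s J ϑ →
        ∃ C₀ : ℝ, ∀ t ∈ s, ∀ ξ : ℝ, ξ = energyOfAction α β (J t) →
          ξ - F * closedG (a ξ) (b ξ) (c ξ) (d ξ) (ν ξ) * (sin (ϑ t) : ℝ) -
            Ω * closedAction β (a ξ) (b ξ) (c ξ) (d ξ) = (C₀ : ℂ) := by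
  have hfam : ∀ (a b c d : ℝ → ℝ) (ν : ℝ → ℂ),
      (∀ ξ ∈ Ioo 0 (barrier α β), IsDescendingRoots α β ξ (a ξ) (b ξ) (c ξ) (d ξ) ∧
        IsNu (a ξ) (b ξ) (c ξ) (d ξ) (ν ξ)) → RootFamily α β a b c d :=
    fun a b c d ν h ξ hξ => (h ξ hξ).1.rootsSpec hβ hξ
  obtain ⟨a, b, c, d, hR⟩ : ∃ a b c d, RootFamily α β a b c d := by
    -- Root functions must be defined for all real `ξ`; outside the energy range their values are
    -- dummies.
    have h (ξ : ℝ) : ∃ a b c d, ξ ∈ Ioo 0 (barrier α β) → RootsSpec α β ξ a b c d := by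
      by_cases hξ : ξ ∈ Ioo 0 (barrier α β)
      · obtain ⟨a, b, c, d, h⟩ := exists_rootsSpec hβ hξ
        exact ⟨a, b, c, d, fun _ => h⟩
      · exact ⟨0, 0, 0, 0, fun h => absurd h hξ⟩
    choose a b c d h using h
    exact ⟨a, b, c, d, h⟩
  refine ⟨barrier_of_nonneg hβ, barrier_of_nonpos hβ, hR.strictMonoOn_actionVar hβ,
    fun E hE => ?_, fun ξ hξ => ⟨existsUnique_roots hβ hξ, fun a b c d h =>
      existsUnique_isNu h.2.2.1 h.2.1 h.1⟩, fun a b c d ν hν => ⟨fun ξ hξ => ?_, ?_⟩⟩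
  · obtain ⟨hcd, hbc, hab⟩ := (hR E hE).order hβ
    obtain ⟨G', -, hq⟩ := hR.hasDerivAt_realG_energyOfAction hβ hE
    rw [(hR E hE).qLeft_eq hβ, (hR E hE).qRight_eq hβ, hR.position_eq hβ hE]
    exact ⟨(hR.hasDerivAt_energyOfAction hβ hE).differentiableAt, hq.differentiableAt,
      fun q hq => ⟨(hR.hasDerivAt_phaseUp_action hβ hE hq).differentiableAt,
        (hR.hasDerivAt_phaseDown_action hβ hE hq).differentiableAt⟩,
      hR.bijOn_angleUp hβ hE, hR.bijOn_angleDown hβ hE, continuous_anglePos hcd hbc hab⟩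
  · have hR := hfam a b c d ν hν
    obtain ⟨hcd, hbc, hab⟩ := (hR ξ hξ).order hβ
    have hG := closedG_eq_realG hcd hbc hab (hν ξ hξ).2
    have hq := hR.qHarmonic_eq_realG hβ hξ
    have hJ := (hR ξ hξ).actionVar_eq_closedAction hβ
    refine ⟨(hR ξ hξ).qLeft_eq hβ, (hR ξ hξ).qRight_eq hβ, modulus_mem hcd hbc hab, hJ, ?_,
      ⟨cnArg (a ξ) (b ξ) (c ξ) (d ξ), cnArg_mem hcd hbc hab, jacobiCn_cnArg hcd hbc hab, hG⟩,
      fun F Ω ϑ => ?_⟩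
    · rw [hq, hG, Complex.ofReal_neg]
    · rw [conservedQuantity_eq hq, hG, hJ]
      push_cast
      rfl
  · intro F Ω s J ϑ hs hflow
    have hR := hfam a b c d ν hν
    obtain ⟨C₀, hC⟩ := hR.isSlowFlow_conserved hβ hs hflow
    refine ⟨C₀, ?_⟩
    rintro t ht ξ rfl
    obtain ⟨E, hE, hEJ⟩ := (hflow t ht).1
    have hξ : energyOfAction α β (J t) = E := by rw [← hEJ, hR.energyOfAction_actionVar hβ hE]
    have := hC t ht
    obtain ⟨hcd, hbc, hab⟩ := (hR E hE).order hβ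
    rw [hξ, ← hEJ, (hR E hE).actionVar_eq_closedAction hβ] at this
    rw [hξ, closedG_eq_realG hcd hbc hab (hν E hE).2, ← this]
    push_cast
    rfl
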